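/- Let $\kappa$ be an algebraically closed field with $\operatorname{char}\kappa\neq 2$, let $n\ge 0$ and $G=\mathrm{Sp}_{2n}(\kappa)$, acting by conjugation on the set $\mathfrak n$ of nilpotent elements of $\mathfrak{sp}_{2n}(\kappa)$. For $x\in\mathfrak n$ let $\mathcal O(x)=G\cdot x$, and let $\pi(x)$ be the partition of $2n$ given by the sizes of the Jordan blocks of $x$. Call a partition of $2n$ symplectic if each odd part has even multiplicity. For $x,y\in\mathfrak n$, $\mathcal O(y)$ is $1$-accessible from $\mathcal O(x)$ if there is a cocharacter $\lambda:\mathbb G_m\to G$ such that $\lim_{a\to0}\lambda(a)\cdot x$ exists (i.e. $a\mapsto\lambda(a)\cdot x$ extends to a morphism on $\mathbb A^1$) and lies in $\mathcal O(y)$; $\mathcal O(y)$ is accessible from $\mathcal O(x)$ if it can be reached by a finite chain of $1$-accessible steps. Consider the following moves on partitions, where only the parts that change are written, all other parts are arbitrary and stay unchanged, and parts equal to $0$ are allowed and ignored: 1. $[2a,2b]\to[a+b,a+b]$, with $a>b\ge0$; 2. $[2a,m,m]\to[2a-2,m+1,m+1]$, with $2a-2\ge m+1$, $m\ge 0$;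 3. $[m,m,2a]\to[m-1,m-1,2a+2]$, with $m-1\ge 2a+2$, $a\ge 0$; 4. $[m,m,k,k]\to[m-1,m-1,k+1,k+1]$, with $m-1\ge k+1$, $k\ge 0$; 5. $[2r,2s]\to[2r-2,2s+2]$, with $2r-2>2s+2$, $s\ge 0$. Then: (i) For all $x,y\in\mathfrak n$, the orbit $\mathcal O(y)$ is accessible from $\mathcal O(x)$ if and only if $\pi(y)$ is obtained from $\pi(x)$ by a finite (possibly empty) sequence of moves of types 1–4. (ii) If $x,y\in\mathfrak n$ are such that $\pi(y)$ is obtained from $\pi(x)$ by a move of type 5, and $\pi(x)$ and $\pi(y)$ are adjacent in the dominance order on symplectic partitions of $2n$ (no symplectic partition lies strictly between them), then $\mathcal O(y)$ is not accessible from $\mathcal O(x)$. (iii) If $\mathcal O(y)$ is accessible from $\mathcal O(x)$, then $\overline{\mathcal O(y)}\subseteq\overline{\mathcal O(x)}$ (Zariski closures) and $\pi(x)$ dominates $\pi(y)$. If $n\ge 3$, the accessibility order is strictly smaller than the dominance order: there are $x,y\in\mathfrak n$ such that $\overline{\mathcal O(y)}\subseteq\overline{\mathcal O(x)}$ and $\pi(x)$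 dominates $\pi(y)$, but $\mathcal O(y)$ is not accessible from $\mathcal O(x)$. -/

import Mathlib

namespace SympAccess

open Polynomial

/-! ### Nilpotent elements of the symplectic Lie algebra and their orbits -/

/-- The set of nilpotent elements of `sp_{2n}(κ)`, as a type. -/
abbrev NilCone (n : ℕ) (κ : Type*) [Field κ] : Type _ :=
  {x : Matrix (Fin n ⊕ Fin n) (Fin n ⊕ Fin n) κ //
    x ∈ LieAlgebra.Symplectic.sp (Fin n) κ ∧ IsNilpotent x}

/-- The orbit of `x` under conjugation by `Sp_{2n}(κ)`. -/
def orbit {n : ℕ} {κ : Type*} [Field κ] (x : NilCone n κ) : Set (NilCone n κ) :=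
  {y | ∃ g : Matrix.symplecticGroup (Fin n) κ,
    (y : Matrix (Fin n ⊕ Fin n) (Fin n ⊕ Fin n) κ) =
      (g : Matrix (Fin n ⊕ Fin n) (Fin n ⊕ Fin n) κ) * x *
        ((g⁻¹ : Matrix.symplecticGroup (Fin n) κ) :
          Matrix (Fin n ⊕ Fin n) (Fin n ⊕ Fin n) κ)}

/-! ### Cocharacters, limits and accessibility -/

/-- A cocharacter of `Sp_{2n}`: a group homomorphism from the multiplicative group of `κ` all of
whose matrix entries are regular functions (Laurent polynomials). -/
structure Cocharacter (n : ℕ) (κ : Type*) [Field κ] where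
  /-- the underlying homomorphism of groups -/
  toHom : κˣ →* Matrix.symplecticGroup (Fin n) κ
  /-- the homomorphism is a morphism of varieties -/
  regular : ∃ P : Matrix (Fin n ⊕ Fin n) (Fin n ⊕ Fin n) (LaurentPolynomial κ),
    ∀ (a : κˣ) (i j : Fin n ⊕ Fin n),
      (toHom a : Matrix (Fin n ⊕ Fin n) (Fin n ⊕ Fin n) κ) i j =
        LaurentPolynomial.eval₂ (RingHom.id κ) a (P i j)

/-- `IsLimit c x y`: the morphism `a ↦ c(a) x c(a)⁻¹` from the punctured affine line extends to
the affine line (its entries are given by polynomials in `a`), and `y` is its value at `0`. -/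
def IsLimit {n : ℕ} {κ : Type*} [Field κ] (c : Cocharacter n κ) (x y : NilCone n κ) : Prop :=
  ∃ P : Matrix (Fin n ⊕ Fin n) (Fin n ⊕ Fin n) κ[X],
    (∀ a : κˣ, P.map (Polynomial.eval (a : κ)) =
      (c.toHom a : Matrix (Fin n ⊕ Fin n) (Fin n ⊕ Fin n) κ) * x *
        (((c.toHom a)⁻¹ : Matrix.symplecticGroup (Fin n) κ) :
          Matrix (Fin n ⊕ Fin n) (Fin n ⊕ Fin n) κ)) ∧
    P.map (Polynomial.eval 0) = y

/-- The orbit of `y` is 1-accessible from the orbit of `x`. -/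
def OneAccessible {n : ℕ} {κ : Type*} [Field κ] (x y : NilCone n κ) : Prop :=
  ∃ (c : Cocharacter n κ) (z : NilCone n κ), IsLimit c x z ∧ z ∈ orbit y

/-- The orbit of `y` is accessible from the orbit of `x`: there is a finite chain of
1-accessible steps from `x` to `y`. -/
def Accessible {n : ℕ} {κ : Type*} [Field κ] (x y : NilCone n κ) : Prop :=
  Relation.ReflTransGen OneAccessible x y

/-! ### The dominance order on orbits (Zariski closures) -/

/-- The Zariski closure, in the affine space of all matrices, of a set of nilpotent elements. -/
def zariskiClosure {n : ℕ} {κ : Type*} [Field κ] (S : Set (NilCone n κ)) :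
    Set (Matrix (Fin n ⊕ Fin n) (Fin n ⊕ Fin n) κ) :=
  {y | ∀ f : MvPolynomial ((Fin n ⊕ Fin n) × (Fin n ⊕ Fin n)) κ,
    (∀ x ∈ S, MvPolynomial.eval (fun ij => x.1 ij.1 ij.2) f = 0) →
      MvPolynomial.eval (fun ij => y ij.1 ij.2) f = 0}

/-- The dominance order on orbits: the closure of the orbit of `y` is contained in the closure of
the orbit of `x`. -/
def OrbitLE {n : ℕ} {κ : Type*} [Field κ] (y x : NilCone n κ) : Prop :=
  zariskiClosure (orbit y) ⊆ zariskiClosure (orbit x)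

/-! ### Partitions labelling nilpotent elements -/

/-- The direct sum of the standard nilpotent Jordan blocks whose sizes are the entries of `l`. -/
def jordanMatrix (κ : Type*) [Field κ] (l : List ℕ) :
    Matrix (Σ i : Fin l.length, Fin (l.get i)) (Σ i : Fin l.length, Fin (l.get i)) κ :=
  Matrix.blockDiagonal' fun i => Matrix.of fun a b : Fin (l.get i) =>
    if (a : ℕ) + 1 = b then 1 else 0

/-- `x` has partition `π`: in some basis, `x` is the direct sum of nilpotent Jordan blocks whose
sizes are the parts of `π`. -/
def HasPartition {n : ℕ} {κ : Type*} [Field κ] (x : NilCone n κ) (π : (2 * n).Partition) : Prop :=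
  ∃ l : List ℕ, (l : Multiset ℕ) = π.parts ∧
    ∃ b : Module.Basis (Σ i : Fin l.length, Fin (l.get i)) κ (Fin n ⊕ Fin n → κ),
      LinearMap.toMatrix b b (Matrix.toLin' x.1) = jordanMatrix κ l

/-- Every odd part has even multiplicity. -/
def IsSymplectic {N : ℕ} (π : N.Partition) : Prop :=
  ∀ r, Odd r → Even (π.parts.count r)

/-- The sum of the `k` largest parts of `π`. -/
def topSum {N : ℕ} (π : N.Partition) (k : ℕ) : ℕ :=
  ((π.parts.sort (· ≥ ·)).take k).sum

/-- `π` dominates `ρ`. -/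
def Dominates {N : ℕ} (π ρ : N.Partition) : Prop :=
  ∀ k, topSum ρ k ≤ topSum π k

/-- `ρ` lies directly below `π` in the dominance order on symplectic partitions. -/
def Adjacent {N : ℕ} (π ρ : N.Partition) : Prop :=
  Dominates π ρ ∧ π ≠ ρ ∧
    ∀ σ : N.Partition, IsSymplectic σ → Dominates π σ → Dominates σ ρ → σ = π ∨ σ = ρ

/-! ### Moves -/

/-- `ρ` arises from `π` by replacing the parts `A` by the parts `B` and leaving all other parts
unchanged. Parts equal to zero are allowed in `A` and `B` and are ignored in `π` and `ρ`. -/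
def Replaces {N : ℕ} (A B : Multiset ℕ) (π ρ : N.Partition) : Prop :=
  ∃ μ : Multiset ℕ, π.parts = (μ + A).filter (0 < ·) ∧ ρ.parts = (μ + B).filter (0 < ·)

/-- `[2a, 2b] → [a+b, a+b]` for `a > b ≥ 0`. -/
def Move1 {N : ℕ} (π ρ : N.Partition) : Prop :=
  ∃ a b, b < a ∧ Replaces {2 * a, 2 * b} {a + b, a + b} π ρ

/-- `[2a, m, m] → [2a-2, m+1, m+1]` for `2a - 2 ≥ m + 1`. -/
def Move2 {N : ℕ} (π ρ : N.Partition) : Prop :=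
  ∃ a m, m + 1 + 2 ≤ 2 * a ∧ Replaces {2 * a, m, m} {2 * a - 2, m + 1, m + 1} π ρ

/-- `[m, m, 2a] → [m-1, m-1, 2a+2]` for `m - 1 ≥ 2a + 2`. -/
def Move3 {N : ℕ} (π ρ : N.Partition) : Prop :=
  ∃ m a, 2 * a + 2 + 1 ≤ m ∧ Replaces {m, m, 2 * a} {m - 1, m - 1, 2 * a + 2} π ρ

/-- `[m, m, k, k] → [m-1, m-1, k+1, k+1]` for `m - 1 ≥ k + 1`. -/
def Move4 {N : ℕ} (π ρ : N.Partition) : Prop :=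
  ∃ m k, k + 1 + 1 ≤ m ∧ Replaces {m, m, k, k} {m - 1, m - 1, k + 1, k + 1} π ρ

/-- `[2r, 2s] → [2r-2, 2s+2]` for `2r - 2 > 2s + 2`. (When `2r - 2 = 2s + 2` this is an instance
of `Move1`.) -/
def Move5 {N : ℕ} (π ρ : N.Partition) : Prop :=
  ∃ r s, s + 3 ≤ r ∧ Replaces {2 * r, 2 * s} {2 * r - 2, 2 * s + 2} π ρ

/-- One move of type 1, 2, 3 or 4. -/
def Move {N : ℕ} (π ρ : N.Partition) : Prop :=
  Move1 π ρ ∨ Move2 π ρ ∨ Move3 π ρ ∨ Move4 π ρ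

end SympAccess

open SympAccess

/-!
Write `c j` for the dimension of the kernel of `x ^ j`. The multiplicity of the part `j ≥ 1` in the
partition of `x` is `2 c j - c (j - 1) - c (j + 1)` (`kerDim`, `mult`, `mult_kerSum`), so the moves
can be followed on multiplicity functions (`Reach`), and these functions can be computed on
arbitrary symplectic spaces with a nilpotent skew endomorphism (`IsSN`).

*Accessible orbits are related by moves.* A cocharacter grades the space by its weights, and the
limit of `x` is its component of weight `0` (`Cocharacter.exists_weights`, `IsLimit.reach`).
Separating one pair of weights `t`, `-t` from the others at a time (`Grading.reach`), one may
assume that the weights are `1, 0, -1`. Then the part of weight `1` is an isotropic stable subspace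
`F`, and the limit acts on `F ⊕ F^⊥ / F ⊕ V / F^⊥`, where the last summand is dual to the first
(`Degen.kerDim_eq`). Splitting off a cyclic subspace of maximal order from `F` reduces the
comparison of Jordan types to a cyclic subspace `W` (`isoStable_reach`). If one reduces by the
lines of the socle filtration of `W` one by one, the partition of `V` is obtained from that of `W^⊥
/ W` by adding two boxes at a time, in increasing heights: either a pair of parts `h - 1` becomes a
pair of parts `h`, or a part `h - 2` becomes a part `h`, with `h` even (`cyc_admissible`). A
combinatorial induction shows that the four moves take all the added boxes off again and collect
them in a new pair of parts (`reach_of_admissible`).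

*Moves are limits.* The space is a sum of orthogonal blocks: cyclic ones of even size and pairs of
dual isotropic ones (`exists_eBlock_orth`, `exists_dBlock_orth`). For each of the four moves an
explicit isotropic stable subspace `F` of the sum of the blocks concerned has a graded space of the
new Jordan type (`exists_realizes_move1` to `exists_realizes_move4`), and an isotropic complement
of `F^⊥` defines a cocharacter whose limit is the graded endomorphism (`exists_degen`,
`Degen.isLimit`). As elements of equal Jordan type are conjugate (`mem_orbit_of_kerDim`), this
limit lies in the expected orbit. The conjugating isometry is found as an isotropic stable subspace
of `V × V'`, a sum of pieces belonging to the blocks.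

*Comparison with the dominance order.* A limit along a cocharacter lies in the closure of the
orbit, and the moves enlarge the kernels of the powers, which is the dominance order
(`dominates_of_kerSum_le`). Every move raises some multiplicity by at least two
(`Move.exists_add_two_le`), which a move of type 5 never does. Between adjacent partitions,
accessibility would be a single move, so a move of type 5 is not realized. Likewise a partition
with distinct parts is never the result of a move, but the orbit with two blocks of sizes `2n - 2`
and `2` lies in the closure of the regular orbit, by an explicit curve (`curve`).
-/

namespace SympAccess

section

/-! ### The moves on multiplicity functions -/

/-- The multiplicity function of the partition with the single part `k`. -/
def ind (k : ℕ) : ℕ → ℤ := fun j => if j = k then 1 else 0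

/-- `MoveData A B`: one of the four moves replaces parts with multiplicity function `A` by parts
with multiplicity function `B`. -/
inductive MoveData : (ℕ → ℤ) → (ℕ → ℤ) → Prop
  | m1 (a b : ℕ) (h : b < a) :
      MoveData (fun j => ind (2 * a) j + ind (2 * b) j) (fun j => 2 * ind (a + b) j)
  | m2 (a m : ℕ) (h : m + 1 + 2 ≤ 2 * a) :
      MoveData (fun j => ind (2 * a) j + 2 * ind m j)
        (fun j => ind (2 * a - 2) j + 2 * ind (m + 1) j)
  | m3 (m a : ℕ) (h : 2 * a + 2 + 1 ≤ m) :
      MoveData (fun j => 2 * ind m j + ind (2 * a) j)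
        (fun j => 2 * ind (m - 1) j + ind (2 * a + 2) j)
  | m4 (m k : ℕ) (h : k + 1 + 1 ≤ m) :
      MoveData (fun j => 2 * ind m j + 2 * ind k j)
        (fun j => 2 * ind (m - 1) j + 2 * ind (k + 1) j)

/-- A multiplicity function: the multiplicities of the positive parts are nonnegative. The value
at `0` is irrelevant. -/
def Valid (f : ℕ → ℤ) : Prop := ∀ j, 1 ≤ j → 0 ≤ f j

/-- One move, or no move at all, on multiplicity functions; only the values at positive arguments
matter. -/
def FStep (f g : ℕ → ℤ) : Prop :=
  (∀ j, 1 ≤ j → f j = g j) ∨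
  ∃ A B, MoveData A B ∧ (∀ j, 1 ≤ j → A j ≤ f j) ∧ ∀ j, 1 ≤ j → g j = f j - A j + B j

/-- A finite sequence of moves on multiplicity functions. -/
def Reach : (ℕ → ℤ) → (ℕ → ℤ) → Prop := Relation.ReflTransGen FStep

theorem Reach.of_eq {f g : ℕ → ℤ} (h : ∀ j, 1 ≤ j → f j = g j) : Reach f g :=
  Relation.ReflTransGen.single (Or.inl h)

theorem Reach.trans {f g h : ℕ → ℤ} (h₁ : Reach f g) (h₂ : Reach g h) : Reach f h :=
  Relation.ReflTransGen.trans h₁ h₂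

theorem Reach.of_data {f g A B : ℕ → ℤ} (h : MoveData A B) (hA : ∀ j, 1 ≤ j → A j ≤ f j)
    (hB : ∀ j, 1 ≤ j → g j = f j - A j + B j) : Reach f g :=
  Relation.ReflTransGen.single (Or.inr ⟨A, B, h, hA, hB⟩)

/-- Parts that are present throughout do not interfere with a sequence of moves. -/
theorem Reach.add_right {f g r : ℕ → ℤ} (h : Reach f g) (hr : Valid r) :
    Reach (fun j => f j + r j) (fun j => g j + r j) := by
  induction h with
  | refl => exact Relation.ReflTransGen.refl
  | tail _ hs ih =>
    refine ih.trans (Relation.ReflTransGen.single ?_)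
    rcases hs with hs | ⟨A, B, hd, hA, hB⟩
    · exact Or.inl fun j hj => by simp only [hs j hj]
    · refine Or.inr ⟨A, B, hd, fun j hj => ?_, fun j hj => ?_⟩
      · have := hA j hj
        have := hr j hj
        linarith
      · simp only [hB j hj]
        ring

/-! ### Additions of boxes -/

/-- The change of the multiplicity function when a pair of parts `h - 1` becomes a pair of parts
`h` (first component `false`), or a part `h - 2` becomes a part `h` (first component `true`). -/
def delta (a : Bool × ℕ) : ℕ → ℤ := fun j =>
  if a.1 then ind a.2 j - ind (a.2 - 2) j else 2 * ind a.2 j - 2 * ind (a.2 - 1) j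

/-- The total change produced by a list of additions. -/
def total : List (Bool × ℕ) → ℕ → ℤ
  | [] => fun _ => 0
  | a :: L => fun j => delta a j + total L j

@[simp] theorem total_nil (j : ℕ) : total [] j = 0 := rfl

@[simp] theorem total_cons (a : Bool × ℕ) (L : List (Bool × ℕ)) (j : ℕ) :
    total (a :: L) j = delta a j + total L j := rfl

@[simp] theorem total_append (L M : List (Bool × ℕ)) (j : ℕ) :
    total (L ++ M) j = total L j + total M j := by
  induction L with
  | nil => simp
  | cons a L ih => simp [ih, add_assoc]

/-- `b` may be carried out after `a`: its parts are larger, by at least two if `b` changes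
a single part. -/
def Lower (a b : Bool × ℕ) : Prop := a.2 < b.2 ∧ (b.1 = true → a.2 + 2 ≤ b.2)

/-- The addition `a` only concerns parts that are at least `q`. -/
def Above (q : ℕ) (a : Bool × ℕ) : Prop :=
  (a.1 = true → q + 2 ≤ a.2 ∧ Even a.2) ∧ (a.1 = false → q + 1 ≤ a.2)

/-- An admissible list of additions to the multiplicity function `f`: all intermediate functions
are valid. -/
structure Admissible (q : ℕ) (f : ℕ → ℤ) (L : List (Bool × ℕ)) : Prop where
  above : ∀ a ∈ L, Above q a
  pairwise : L.Pairwise Lower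
  valid : ∀ t, t <+: L → Valid fun j => f j + total t j

theorem total_nonneg {L : List (Bool × ℕ)} {j : ℕ} (h : ∀ a ∈ L, 0 ≤ delta a j) :
    0 ≤ total L j := by
  induction L with
  | nil => simp
  | cons a L ih =>
    have h1 := h a (by simp)
    have h2 := ih fun b hb => h b (by simp [hb])
    simp only [total_cons]
    omega

/-- Additions above `q` do not use up parts smaller than `q`. -/
theorem total_nonneg_of_lt {q j : ℕ} {L : List (Bool × ℕ)} (h : ∀ a ∈ L, Above q a)
    (hj : j < q) : 0 ≤ total L j := by
  refine total_nonneg fun a ha => ?_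
  obtain ⟨h1, h2⟩ := h a ha
  rcases a with ⟨_ | _, k⟩ <;> simp only [delta, ind] at * <;> simp at h1 h2 ⊢ <;>
    split_ifs <;> omega

theorem Admissible.congr {q q' : ℕ} {f g : ℕ → ℤ} {L : List (Bool × ℕ)} (h : Admissible q f L)
    (ha : ∀ a ∈ L, Above q' a)
    (hv : ∀ t, t <+: L → ∀ j, 1 ≤ j → 0 ≤ f j + total t j → 0 ≤ g j + total t j) :
    Admissible q' g L :=
  ⟨ha, h.pairwise, fun t ht j hj => hv t ht j hj (h.valid t ht j hj)⟩

theorem Admissible.left {q : ℕ} {f : ℕ → ℤ} {L M : List (Bool × ℕ)}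
    (h : Admissible q f (L ++ M)) : Admissible q f L :=
  ⟨fun a ha => h.above a (by simp [ha]), (List.pairwise_append.1 h.pairwise).1,
    fun t ht => h.valid t (ht.trans (List.prefix_append _ _))⟩

theorem Admissible.right {q : ℕ} {f : ℕ → ℤ} {L M : List (Bool × ℕ)}
    (h : Admissible q f (L ++ M)) : Admissible q (fun j => f j + total L j) M :=
  ⟨fun a ha => h.above a (by simp [ha]), (List.pairwise_append.1 h.pairwise).2.1,
    fun t ht j hj => by
      have := h.valid (L ++ t) ((List.prefix_append_right_inj L).2 ht) j hj
      simpa [add_assoc] using this⟩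

theorem Admissible.last {q : ℕ} {f : ℕ → ℤ} {L : List (Bool × ℕ)} (h : Admissible q f L) :
    Valid fun j => f j + total L j := h.valid L List.prefix_rfl

theorem Admissible.first {q : ℕ} {f : ℕ → ℤ} {L : List (Bool × ℕ)} (h : Admissible q f L) :
    Valid f := fun j hj => by simpa using h.valid [] List.nil_prefix j hj

theorem Admissible.append {q : ℕ} {f : ℕ → ℤ} {L M : List (Bool × ℕ)}
    (hL : Admissible q f L) (hM : Admissible q (fun j => f j + total L j) M)
    (hLM : ∀ a ∈ L, ∀ b ∈ M, Lower a b) : Admissible q f (L ++ M) := by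
  refine ⟨fun a ha => ?_, List.pairwise_append.2 ⟨hL.pairwise, hM.pairwise, hLM⟩,
    fun t ht => ?_⟩
  · rcases List.mem_append.1 ha with h | h
    exacts [hL.above a h, hM.above a h]
  · obtain ⟨u, hu⟩ := ht
    rcases List.append_eq_append_iff.1 hu with ⟨s, hs, -⟩ | ⟨s, rfl, hs⟩
    · exact hL.valid t ⟨s, hs.symm⟩
    · intro j hj
      have := hM.valid s ⟨u, hs.symm⟩ j hj
      simpa [add_assoc] using this

end

/-! ### Collapsing added boxes -/

section

/-- The parts `p` and `q` together with the parts of `σ`. -/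
def base (p q : ℕ) (σ : ℕ → ℤ) : ℕ → ℤ := fun j => ind p j + ind q j + σ j

/-- The claim of `reach_of_admissible` for lists of length less than `n`. -/
def Collapses (n : ℕ) : Prop :=
  ∀ (p q : ℕ) (σ : ℕ → ℤ) (L : List (Bool × ℕ)) (f : ℕ), L.length < n →
    (p = q ∨ p < q ∧ Even p ∧ Even q) → Valid σ → Admissible q (base p q σ) L →
    2 * f = p + q + 2 * L.length →
    Reach (fun j => base p q σ j + total L j) (fun j => 2 * ind f j + σ j)

/-- The top addition is a single part: it is undone while the pair `p, p` becomes
`p + 1, p + 1`. -/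
theorem reach_top_true {p h : ℕ} {σ : ℕ → ℤ} {L : List (Bool × ℕ)} (hh : Even h)
    (hσ : Valid σ) (hp : p + 3 ≤ h) (hL : ∀ a ∈ L, Above (p + 1) a)
    (hv : Valid fun j => base p p σ j + total L j)
    (hw : Valid fun j => base p p σ j + total (L ++ [(true, h)]) j) :
    Reach (fun j => base p p σ j + total (L ++ [(true, h)]) j)
      (fun j => base (p + 1) (p + 1) σ j + total L j) := by
  obtain ⟨k, rfl⟩ := hh
  have h0 := total_nonneg_of_lt hL (Nat.lt_succ_self p)
  refine Reach.of_data (MoveData.m2 k p (by omega)) (fun j hj => ?_) (fun j hj => ?_)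
  · have h1 := hσ j hj
    have h2 := hv j hj
    have h3 := hw j hj
    simp only [base, total_append, total_cons, total_nil, delta, ind, if_true] at *
    by_cases hjp : j = p
    · subst hjp
      simp at *
      split_ifs <;> omega
    · simp [hjp] at *
      split_ifs at * <;> omega
  · simp only [base, total_append, total_cons, total_nil, delta, ind, if_true]
    rw [show k + k - 2 = 2 * k - 2 by omega, show k + k = 2 * k by omega]
    ring

/-- The top addition is a pair: it is undone while the pair `p, p` becomes `p + 1, p + 1`. -/
theorem reach_top_false {p h : ℕ} {σ : ℕ → ℤ} {L : List (Bool × ℕ)}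
    (hσ : Valid σ) (hp : p + 2 ≤ h) (hL : ∀ a ∈ L, Above (p + 1) a)
    (hv : Valid fun j => base p p σ j + total L j)
    (hw : Valid fun j => base p p σ j + total (L ++ [(false, h)]) j) :
    Reach (fun j => base p p σ j + total (L ++ [(false, h)]) j)
      (fun j => base (p + 1) (p + 1) σ j + total L j) := by
  have h0 := total_nonneg_of_lt hL (Nat.lt_succ_self p)
  refine Reach.of_data (MoveData.m4 h p (by omega)) (fun j hj => ?_) (fun j hj => ?_)
  · have h1 := hσ j hj
    have h2 := hv j hj
    have h3 := hw j hj
    simp only [base, total_append, total_cons, total_nil, delta, ind] at *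
    by_cases hjp : j = p
    · subst hjp
      simp at *
      split_ifs <;> omega
    · simp [hjp] at *
      split_ifs at * <;> omega
  · simp only [base, total_append, total_cons, total_nil, delta, ind, Bool.false_eq_true,
      if_false]
    ring

/-- The case of two equal parts `p, p`. Either the first addition is applied to this pair, and it is
absorbed into it, or the top addition is undone by a move of type 2 or 4 which enlarges the pair. -/
theorem Collapses.of_eq {L : List (Bool × ℕ)} (IH : Collapses L.length) {p f : ℕ} {σ : ℕ → ℤ}
    (hne : L ≠ []) (hσ : Valid σ) (hL : Admissible p (base p p σ) L)
    (hf : 2 * f = p + p + 2 * L.length) :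
    Reach (fun j => base p p σ j + total L j) (fun j => 2 * ind f j + σ j) := by
  by_cases hlow : ∀ a ∈ L, Above (p + 1) a
  · -- the pair `p, p` is not used by `L`, and the top addition is undone
    obtain rfl | ⟨I, ⟨e, h⟩, rfl⟩ := List.eq_nil_or_concat' L
    · exact absurd rfl hne
    have hI := hL.left
    have hIa : ∀ a ∈ I, Above (p + 1) a := fun a ha => hlow a (by simp [ha])
    have hta := hlow (e, h) (by simp)
    have hv := hI.last
    have hw := hL.last
    have hstep : Reach (fun j => base p p σ j + total (I ++ [(e, h)]) j)
        (fun j => base (p + 1) (p + 1) σ j + total I j) := by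
      cases e
      · exact reach_top_false hσ (hta.2 rfl) hIa hv hw
      · exact reach_top_true (hta.1 rfl).2 hσ (hta.1 rfl).1 hIa hv hw
    refine hstep.trans (IH _ _ _ _ _ (by simp) (Or.inl rfl) hσ
      (hI.congr hIa fun t ht j hj hnn => ?_) (by simp at hf; omega))
    have h0 : 0 ≤ total t p :=
      total_nonneg_of_lt (fun a ha => hIa a (ht.subset ha)) (Nat.lt_succ_self p)
    have h1 := hσ j hj
    simp only [base, ind] at hnn ⊢
    by_cases hjp : j = p
    · subst hjp
      simp
      omega
    · simp [hjp] at hnn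
      split_ifs <;> omega
  · -- the first addition is applied to the pair `p, p` itself
    obtain - | ⟨⟨e, h⟩, M⟩ := L
    · exact absurd rfl hne
    have hM : Admissible p (fun j => base p p σ j + total [(e, h)] j) M :=
      Admissible.right (L := [(e, h)]) hL
    have ha := hL.above (e, h) (by simp)
    have hlt : ∀ b ∈ M, Lower (e, h) b := (List.pairwise_cons.1 hL.pairwise).1
    cases e
    · have hh : h = p + 1 := by
        by_contra hne'
        refine hlow fun a ha' => ?_
        have h1 := ha.2 rfl
        rcases List.mem_cons.1 ha' with rfl | ha'
        · exact ⟨by simp, fun _ => by simp at *; omega⟩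
        · have h2 := hlt a ha'
          have h3 := hL.above a (by simp [ha'])
          exact ⟨fun h => ⟨by have := h2.2 h; simp at *; omega, (h3.1 h).2⟩,
            fun h => by have := h2.1; simp at *; omega⟩
      subst hh
      refine (Reach.of_eq fun j hj => ?_).trans (IH (p + 1) (p + 1) σ M f (by simp) (Or.inl rfl)
        hσ (hM.congr (fun a ha' => ?_) fun t _ j hj hnn => ?_) (by simp at hf; omega))
      · simp only [base, total_cons, delta, Bool.false_eq_true, if_false,
          Nat.add_sub_cancel]
        ring
      · have h2 := hlt a ha'
        have h3 := hL.above a (by simp [ha'])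
        exact ⟨fun h => ⟨h2.2 h, (h3.1 h).2⟩, fun h => h2.1⟩
      · simp only [base, total_cons, total_nil, delta, Bool.false_eq_true, if_false,
          Nat.add_sub_cancel] at hnn ⊢
        linarith
    · have hev := (ha.1 rfl).2
      have hh : h = p + 2 := by
        by_contra hne'
        refine hlow fun a ha' => ?_
        have h1 := ha.1 rfl
        rcases List.mem_cons.1 ha' with rfl | ha'
        · exact ⟨fun _ => ⟨by simp at *; omega, h1.2⟩, by simp⟩
        · have h2 := hlt a ha'
          have h3 := hL.above a (by simp [ha'])
          exact ⟨fun h => ⟨by have := h2.2 h; simp at *; omega, (h3.1 h).2⟩,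
            fun h => by have := h2.1; simp at *; omega⟩
      subst hh
      have hpe : Even p := by
        simp only at hev
        rw [Nat.even_add] at hev
        simpa using hev
      refine (Reach.of_eq fun j hj => ?_).trans (IH p (p + 2) σ M f (by simp)
        (Or.inr ⟨by omega, hpe, hev⟩)
        hσ (hM.congr (fun a ha' => ?_) fun t _ j hj hnn => ?_) (by simp at hf; omega))
      · simp only [base, total_cons, delta, if_true,
          Nat.add_sub_cancel]
        ring
      · have h2 := hlt a ha'
        have h3 := hL.above a (by simp [ha'])
        exact ⟨fun h => ⟨h2.2 h, (h3.1 h).2⟩, fun h => h2.1⟩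
      · simp only [base, total_cons, total_nil, delta, if_true,
          Nat.add_sub_cancel] at hnn ⊢
        linarith

/-- The case of two distinct even parts `p < q` with a pair on top of the additions: the pair is
undone by a move of type 3, which enlarges `p` by two. -/
theorem Collapses.of_top_pair {I : List (Bool × ℕ)} {h : ℕ}
    (IH : Collapses (I ++ [(false, h)]).length) {p q f : ℕ} {σ : ℕ → ℤ}
    (hpq : p < q) (hp : Even p) (hq : Even q) (hσ : Valid σ)
    (hL : Admissible q (base p q σ) (I ++ [(false, h)]))
    (hf : 2 * f = p + q + 2 * (I ++ [(false, h)]).length) :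
    Reach (fun j => base p q σ j + total (I ++ [(false, h)]) j)
      (fun j => 2 * ind f j + σ j) := by
  have hI := hL.left
  have hh : q + 1 ≤ h := (hL.above (false, h) (by simp)).2 rfl
  have hv := hI.last
  have hw := hL.last
  have h0 := total_nonneg_of_lt hI.above hpq
  obtain ⟨a, rfl⟩ := hp
  obtain ⟨b, rfl⟩ := hq
  have hstep : Reach (fun j => base (a + a) (b + b) σ j + total (I ++ [(false, h)]) j)
      (fun j => base (a + a + 2) (b + b) σ j + total I j) := by
    refine Reach.of_data (MoveData.m3 h a (by omega)) (fun j hj => ?_) (fun j hj => ?_)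
    · have h1 := hσ j hj
      have h2 := hv j hj
      have h3 := hw j hj
      clear hf hL
      simp only [base, total_append, total_cons, total_nil, delta, ind, Bool.false_eq_true,
        if_false, show 2 * a = a + a from two_mul a] at h2 h3 ⊢
      split_ifs at h2 h3 ⊢ <;> subst_vars <;> omega
    · simp only [base, total_append, total_cons, total_nil, delta, ind, Bool.false_eq_true,
        if_false]
      rw [show a + a = 2 * a by omega]
      ring
  refine hstep.trans (IH _ _ _ _ _ (by simp) ?_ hσ (hI.congr hI.above fun t ht j hj hnn => ?_)
    (by simp at hf ⊢; omega))
  · rcases Nat.lt_or_ge (a + a + 2) (b + b) with h | h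
    · exact Or.inr ⟨h, ⟨a + 1, by ring⟩, ⟨b, rfl⟩⟩
    · exact Or.inl (by omega)
  · have h0 : 0 ≤ total t (a + a) :=
      total_nonneg_of_lt (fun a ha => hI.above a (ht.subset ha)) hpq
    have h1 := hσ j hj
    simp only [base, ind] at hnn ⊢
    by_cases hjp : j = a + a
    · subst hjp
      simp
      split_ifs <;> omega
    · simp [hjp] at hnn
      split_ifs at * <;> omega

/-- The case of two distinct even parts `p < q` when all additions change single parts. If `q` is
not changed by them, a move of type 1 replaces `p, q` by a pair, and `Collapses.of_eq` applies. -/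
theorem Collapses.of_singles {L : List (Bool × ℕ)} (IH : Collapses L.length) {p q f : ℕ}
    {σ : ℕ → ℤ} (hpq : p < q) (hp : Even p) (hq : Even q) (hσ : Valid σ)
    (hL : Admissible q (base p q σ) L) (hs : ∀ a ∈ L, a.1 = true)
    (hf : 2 * f = p + q + 2 * L.length) :
    Reach (fun j => base p q σ j + total L j) (fun j => 2 * ind f j + σ j) := by
  by_cases hlow : ∀ a ∈ L, Above (q + 1) a
  · -- the part `q` is not used by `L`, so `p, q` may be replaced by their mean
    obtain ⟨a, rfl⟩ := hp
    obtain ⟨b, rfl⟩ := hq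
    have h0 := total_nonneg_of_lt hlow (Nat.lt_succ_self _)
    have h0' := total_nonneg_of_lt hL.above hpq
    have hw := hL.last
    have hstep : Reach (fun j => base (a + a) (b + b) σ j + total L j)
        (fun j => base (b + a) (b + a) σ j + total L j) := by
      refine Reach.of_data (MoveData.m1 b a (by omega)) (fun j hj => ?_) (fun j hj => ?_)
      · have h1 := hσ j hj
        have h3 := hw j hj
        simp only [base, ind] at *
        by_cases hjp : j = a + a
        · subst hjp
          split_ifs at * <;> omega
        by_cases hjq : j = b + b
        · subst hjq
          split_ifs at * <;> omega
        rw [if_neg hjp, if_neg hjq] at h3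
        split_ifs <;> omega
      · simp only [base]
        rw [show a + a = 2 * a by omega, show b + b = 2 * b by omega]
        ring
    have hL' : Admissible (b + a) (base (b + a) (b + a) σ) L := by
      refine hL.congr (fun c hc => ?_) fun t ht j hj hnn => ?_
      · have := hL.above c hc
        exact ⟨fun h => ⟨by have := (this.1 h).1; omega, (this.1 h).2⟩,
          fun h => by have := this.2 h; omega⟩
      · have h0 : 0 ≤ total t (b + b) :=
          total_nonneg_of_lt (fun a ha => hlow a (ht.subset ha)) (Nat.lt_succ_self _)
        have h0' : 0 ≤ total t (a + a) :=
          total_nonneg_of_lt (fun a ha => hL.above a (ht.subset ha)) hpq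
        have h1 := hσ j hj
        simp only [base, ind] at *
        by_cases hjp : j = a + a
        · subst hjp
          split_ifs at * <;> omega
        by_cases hjq : j = b + b
        · subst hjq
          split_ifs at * <;> omega
        rw [if_neg hjp, if_neg hjq] at hnn
        split_ifs <;> omega
    refine hstep.trans ?_
    rcases eq_or_ne L [] with rfl | hne
    · simp at hf
      have hfb : f = b + a := by omega
      subst hfb
      exact Reach.of_eq fun j _ => by simp [base]; ring
    · exact IH.of_eq hne hσ hL' (by omega)
  · -- the first addition is applied to `q` itself
    obtain - | ⟨⟨e, h⟩, M⟩ := L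
    · simp at hlow
    have hM : Admissible q (fun j => base p q σ j + total [(e, h)] j) M :=
      Admissible.right (L := [(e, h)]) hL
    have ha := hL.above (e, h) (by simp)
    have hlt : ∀ b ∈ M, Lower (e, h) b := (List.pairwise_cons.1 hL.pairwise).1
    obtain rfl : e = true := hs (e, h) (by simp)
    have hev := (ha.1 rfl).2
    have hh : h = q + 2 := by
      by_contra hne'
      refine hlow fun a ha' => ?_
      have h1 := ha.1 rfl
      rcases List.mem_cons.1 ha' with rfl | ha'
      · exact ⟨fun _ => ⟨by simp at *; omega, h1.2⟩, by simp⟩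
      · have h2 := hlt a ha'
        have h3 := hL.above a (by simp [ha'])
        exact ⟨fun h => ⟨by have := h2.2 h; simp at *; omega, (h3.1 h).2⟩,
          fun h => by have := h2.1; simp at *; omega⟩
    subst hh
    refine (Reach.of_eq fun j hj => ?_).trans (IH p (q + 2) σ M f (by simp)
      (Or.inr ⟨by omega, hp, hev⟩)
      hσ (hM.congr (fun a ha' => ?_) fun t _ j hj hnn => ?_) (by simp at hf; omega))
    · simp only [base, total_cons, delta, if_true, Nat.add_sub_cancel]
      ring
    · have h2 := hlt a ha'
      have h3 := hL.above a (by simp [ha'])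
      exact ⟨fun h => ⟨h2.2 h, (h3.1 h).2⟩, fun h => h2.1⟩
    · simp only [base, total_cons, total_nil, delta, if_true, Nat.add_sub_cancel] at hnn ⊢
      linarith

/-- Consecutive pair additions `h + 1, …, h + n`. -/
def pairRun (h n : ℕ) : List (Bool × ℕ) := (List.range n).map fun i => (false, h + 1 + i)

theorem total_pairRun (h n j : ℕ) :
    total (pairRun h n) j = 2 * ind (h + n) j - 2 * ind h j := by
  induction n with
  | zero => simp [pairRun]
  | succ n ih =>
    have : pairRun h (n + 1) = pairRun h n ++ [(false, h + 1 + n)] := by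
      simp [pairRun, List.range_succ]
    rw [this, total_append, ih]
    simp only [total_cons, total_nil, delta, Bool.false_eq_true, if_false]
    rw [show h + 1 + n - 1 = h + n by omega, show h + 1 + n = h + (n + 1) by omega]
    ring

/-- A run of pair additions starts from a pair of parts `h`. -/
theorem admissible_pairRun {q h n : ℕ} {f : ℕ → ℤ} (hq : q ≤ h) (hf : Valid f)
    (hfh : 1 ≤ h → 2 ≤ f h) : Admissible q f (pairRun h n) := by
  refine ⟨fun a ha => ?_, ?_, fun t ht j hj => ?_⟩
  · obtain ⟨i, -, rfl⟩ := List.mem_map.1 ha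
    exact ⟨by simp, fun _ => by simp; omega⟩
  · exact List.pairwise_map.2 (List.pairwise_lt_range.imp fun h => ⟨by simpa using h, by simp⟩)
  · obtain ⟨m, rfl⟩ : ∃ m, t = pairRun h m := by
      refine ⟨min t.length n, ?_⟩
      rw [List.prefix_iff_eq_take, pairRun, ← List.map_take, List.take_range] at ht
      exact ht
    have h1 := hf j hj
    simp only [total_pairRun, ind]
    split_ifs with h2 h3 h3 <;> try omega
    subst h3
    have := hfh hj
    omega

/-- The case of two distinct even parts `p < q` when some addition creates a pair `h, h`. By
induction the later additions `E` can be collapsed onto this pair, so that the additions from `h` on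
are replaced by a run of pair additions; then the top addition is a pair. -/
theorem Collapses.of_mixed {L E : List (Bool × ℕ)} {h : ℕ}
    (IH : Collapses (L ++ (false, h) :: E).length) {p q f : ℕ}
    {σ : ℕ → ℤ} (hpq : p < q) (hp : Even p) (hq : Even q) (hσ : Valid σ)
    (hL : Admissible q (base p q σ) (L ++ (false, h) :: E))
    (hf : 2 * f = p + q + 2 * (L ++ (false, h) :: E).length) :
    Reach (fun j => base p q σ j + total (L ++ (false, h) :: E) j)
      (fun j => 2 * ind f j + σ j) := by
  have hh : q + 1 ≤ h := (hL.above (false, h) (by simp)).2 rfl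
  have hL1 := hL.left
  have hR := hL.right
  have hlast : Valid fun j => base p q σ j + total (L ++ [(false, h)]) j :=
    hL.valid _ ⟨E, by simp⟩
  have hcons := List.pairwise_cons.1 hR.pairwise
  -- the remaining parts once the pair `h, h` is set aside
  set τ : ℕ → ℤ := fun j => base p q σ j + total L j - 2 * ind (h - 1) j with hτ
  have hτv : Valid τ := fun j hj => by
    have h1 := hL1.last j hj
    have h2 := hlast j hj
    simp only [hτ, total_append, total_cons, total_nil, delta, ind] at *
    split_ifs at * <;> omega
  have hEadm : Admissible h (base h h τ) E := by
    have : Admissible q (fun j => (base p q σ j + total L j) + total [(false, h)] j) E :=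
      Admissible.right (L := [(false, h)]) hR
    refine this.congr (fun a ha => ?_) fun t ht j hj hnn => ?_
    · exact ⟨fun h' => ⟨(hcons.1 a ha).2 h', ((hR.above a (by simp [ha])).1 h').2⟩,
        fun h' => (hcons.1 a ha).1⟩
    · simp only [base, hτ, total_cons, total_nil, delta] at hnn ⊢
      simp at hnn
      linarith
  -- collapsing the additions `E` onto the pair `h, h`
  have hrun := IH h h τ E (h + E.length) (by simp; omega) (Or.inl rfl) hτv hEadm (by omega)
  have hadm : Admissible q (base p q σ) (L ++ pairRun (h - 1) (E.length + 1)) := by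
    refine hL1.append (admissible_pairRun (by omega) hL1.last fun h1 => ?_) fun a ha b hb => ?_
    · have h2 := hlast (h - 1) h1
      simp only [total_append, total_cons, total_nil, delta, ind] at h2
      have h3 : h - 1 ≠ h := by omega
      simp [h3] at h2
      omega
    · have := (List.pairwise_append.1 hL.pairwise).2.2 a ha (false, h) (by simp)
      obtain ⟨i, -, rfl⟩ := List.mem_map.1 hb
      exact ⟨by have := this.1; simp at *; omega, by simp⟩
  have hsplit : pairRun (h - 1) (E.length + 1) =
      pairRun (h - 1) E.length ++ [(false, h - 1 + 1 + E.length)] := by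
    simp [pairRun, List.range_succ]
  rw [hsplit, ← List.append_assoc] at hadm
  have hlen : (L ++ (false, h) :: E).length =
      (L ++ pairRun (h - 1) E.length ++ [(false, h - 1 + 1 + E.length)]).length := by
    simp [pairRun]
  rw [hlen] at IH hf
  refine Reach.trans ?_ (IH.of_top_pair hpq hp hq hσ hadm hf)
  refine (Reach.of_eq fun j hj => ?_).trans (hrun.trans (Reach.of_eq fun j hj => ?_))
  · simp only [base, hτ, total_append, total_cons, delta, Bool.false_eq_true, if_false]
    ring_nf
  · rw [List.append_assoc, ← hsplit, total_append, total_pairRun,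
      show h - 1 + (E.length + 1) = h + E.length by omega]
    simp only [hτ]
    ring

/-- If the parts of `f` arise from those of `σ` and two more parts `p, q` by an admissible list of
additions above `q`, then all the added boxes can be moved, by the four moves, to the parts
`p, q`, which become a pair. -/
theorem reach_of_admissible (n : ℕ) : Collapses n := by
  induction n with
  | zero => intro p q σ L f h; simp at h
  | succ n ih =>
    intro p q σ L f hn hpq hσ hL hf
    have IH : Collapses L.length := fun p q σ L' f h => ih p q σ L' f (by omega)
    rcases hpq with rfl | ⟨hpq, hp, hq⟩
    · rcases eq_or_ne L [] with rfl | hne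
      · have : f = p := by simp at hf; omega
        subst this
        exact Reach.of_eq fun j _ => by simp [base]; ring
      · exact IH.of_eq hne hσ hL hf
    · by_cases hs : ∀ a ∈ L, a.1 = true
      · exact IH.of_singles hpq hp hq hσ hL hs hf
      · push Not at hs
        obtain ⟨⟨_ | _, h⟩, ha, he⟩ := hs
        · obtain ⟨L₁, E, rfl⟩ := List.append_of_mem ha
          exact IH.of_mixed hpq hp hq hσ hL hf
        · simp at he

end

section

open Module

variable {κ : Type*} [Field κ] {V : Type*} [AddCommGroup V] [Module κ V]

/-! ### Nilpotent skew endomorphisms of symplectic spaces -/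

/-- `ω` is a symplectic form on `V` and `x` is a nilpotent element of its symplectic Lie
algebra. -/
structure IsSN (ω : LinearMap.BilinForm κ V) (x : End κ V) : Prop where
  alt : ω.IsAlt
  nondeg : ω.Nondegenerate
  skew : ∀ a b, ω (x a) b = -ω a (x b)
  nil : IsNilpotent x

theorem IsSN.skew_pow {ω : LinearMap.BilinForm κ V} {x : End κ V} (h : IsSN ω x) (i : ℕ) (a b : V) :
    ω ((x ^ i) a) b = (-1) ^ i * ω a ((x ^ i) b) := by
  induction i generalizing b with
  | zero => simp
  | succ i ih =>
    rw [pow_succ', Module.End.mul_apply, h.skew, ih, pow_succ (-1 : κ), ← Module.End.mul_apply,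
      ← pow_succ, pow_succ']
    ring

theorem IsSN.neg {ω : LinearMap.BilinForm κ V} {x : End κ V} (h : IsSN ω x) (a b : V) :
    ω a b = -ω b a := (LinearMap.IsAlt.neg h.alt b a).symm

theorem IsSN.zero_iff {ω : LinearMap.BilinForm κ V} {x : End κ V} (h : IsSN ω x) {a b : V} :
    ω a b = 0 ↔ ω b a = 0 := h.alt.eq_iff

theorem IsSN.exists_ne {ω : LinearMap.BilinForm κ V} {x : End κ V} (h : IsSN ω x) {a : V}
    (ha : a ≠ 0) : ∃ b, ω a b ≠ 0 := by
  by_contra! hb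
  exact ha (h.nondeg.1 a hb)

/-- The dimension of the kernel of `x ^ j` on `V`. -/
noncomputable def kerDim (x : End κ V) (j : ℕ) : ℕ := finrank κ (LinearMap.ker (x ^ j))

/-- The dimension of the kernel of `x ^ j` on the subspace `F`. -/
noncomputable def kerDimOn (x : End κ V) (F : Submodule κ V) (j : ℕ) : ℕ :=
  finrank κ (F ⊓ LinearMap.ker (x ^ j) : Submodule κ V)

/-- The preimage in `F^⊥` of the kernel of `x ^ j` on `F^⊥ / F`. -/
def quotKer (ω : LinearMap.BilinForm κ V) (x : End κ V) (F : Submodule κ V) (j : ℕ) :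
    Submodule κ V :=
  ω.orthogonal F ⊓ F.comap (x ^ j)

/-- The dimension of the kernel of `x ^ j` on `F^⊥ / F`, for an isotropic `x`-stable subspace
`F`. -/
noncomputable def kerDimQuot (ω : LinearMap.BilinForm κ V) (x : End κ V) (F : Submodule κ V)
    (j : ℕ) : ℕ :=
  finrank κ (quotKer ω x F j) - finrank κ F

/-- The multiplicity function of the partition whose conjugate has the partial sums `c`. -/
def mult (c : ℕ → ℕ) : ℕ → ℤ := fun j => 2 * c j - c (j - 1) - c (j + 1)

theorem mem_orth {ω : LinearMap.BilinForm κ V} {F : Submodule κ V} {a : V} :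
    a ∈ ω.orthogonal F ↔ ∀ f ∈ F, ω f a = 0 := Iff.rfl

/-- `F` is isotropic and stable under `x`. -/
structure IsoStable (ω : LinearMap.BilinForm κ V) (x : End κ V) (F : Submodule κ V) : Prop where
  iso : ∀ a ∈ F, ∀ b ∈ F, ω a b = 0
  stable : ∀ a ∈ F, x a ∈ F

theorem stable_pow {x : End κ V} {F : Submodule κ V} (h : ∀ a ∈ F, x a ∈ F) (i : ℕ) :
    ∀ a ∈ F, (x ^ i) a ∈ F := by
  induction i with
  | zero => simp
  | succ i ih =>
    intro a ha
    rw [pow_succ', Module.End.mul_apply]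
    exact h _ (ih a ha)

theorem IsSN.orth_stable {ω : LinearMap.BilinForm κ V} {x : End κ V} (h : IsSN ω x)
    {F : Submodule κ V} (hF : ∀ a ∈ F, x a ∈ F) : ∀ a ∈ ω.orthogonal F, x a ∈ ω.orthogonal F := by
  intro a ha f hf
  have h1 : ω (x f) a = 0 := ha _ (hF f hf)
  rw [h.skew] at h1
  exact neg_eq_zero.1 h1

theorem IsoStable.le_orth {ω : LinearMap.BilinForm κ V} {x : End κ V} {F : Submodule κ V}
    (h : IsoStable ω x F) : F ≤ ω.orthogonal F := fun a ha b hb => h.iso b hb a ha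

theorem IsoStable.le_quotKer {ω : LinearMap.BilinForm κ V} {x : End κ V} {F : Submodule κ V}
    (h : IsoStable ω x F) (j : ℕ) : F ≤ quotKer ω x F j :=
  le_inf h.le_orth fun a ha => stable_pow h.stable j a ha

theorem finrank_map_add_inf_ker [FiniteDimensional κ V] {W : Type*} [AddCommGroup W]
    [Module κ W] (f : V →ₗ[κ] W) (S : Submodule κ V) :
    finrank κ (S.map f) + finrank κ (S ⊓ LinearMap.ker f : Submodule κ V) = finrank κ S := by
  have h := LinearMap.finrank_range_add_finrank_ker (f.domRestrict S)
  rw [LinearMap.range_domRestrict] at h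
  rw [← h, LinearMap.ker_domRestrict, ← Submodule.finrank_map_subtype_eq,
    Submodule.map_comap_subtype]

theorem range_pow_anti (x : End κ V) {i j : ℕ} (h : i ≤ j) :
    LinearMap.range (x ^ j) ≤ LinearMap.range (x ^ i) := by
  obtain ⟨k, rfl⟩ := Nat.exists_eq_add_of_le h
  rw [pow_add, Module.End.mul_eq_comp]
  exact LinearMap.range_comp_le_range _ _

theorem orth_range_of_adjoint {ω : LinearMap.BilinForm κ V} (hω : ω.Nondegenerate) {S T : End κ V}
    (h : ∀ a b, ω (S a) b = ω a (T b)) : ω.orthogonal (LinearMap.range S) = LinearMap.ker T := by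
  ext b
  rw [mem_orth, LinearMap.mem_ker]
  constructor
  · intro hb
    refine hω.2 _ fun a => ?_
    rw [← h]
    exact hb _ ⟨a, rfl⟩
  · rintro hb _ ⟨a, rfl⟩
    rw [h, hb, map_zero]

theorem IsSN.orth_range_pow {ω : LinearMap.BilinForm κ V} {x : End κ V} (h : IsSN ω x) (j : ℕ) :
    ω.orthogonal (LinearMap.range (x ^ j)) = LinearMap.ker (x ^ j) := by
  rw [orth_range_of_adjoint (T := ((-1) ^ j : κ) • x ^ j) h.nondeg]
  · ext a
    rcases neg_one_pow_eq_or κ j with h1 | h1 <;> simp [h1]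
  · intro a b
    rw [h.skew_pow]
    simp

section finite

variable [FiniteDimensional κ V]

theorem IsoStable.finrank_quotKer {ω : LinearMap.BilinForm κ V} {x : End κ V} {F : Submodule κ V}
    (h : IsoStable ω x F) (j : ℕ) :
    finrank κ (quotKer ω x F j) = finrank κ F + kerDimQuot ω x F j := by
  have := Submodule.finrank_mono (h.le_quotKer j)
  unfold kerDimQuot
  omega

/-- Adjoint endomorphisms have the same rank. -/
theorem finrank_range_of_adjoint {ω : LinearMap.BilinForm κ V} (hω : ω.Nondegenerate)
    {S T : End κ V} (h : ∀ a b, ω (S a) b = ω a (T b)) :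
    finrank κ (LinearMap.range S) = finrank κ (LinearMap.range T) := by
  have h1 := LinearMap.BilinForm.finrank_orthogonal hω (LinearMap.range S)
  rw [orth_range_of_adjoint hω h] at h1
  have h2 := LinearMap.finrank_range_add_finrank_ker T
  have h3 := Submodule.finrank_le (LinearMap.range S)
  omega

theorem IsSN.orth_ker_pow {ω : LinearMap.BilinForm κ V} {x : End κ V} (h : IsSN ω x) (j : ℕ) :
    ω.orthogonal (LinearMap.ker (x ^ j)) = LinearMap.range (x ^ j) := by
  rw [← h.orth_range_pow, LinearMap.BilinForm.orthogonal_orthogonal h.nondeg h.alt.isRefl]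

theorem finrank_orth_add {ω : LinearMap.BilinForm κ V} (h : ω.Nondegenerate) (F : Submodule κ V) :
    finrank κ (ω.orthogonal F) + finrank κ F = finrank κ V := by
  have := LinearMap.BilinForm.finrank_orthogonal h F
  have := Submodule.finrank_le F
  omega

theorem kerDim_add_range (x : End κ V) (j : ℕ) :
    kerDim x j + finrank κ (LinearMap.range (x ^ j)) = finrank κ V := by
  rw [add_comm]
  exact LinearMap.finrank_range_add_finrank_ker _

/-- `dim ker x ^ (j + 1) - dim ker x ^ j` is the dimension of `ker x ⊓ range x ^ j`. -/
theorem kerDim_succ (x : End κ V) (j : ℕ) :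
    kerDim x (j + 1) = kerDim x j +
      finrank κ (LinearMap.range (x ^ j) ⊓ LinearMap.ker x : Submodule κ V) := by
  have h1 := finrank_map_add_inf_ker x (LinearMap.range (x ^ j))
  have h2 : (LinearMap.range (x ^ j)).map x = LinearMap.range (x ^ (j + 1)) := by
    rw [pow_succ', Module.End.mul_eq_comp, LinearMap.range_comp]
  rw [h2] at h1
  have h3 := kerDim_add_range x j
  have h4 := kerDim_add_range x (j + 1)
  omega

theorem mult_kerDim (x : End κ V) {j : ℕ} (hj : 1 ≤ j) :
    mult (kerDim x) j =
      (finrank κ (LinearMap.range (x ^ (j - 1)) ⊓ LinearMap.ker x : Submodule κ V) : ℤ) -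
      finrank κ (LinearMap.range (x ^ j) ⊓ LinearMap.ker x : Submodule κ V) := by
  obtain ⟨j, rfl⟩ := Nat.exists_eq_add_of_le' hj
  have h1 := kerDim_succ x j
  have h2 := kerDim_succ x (j + 1)
  change mult (kerDim x) (j + 1) =
    (finrank κ (LinearMap.range (x ^ j) ⊓ LinearMap.ker x : Submodule κ V) : ℤ) - _
  simp only [mult, Nat.add_sub_cancel]
  rw [h2, h1]
  push_cast
  ring

theorem valid_mult_kerDim (x : End κ V) : Valid (mult (kerDim x)) := by
  intro j hj
  rw [mult_kerDim x hj]
  have := Submodule.finrank_mono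
    (inf_le_inf_right (LinearMap.ker x) (range_pow_anti x (Nat.sub_le j 1)))
  omega

/-- If `j` is a part of the partition of `x`, there is a vector of height exactly `j` in the
kernel. -/
theorem exists_height_of_mult {x : End κ V} {j : ℕ} (hj : 1 ≤ j) (h : 1 ≤ mult (kerDim x) j) :
    ∃ u, (x ^ j) u = 0 ∧ (x ^ (j - 1)) u ∉ LinearMap.range (x ^ j) := by
  rw [mult_kerDim x hj] at h
  by_contra! hc
  have : (LinearMap.range (x ^ (j - 1)) ⊓ LinearMap.ker x : Submodule κ V) ≤
      LinearMap.range (x ^ j) ⊓ LinearMap.ker x := by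
    rintro _ ⟨⟨u, rfl⟩, hu⟩
    refine ⟨hc u ?_, hu⟩
    rw [← Nat.sub_add_cancel hj, pow_succ', Module.End.mul_apply]
    exact hu
  have := Submodule.finrank_mono this
  omega

end finite

end

section

open Module

variable {κ : Type*} [Field κ] {V : Type*} [AddCommGroup V] [Module κ V]

/-! ### Reduction by an isotropic subspace -/

/-- `φ` identifies `F^⊥ / F`, with the form and the endomorphism induced by `ω` and `x`, with
`V'`. Only the restriction of `φ` to `F^⊥` matters. -/
structure IsReduction {V' : Type*} [AddCommGroup V'] [Module κ V'] (ω : LinearMap.BilinForm κ V)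
    (x : End κ V) (F : Submodule κ V) (ω' : LinearMap.BilinForm κ V') (x' : End κ V')
    (φ : V →ₗ[κ] V') : Prop where
  surj : ∀ v, ∃ a ∈ ω.orthogonal F, φ a = v
  ker : ∀ a ∈ ω.orthogonal F, φ a = 0 ↔ a ∈ F
  form : ∀ a ∈ ω.orthogonal F, ∀ b ∈ ω.orthogonal F, ω' (φ a) (φ b) = ω a b
  comm : ∀ a ∈ ω.orthogonal F, φ (x a) = x' (φ a)

section

variable {V' : Type*} [AddCommGroup V'] [Module κ V'] {ω : LinearMap.BilinForm κ V}
  {x : End κ V} {F L : Submodule κ V} {ω' : LinearMap.BilinForm κ V'} {x' : End κ V'}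
  {φ : V →ₗ[κ] V'}

theorem IsReduction.comm_pow (h : IsSN ω x) (hF : ∀ a ∈ F, x a ∈ F)
    (hr : IsReduction ω x F ω' x' φ) (i : ℕ) :
    ∀ a ∈ ω.orthogonal F, φ ((x ^ i) a) = (x' ^ i) (φ a) := by
  induction i with
  | zero => simp
  | succ i ih =>
    intro a ha
    rw [pow_succ, pow_succ, Module.End.mul_apply, Module.End.mul_apply, ih _
      (h.orth_stable hF a ha), hr.comm a ha]

theorem IsReduction.isSN [FiniteDimensional κ V] (h : IsSN ω x) (hF : ∀ a ∈ F, x a ∈ F)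
    (hr : IsReduction ω x F ω' x' φ) : IsSN ω' x' := by
  have halt : ω'.IsAlt := fun v => by
    obtain ⟨a, ha, rfl⟩ := hr.surj v
    rw [hr.form a ha a ha]
    exact h.alt a
  refine ⟨halt, ?_, fun v w => ?_, ?_⟩
  · refine (LinearMap.IsRefl.nondegenerate_iff_separatingLeft halt.isRefl).2 fun v hv => ?_
    obtain ⟨a, ha, rfl⟩ := hr.surj v
    rw [hr.ker a ha, ← LinearMap.BilinForm.orthogonal_orthogonal h.nondeg h.alt.isRefl F]
    intro b hb
    have := hv (φ b)
    rw [hr.form a ha b hb] at this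
    exact h.zero_iff.1 this
  · obtain ⟨a, ha, rfl⟩ := hr.surj v
    obtain ⟨b, hb, rfl⟩ := hr.surj w
    rw [← hr.comm a ha, ← hr.comm b hb, hr.form _ (h.orth_stable hF a ha) _ hb,
      hr.form _ ha _ (h.orth_stable hF b hb), h.skew]
  · obtain ⟨k, hk⟩ := h.nil
    refine ⟨k, LinearMap.ext fun v => ?_⟩
    obtain ⟨a, ha, rfl⟩ := hr.surj v
    rw [← hr.comm_pow h hF k a ha, hk]
    simp

/-- The quotient `F^⊥ / F` is modelled on `D ⊓ F^⊥`, for a complement `D` of `F`. -/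
theorem exists_reduction [FiniteDimensional κ V] (h : IsSN ω x) (hF : IsoStable ω x F) :
    ∃ (C : Submodule κ V) (ω' : LinearMap.BilinForm κ C) (x' : End κ C) (φ : V →ₗ[κ] C),
      IsReduction ω x F ω' x' φ ∧ IsSN ω' x' := by
  obtain ⟨D, hD⟩ := Submodule.exists_isCompl F
  obtain ⟨p, hpD, hpF⟩ : ∃ p : V →ₗ[κ] V, (∀ a, p a ∈ D) ∧ (∀ a, a - p a ∈ F) := by
    refine ⟨D.subtype ∘ₗ Submodule.projectionOnto D F hD.symm, fun a => ?_, fun a => ?_⟩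
    · simp
    · suffices h1 : a - (D.subtype ∘ₗ Submodule.projectionOnto D F hD.symm) a ∈
          LinearMap.ker (Submodule.projectionOnto D F hD.symm) by
        rwa [Submodule.ker_projectionOnto] at h1
      rw [LinearMap.mem_ker, map_sub, sub_eq_zero, LinearMap.comp_apply, Submodule.subtype_apply,
        Submodule.projectionOnto_apply_left]
  have hp0 : ∀ a, p a = 0 ↔ a ∈ F := fun a => by
    refine ⟨fun ha => by simpa [ha] using hpF a, fun ha => ?_⟩
    have h1 : p a ∈ F := by simpa using F.sub_mem ha (hpF a)
    exact (Submodule.disjoint_def.1 hD.disjoint) _ h1 (hpD a)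
  set C : Submodule κ V := D ⊓ ω.orthogonal F with hC
  obtain ⟨q, hq⟩ := C.subtype.exists_leftInverse_of_injective (by simp)
  have hq' : ∀ c : C, q c = c := fun c => LinearMap.congr_fun hq c
  have hpC : ∀ a ∈ ω.orthogonal F, p a ∈ C := fun a ha =>
    ⟨hpD a, by simpa using (ω.orthogonal F).sub_mem ha (hF.le_orth (hpF a))⟩
  set φ : V →ₗ[κ] C := q ∘ₗ p with hφ
  have hφp : ∀ a ∈ ω.orthogonal F, (φ a : V) = p a := fun a ha => by
    have := hq' ⟨p a, hpC a ha⟩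
    exact congrArg Subtype.val this
  have hφF : ∀ a ∈ F, φ a = 0 := fun a ha => by simp [hφ, (hp0 a).2 ha]
  have hr : IsReduction ω x F (ω.restrict C) (φ ∘ₗ x ∘ₗ C.subtype) φ := by
    refine ⟨fun v => ⟨v, v.2.2, Subtype.ext ?_⟩, fun a ha => ?_, fun a ha b hb => ?_,
      fun a ha => ?_⟩
    · rw [hφp _ v.2.2]
      have h1 : (v : V) - p v ∈ D := D.sub_mem v.2.1 (hpD _)
      exact (sub_eq_zero.1 ((Submodule.disjoint_def.1 hD.disjoint) _ (hpF v) h1)).symm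
    · rw [← hp0, ← hφp a ha, Submodule.coe_eq_zero]
    · change ω (φ a : V) (φ b : V) = _
      rw [hφp a ha, hφp b hb]
      have h1 : ω (a - p a) b = 0 := hb _ (hpF a)
      have h2 : ω (p a) (b - p b) = 0 := h.zero_iff.1 ((hpC a ha).2 _ (hpF b))
      simp only [map_sub, LinearMap.sub_apply] at h1 h2
      rw [sub_eq_zero] at h1 h2
      rw [← h2, h1]
    · have h1 := hφF _ (hF.stable _ (hpF a))
      rw [map_sub, map_sub, sub_eq_zero] at h1
      rw [h1]
      simp [hφp a ha]
  exact ⟨C, _, _, φ, hr, hr.isSN h hF.stable⟩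

theorem kerDimQuot_bot (ω : LinearMap.BilinForm κ V) (x : End κ V) (j : ℕ) :
    kerDimQuot ω x ⊥ j = kerDim x j := by
  have : quotKer ω x ⊥ j = LinearMap.ker (x ^ j) := by
    rw [quotKer, LinearMap.BilinForm.orthogonal_bot, top_inf_eq, Submodule.comap_bot]
  rw [kerDimQuot, this, finrank_bot, Nat.sub_zero, kerDim]

theorem IsReduction.finrank_map [FiniteDimensional κ V] (hr : IsReduction ω x L ω' x' φ)
    {S : Submodule κ V} (h1 : L ≤ S) (h2 : S ≤ ω.orthogonal L) :
    finrank κ (S.map φ) + finrank κ L = finrank κ S := by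
  have h3 : S ⊓ LinearMap.ker φ = L := by
    ext a
    exact ⟨fun ha => (hr.ker a (h2 ha.1)).1 ha.2, fun ha => ⟨h1 ha, (hr.ker a (h2 (h1 ha))).2 ha⟩⟩
  rw [← finrank_map_add_inf_ker φ S, h3]

theorem IsReduction.isoStable (hr : IsReduction ω x L ω' x' φ) (hF : IsoStable ω x F)
    (hLF : L ≤ F) : IsoStable ω' x' (F.map φ) := by
  have hFL : F ≤ ω.orthogonal L := hF.le_orth.trans (LinearMap.BilinForm.orthogonal_le hLF)
  constructor
  · rintro _ ⟨a, ha, rfl⟩ _ ⟨b, hb, rfl⟩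
    rw [hr.form a (hFL ha) b (hFL hb)]
    exact hF.iso a ha b hb
  · rintro _ ⟨a, ha, rfl⟩
    exact ⟨x a, hF.stable a ha, hr.comm a (hFL ha)⟩

theorem IsReduction.mem_map (hr : IsReduction ω x L ω' x' φ) (hLF : L ≤ F)
    (hFL : F ≤ ω.orthogonal L) {a : V} (ha : a ∈ ω.orthogonal L) :
    φ a ∈ F.map φ ↔ a ∈ F := by
  refine ⟨?_, fun h => ⟨a, h, rfl⟩⟩
  rintro ⟨b, hb, hab⟩
  have h1 : a - b ∈ L := (hr.ker _ (Submodule.sub_mem _ ha (hFL hb))).1 (by simp [hab])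
  simpa using F.add_mem (hLF h1) hb

/-- Reduction in stages: `(F / L)^⊥ / (F / L)` is `F^⊥ / F`. -/
theorem IsReduction.kerDimQuot_map [FiniteDimensional κ V] (h : IsSN ω x)
    (hL : ∀ a ∈ L, x a ∈ L) (hr : IsReduction ω x L ω' x' φ)
    (hF : IsoStable ω x F) (hLF : L ≤ F) (j : ℕ) :
    kerDimQuot ω' x' (F.map φ) j = kerDimQuot ω x F j := by
  have hFL : F ≤ ω.orthogonal L := hF.le_orth.trans (LinearMap.BilinForm.orthogonal_le hLF)
  have hle : ω.orthogonal F ≤ ω.orthogonal L := LinearMap.BilinForm.orthogonal_le hLF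
  have h1 : quotKer ω' x' (F.map φ) j = (quotKer ω x F j).map φ := by
    ext v
    obtain ⟨a, ha, rfl⟩ := hr.surj v
    rw [hr.mem_map (hLF.trans (hF.le_quotKer j)) (inf_le_left.trans hle) ha]
    simp only [quotKer, Submodule.mem_inf, Submodule.mem_comap, ← hr.comm_pow h hL j a ha]
    rw [hr.mem_map hLF hFL (stable_pow (h.orth_stable hL) j a ha)]
    refine and_congr_left fun _ => ⟨fun hv f hf => ?_, fun hv => ?_⟩
    · rw [← hr.form f (hFL hf) a ha]
      exact hv (φ f) ⟨f, hf, rfl⟩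
    · rintro _ ⟨f, hf, rfl⟩
      exact (hr.form f (hFL hf) a ha).trans (hv f hf)
  have h2 := hr.finrank_map hLF hFL
  have h3 := hr.finrank_map (hLF.trans (hF.le_quotKer j)) (inf_le_left.trans hle)
  unfold kerDimQuot
  rw [h1]
  omega

theorem IsReduction.kerDim_eq [FiniteDimensional κ V] (h : IsSN ω x)
    (hr : IsReduction ω x L ω' x' φ) (hL : IsoStable ω x L) (j : ℕ) :
    kerDim x' j = kerDimQuot ω x L j := by
  rw [← hr.kerDimQuot_map h hL.stable hL le_rfl]
  have : L.map φ = ⊥ := by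
    rw [eq_bot_iff]
    rintro _ ⟨a, ha, rfl⟩
    exact (hr.ker a (hL.le_orth ha)).2 ha
  rw [this, kerDimQuot_bot]

/-! ### Reduction by a line -/

theorem finrank_inf_ker_form [FiniteDimensional κ V] {S : Submodule κ V} {f : V →ₗ[κ] κ}
    (h : ∃ a ∈ S, f a ≠ 0) :
    finrank κ (S ⊓ LinearMap.ker f : Submodule κ V) + 1 = finrank κ S := by
  rw [← finrank_map_add_inf_ker f S, add_comm]
  congr 1
  obtain ⟨a, ha, hfa⟩ := h
  have : S.map f = ⊤ := by
    rw [eq_top_iff]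
    intro c _
    exact ⟨(c / f a) • a, S.smul_mem _ ha, by simp [hfa]⟩
  rw [this, finrank_top, finrank_self]

theorem orth_span_singleton (v : V) :
    ω.orthogonal (κ ∙ v) = LinearMap.ker (ω v) := by
  ext a
  rw [mem_orth, LinearMap.mem_ker]
  refine ⟨fun h => h v (Submodule.mem_span_singleton_self v), fun h f hf => ?_⟩
  obtain ⟨c, rfl⟩ := Submodule.mem_span_singleton.1 hf
  simp [h]

open Classical in
/-- The kernel dimensions of the reduction by the line spanned by the vector `v = x ^ (h - 1) u` of
height `h` in the kernel of `x`. -/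
theorem kerDimQuot_line [FiniteDimensional κ V] (hs : IsSN ω x) {u : V} {h : ℕ} (hh : 1 ≤ h)
    (hu : (x ^ h) u = 0) (hv : (x ^ (h - 1)) u ∉ LinearMap.range (x ^ h)) (j : ℕ) :
    (kerDim x j : ℤ) - kerDimQuot ω x (κ ∙ (x ^ (h - 1)) u) j =
      if h ≤ j then 2 else if j + 1 = h ∧ ω u ((x ^ (h - 1)) u) ≠ 0 then 1 else 0 := by
  set v := (x ^ (h - 1)) u with hvdef
  have hv0 : v ≠ 0 := fun h0 => hv (h0 ▸ zero_mem _)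
  have hxv : x v = 0 := by
    rw [hvdef, ← Module.End.mul_apply, ← pow_succ', Nat.sub_add_cancel hh, hu]
  have hL : IsoStable ω x (κ ∙ v) := by
    constructor
    · intro a ha b hb
      obtain ⟨c, rfl⟩ := Submodule.mem_span_singleton.1 ha
      obtain ⟨d, rfl⟩ := Submodule.mem_span_singleton.1 hb
      have : ω v v = 0 := hs.alt v
      simp [this]
    · intro a ha
      obtain ⟨c, rfl⟩ := Submodule.mem_span_singleton.1 ha
      simp [hxv]
  have hL1 : finrank κ (κ ∙ v) = 1 := finrank_span_singleton hv0
  have hq := hL.finrank_quotKer j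
  have hqd : quotKer ω x (κ ∙ v) j = (κ ∙ v).comap (x ^ j) ⊓ LinearMap.ker (ω v) := by
    rw [quotKer, orth_span_singleton, inf_comm]
  split_ifs with h1 h2
  · -- `v` is not in the image of `x ^ j`
    have hcomap : (κ ∙ v).comap (x ^ j) = LinearMap.ker (x ^ j) := by
      ext a
      rw [Submodule.mem_comap, LinearMap.mem_ker, Submodule.mem_span_singleton]
      refine ⟨fun ⟨c, hc⟩ => ?_, fun ha => ⟨0, by simp [ha]⟩⟩
      by_contra hne
      have hc0 : c ≠ 0 := fun h0 => hne (by simp [← hc, h0])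
      refine hv (range_pow_anti x h1 ⟨c⁻¹ • a, ?_⟩)
      rw [map_smul, ← hc, smul_smul, inv_mul_cancel₀ hc0, one_smul]
    have hex : ∃ a ∈ LinearMap.ker (x ^ j), ω v a ≠ 0 := by
      by_contra! hc
      refine hv (range_pow_anti x h1 ?_)
      rw [← hs.orth_ker_pow]
      exact fun a ha => hs.zero_iff.1 (hc a ha)
    have h3 := finrank_inf_ker_form hex
    rw [hqd, hcomap] at hq
    change _ = kerDim x j at h3
    omega
  all_goals
    have hjh : j ≤ h - 1 := by omega
    have hmap : ((κ ∙ v).comap (x ^ j)).map (x ^ j) = κ ∙ v := by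
      rw [Submodule.map_comap_eq, inf_eq_right, Submodule.span_singleton_le_iff_mem]
      refine ⟨(x ^ (h - 1 - j)) u, ?_⟩
      rw [← Module.End.mul_apply, ← pow_add, Nat.add_sub_cancel' hjh]
    have hcd := finrank_map_add_inf_ker (x ^ j) ((κ ∙ v).comap (x ^ j))
    rw [hmap, hL1, inf_eq_right.2 (LinearMap.ker_le_comap (x ^ j))] at hcd
    change 1 + kerDim x j = _ at hcd
  · have hex : ∃ a ∈ (κ ∙ v).comap (x ^ j), ω v a ≠ 0 := by
      refine ⟨u, ?_, fun h0 => h2.2 (hs.zero_iff.1 h0)⟩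
      rw [Submodule.mem_comap, show j = h - 1 by omega]
      exact Submodule.mem_span_singleton_self v
    have h3 := finrank_inf_ker_form hex
    rw [hqd] at hq
    omega
  · have hle : (κ ∙ v).comap (x ^ j) ≤ LinearMap.ker (ω v) := by
      intro a ha
      obtain ⟨c, hc⟩ := Submodule.mem_span_singleton.1 ha
      rw [LinearMap.mem_ker, show v = (x ^ j) ((x ^ (h - 1 - j)) u) by
        rw [← Module.End.mul_apply, ← pow_add, Nat.add_sub_cancel' hjh], hs.skew_pow, ← hc,
        map_smul, smul_eq_mul, mul_eq_zero, mul_eq_zero]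
      refine Or.inr (Or.inr ?_)
      by_cases hj : j + 1 = h
      · have h3 : ω u v = 0 := by
          by_contra h3
          exact h2 ⟨hj, h3⟩
        rw [show h - 1 - j = 0 by omega]
        simpa using h3
      · rw [hs.skew_pow, hvdef, ← Module.End.mul_apply, ← pow_add,
          show h - 1 - j + (h - 1) = (h - 1 - j - 1) + h by omega, pow_add, Module.End.mul_apply,
          hu]
        simp
    rw [hqd, inf_eq_left.2 hle] at hq
    omega

end

end

section

open Module

variable {κ : Type*} [Field κ] {V : Type*} [AddCommGroup V] [Module κ V]

/-! ### Cyclic subspaces -/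

/-- The smallest `x`-stable subspace containing `w`. -/
def cyc (x : End κ V) (w : V) : Submodule κ V := Submodule.span κ (Set.range fun i : ℕ => (x ^ i) w)

theorem pow_mem_cyc (x : End κ V) (w : V) (i : ℕ) : (x ^ i) w ∈ cyc x w :=
  Submodule.subset_span ⟨i, rfl⟩

theorem mem_cyc (x : End κ V) (w : V) : w ∈ cyc x w := by simpa using pow_mem_cyc x w 0

theorem cyc_le {x : End κ V} {w : V} {S : Submodule κ V} : cyc x w ≤ S ↔ ∀ i, (x ^ i) w ∈ S := by
  rw [cyc, Submodule.span_le]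
  exact Set.range_subset_iff

theorem cyc_le_of_stable {x : End κ V} {w : V} {S : Submodule κ V} (hS : ∀ a ∈ S, x a ∈ S)
    (hw : w ∈ S) : cyc x w ≤ S := cyc_le.2 fun i => stable_pow hS i w hw

theorem map_cyc {V' : Type*} [AddCommGroup V'] [Module κ V'] {x : End κ V} {w : V}
    {φ : V →ₗ[κ] V'} {x' : End κ V'} (h : ∀ i, φ ((x ^ i) w) = (x' ^ i) (φ w)) :
    (cyc x w).map φ = cyc x' (φ w) := by
  rw [cyc, cyc, Submodule.map_span, ← Set.range_comp]
  congr 2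
  ext i
  exact h i

theorem map_pow_cyc (x : End κ V) (w : V) (j : ℕ) :
    (cyc x w).map (x ^ j) = cyc x ((x ^ j) w) :=
  map_cyc fun i => by rw [← Module.End.mul_apply, ← Module.End.mul_apply, ← pow_add, ← pow_add,
    add_comm]

theorem cyc_stable (x : End κ V) (w : V) : ∀ a ∈ cyc x w, x a ∈ cyc x w := by
  intro a ha
  have h1 : x a ∈ (cyc x w).map (x ^ 1) := ⟨a, ha, by simp⟩
  rw [map_pow_cyc] at h1
  exact cyc_le_of_stable (S := cyc x w) (fun b hb => by
    have : (cyc x w).map x ≤ cyc x w := by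
      rw [cyc, Submodule.map_span_le]
      rintro _ ⟨i, rfl⟩
      change x ((x ^ i) w) ∈ _
      rw [← Module.End.mul_apply, ← pow_succ']
      exact pow_mem_cyc x w (i + 1)
    exact this ⟨b, hb, rfl⟩) (pow_mem_cyc x w 1) h1

theorem cyc_eq_sup (x : End κ V) (w : V) : cyc x w = (κ ∙ w) ⊔ cyc x (x w) := by
  apply le_antisymm
  · refine cyc_le.2 fun i => ?_
    rcases i with - | i
    · exact Submodule.mem_sup_left (by simp)
    · refine Submodule.mem_sup_right ?_
      rw [pow_succ, Module.End.mul_apply]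
      exact pow_mem_cyc x (x w) i
  · refine sup_le ((Submodule.span_singleton_le_iff_mem _ _).2 (mem_cyc x w)) ?_
    exact cyc_le_of_stable (cyc_stable x w) (cyc_stable x w w (mem_cyc x w))

/-- `w` has order exactly `m` under `x`. -/
def HasOrder (x : End κ V) (w : V) (m : ℕ) : Prop :=
  (x ^ m) w = 0 ∧ ∀ k, k < m → (x ^ k) w ≠ 0

theorem hasOrder_of {x : End κ V} {w : V} {m : ℕ} (h0 : (x ^ m) w = 0)
    (h1 : m ≠ 0 → (x ^ (m - 1)) w ≠ 0) : HasOrder x w m := by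
  refine ⟨h0, fun k hk hw => h1 (by omega) ?_⟩
  rw [show m - 1 = (m - 1 - k) + k by omega, pow_add, Module.End.mul_apply, hw, map_zero]

theorem HasOrder.pow {x : End κ V} {w : V} {m : ℕ} (h : HasOrder x w m) (j : ℕ) :
    HasOrder x ((x ^ j) w) (m - j) := by
  constructor
  · rw [← Module.End.mul_apply, ← pow_add]
    rcases Nat.le_total j m with hj | hj
    · rw [Nat.sub_add_cancel hj, h.1]
    · rw [show m - j + j = (j - m) + m by omega, pow_add, Module.End.mul_apply, h.1, map_zero]
  · intro k hk
    rw [← Module.End.mul_apply, ← pow_add]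
    exact h.2 _ (by omega)

theorem HasOrder.cyc_le_ker {x : End κ V} {w : V} {m : ℕ} (h : HasOrder x w m) :
    cyc x w ≤ LinearMap.ker (x ^ m) := by
  refine cyc_le.2 fun i => ?_
  rw [LinearMap.mem_ker, ← Module.End.mul_apply, ← pow_add, add_comm, pow_add,
    Module.End.mul_apply, h.1, map_zero]

theorem HasOrder.finrank_cyc [FiniteDimensional κ V] {x : End κ V} {w : V} {m : ℕ}
    (h : HasOrder x w m) : finrank κ (cyc x w) = m := by
  induction m generalizing w with
  | zero =>
    have : cyc x w = ⊥ := by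
      have := h.cyc_le_ker
      rw [eq_bot_iff]
      simpa [Module.End.one_eq_id] using this
    simp [this]
  | succ m ih =>
    have hx : HasOrder x (x w) m := by simpa using h.pow 1
    have h1 := ih hx
    have hw : w ∉ cyc x (x w) := fun hw => h.2 m (Nat.lt_succ_self m) (hx.cyc_le_ker hw)
    have hw0 : w ≠ 0 := fun h0 => hw (h0 ▸ zero_mem _)
    have h2 := Submodule.finrank_sup_add_finrank_inf_eq (κ ∙ w) (cyc x (x w))
    have h3 : (κ ∙ w) ⊓ cyc x (x w) = ⊥ := by
      rw [eq_bot_iff]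
      rintro _ ⟨ha, hb⟩
      obtain ⟨c, rfl⟩ := Submodule.mem_span_singleton.1 ha
      by_contra hne
      have hc : c ≠ 0 := fun h0 => hne (by simp [h0])
      exact hw ((Submodule.smul_mem_iff _ hc).1 hb)
    rw [← cyc_eq_sup, h3, finrank_bot, finrank_span_singleton hw0, h1] at h2
    omega

theorem HasOrder.kerDimOn_cyc [FiniteDimensional κ V] {x : End κ V} {w : V} {m : ℕ}
    (h : HasOrder x w m) (j : ℕ) : kerDimOn x (cyc x w) j = min m j := by
  have h1 := finrank_map_add_inf_ker (x ^ j) (cyc x w)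
  rw [map_pow_cyc, (h.pow j).finrank_cyc, h.finrank_cyc] at h1
  unfold kerDimOn
  omega

theorem HasOrder.cyc_inf_ker [FiniteDimensional κ V] {x : End κ V} {w : V} {m j : ℕ}
    (h : HasOrder x w m) (hj : j ≤ m) :
    cyc x w ⊓ LinearMap.ker (x ^ (m - j)) = (cyc x w).map (x ^ j) := by
  symm
  apply Submodule.eq_of_le_of_finrank_eq
  · refine le_inf ?_ ?_
    · rintro _ ⟨a, ha, rfl⟩
      exact stable_pow (cyc_stable x w) j a ha
    · rw [map_pow_cyc]
      exact (h.pow j).cyc_le_ker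
  · have := h.kerDimOn_cyc (m - j)
    rw [map_pow_cyc, (h.pow j).finrank_cyc]
    unfold kerDimOn at this
    omega

theorem mem_orth_cyc {ω : LinearMap.BilinForm κ V} {x : End κ V} {w a : V} :
    a ∈ ω.orthogonal (cyc x w) ↔ ∀ i, ω ((x ^ i) w) a = 0 := by
  refine ⟨fun h i => h _ (pow_mem_cyc x w i), fun h => ?_⟩
  have : cyc x w ≤ LinearMap.ker (ω.flip a) := cyc_le.2 fun i => h i
  exact fun b hb => this hb

theorem IsSN.mem_orth_cyc {ω : LinearMap.BilinForm κ V} {x : End κ V} (h : IsSN ω x) {w a : V} :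
    a ∈ ω.orthogonal (cyc x w) ↔ ∀ i, ω w ((x ^ i) a) = 0 := by
  rw [SympAccess.mem_orth_cyc]
  refine forall_congr' fun i => ?_
  rw [h.skew_pow]
  simp

theorem IsSN.cyc_isotropic_pair {ω : LinearMap.BilinForm κ V} {x : End κ V} (h : IsSN ω x)
    {w v : V} (hw : ∀ i, ω w ((x ^ i) v) = 0) : cyc x v ≤ ω.orthogonal (cyc x w) :=
  cyc_le_of_stable (h.orth_stable (cyc_stable x w)) (h.mem_orth_cyc.2 hw)

theorem IsSN.isoStable_cyc {ω : LinearMap.BilinForm κ V} {x : End κ V} (h : IsSN ω x)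
    {w : V} (hw : ∀ i, ω w ((x ^ i) w) = 0) : IsoStable ω x (cyc x w) :=
  ⟨fun a ha _ hb => h.cyc_isotropic_pair hw hb a ha, cyc_stable x w⟩

/-! ### Cyclic isotropic subspaces and additions of boxes -/

/-- The height of a nonzero vector: the largest power of `x` whose range contains it, plus one. -/
theorem exists_height [FiniteDimensional κ V] {x : End κ V} (hx : IsNilpotent x) {v : V}
    (hv : v ≠ 0) :
    ∃ h, 1 ≤ h ∧ v ∈ LinearMap.range (x ^ (h - 1)) ∧ v ∉ LinearMap.range (x ^ h) := by
  classical
  have hex : ∃ k, v ∉ LinearMap.range (x ^ k) := by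
    obtain ⟨k, hk⟩ := hx
    exact ⟨k, by simpa [hk] using hv⟩
  have h0 : Nat.find hex ≠ 0 := fun h0 => by
    have := Nat.find_spec hex
    rw [h0] at this
    exact this ⟨v, by simp⟩
  refine ⟨Nat.find hex, Nat.one_le_iff_ne_zero.2 h0, ?_, Nat.find_spec hex⟩
  by_contra hc
  exact Nat.find_min hex (Nat.sub_lt (Nat.pos_of_ne_zero h0) one_pos) hc

/-- The effect of a reduction by a line, expressed by multiplicities, is a single addition of two
boxes. -/
theorem mult_sub_eq_delta {c c' : ℕ → ℕ} {h j : ℕ} (hj : 1 ≤ j) (hh : 1 ≤ h) (b : Bool)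
    (hb : b = true → 2 ≤ h)
    (hc : ∀ i, (c i : ℤ) - c' i = if h ≤ i then 2 else if i + 1 = h ∧ b = true then 1 else 0) :
    mult c j = mult c' j + delta (b, h) j := by
  have h1 := hc j
  have h2 := hc (j - 1)
  have h3 := hc (j + 1)
  simp only [mult, delta, ind]
  cases b
  · simp at h1 h2 h3 ⊢
    split_ifs at * <;> omega
  · have := hb rfl
    simp at h1 h2 h3 ⊢
    split_ifs at * <;> omega

open Classical in
/-- The partition of `V` arises from that of `W^⊥ / W`, for a cyclic isotropic subspace `W` of
dimension `m`, by an admissible list of `m` additions. The heights of the successive lines of `W`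
are the sizes of the new parts, and they decrease when one passes to the reduction by a line. -/
theorem cyc_admissible (h2 : (2 : κ) ≠ 0) (m : ℕ) :
    ∀ {V : Type*} [AddCommGroup V] [Module κ V] [FiniteDimensional κ V]
      {ω : LinearMap.BilinForm κ V} {x : End κ V} {w : V}, IsSN ω x → HasOrder x w m →
      (∀ i, ω w ((x ^ i) w) = 0) →
      ∃ L : List (Bool × ℕ), L.length = m ∧
        (∀ a ∈ L, ∀ k, k + 1 = m → (x ^ k) w ∈ LinearMap.range (x ^ (a.2 - 1))) ∧
        Admissible 0 (mult (kerDimQuot ω x (cyc x w))) L ∧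
        ∀ j, 1 ≤ j → mult (kerDim x) j = mult (kerDimQuot ω x (cyc x w)) j + total L j := by
  induction m with
  | zero =>
    intro V _ _ _ ω x w hs hw hiso
    have hw0 : w = 0 := by simpa using hw.1
    have hc : cyc x w = ⊥ := by
      rw [eq_bot_iff]
      exact cyc_le.2 fun i => by simp [hw0]
    have hk : kerDimQuot ω x (cyc x w) = kerDim x := by
      rw [hc]
      exact funext (kerDimQuot_bot ω x)
    refine ⟨[], rfl, by simp, ⟨by simp, List.Pairwise.nil, fun t ht => ?_⟩, by simp [hk]⟩
    rw [List.prefix_nil.1 ht, hk]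
    simpa using valid_mult_kerDim x
  | succ m ih =>
    intro V _ _ _ ω x w hs hw hiso
    have hv0 := hw.2 m (Nat.lt_succ_self m)
    obtain ⟨h, hh, ⟨u, hu⟩, hv⟩ := exists_height hs.nil hv0
    set v := (x ^ m) w with hvdef
    have hxv : x v = 0 := by
      rw [hvdef, ← Module.End.mul_apply, ← pow_succ', hw.1]
    have hxu : (x ^ h) u = 0 := by
      rw [← Nat.sub_add_cancel hh, pow_succ', Module.End.mul_apply, hu, hxv]
    have hLW : (κ ∙ v) ≤ cyc x w :=
      (Submodule.span_singleton_le_iff_mem _ _).2 (pow_mem_cyc x w m)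
    have hW := hs.isoStable_cyc hiso
    have hL : IsoStable ω x (κ ∙ v) := by
      refine ⟨fun a ha b hb => hW.iso a (hLW ha) b (hLW hb), fun a ha => ?_⟩
      obtain ⟨c, rfl⟩ := Submodule.mem_span_singleton.1 ha
      simp [hxv]
    have hWL : cyc x w ≤ ω.orthogonal (κ ∙ v) :=
      hW.le_orth.trans (LinearMap.BilinForm.orthogonal_le hLW)
    obtain ⟨C, ω', x', φ, hr, hs'⟩ := exists_reduction hs hL
    have hφ : ∀ i, φ ((x ^ i) w) = (x' ^ i) (φ w) := fun i =>
      hr.comm_pow hs hL.stable i w (hWL (mem_cyc x w))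
    have hw' : HasOrder x' (φ w) m := by
      refine hasOrder_of ?_ fun hm => ?_
      · rw [← hφ, hr.ker _ (hWL (pow_mem_cyc x w m))]
        exact Submodule.mem_span_singleton_self v
      · rw [← hφ, Ne, hr.ker _ (hWL (pow_mem_cyc x w _))]
        intro hmem
        obtain ⟨c, hc⟩ := Submodule.mem_span_singleton.1 hmem
        refine hv0 ?_
        rw [hvdef, ← Nat.sub_add_cancel (Nat.one_le_iff_ne_zero.2 hm), pow_succ',
          Module.End.mul_apply, ← hc, map_smul, hxv, smul_zero]
    have hiso' : ∀ i, ω' (φ w) ((x' ^ i) (φ w)) = 0 := fun i => by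
      rw [← hφ, hr.form _ (hWL (mem_cyc x w)) _ (hWL (pow_mem_cyc x w i))]
      exact hiso i
    obtain ⟨L, hlen, hrange, hadm, htot⟩ := ih hs' hw' hiso'
    have hquot : kerDimQuot ω' x' (cyc x' (φ w)) = kerDimQuot ω x (cyc x w) := by
      rw [← map_cyc hφ]
      exact funext (hr.kerDimQuot_map hs hL.stable hW hLW)
    have hker : kerDim x' = kerDimQuot ω x (κ ∙ v) := funext (hr.kerDim_eq hs hL)
    rw [hquot] at hadm htot
    have hline := kerDimQuot_line hs hh hxu (by rwa [hu])
    rw [hu] at hline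
    -- the heights occurring in the reduction are smaller than `h`
    have hbelow : ∀ a ∈ L, ∃ z, ω v z = 0 ∧ (x ^ (a.2 - 1 + 1)) z = v := by
      intro a ha
      have hm : m ≠ 0 := fun hm => by
        rw [hm, List.length_eq_zero_iff] at hlen
        simp [hlen] at ha
      obtain ⟨z', hz'⟩ := hrange a ha (m - 1) (Nat.sub_add_cancel (Nat.one_le_iff_ne_zero.2 hm))
      obtain ⟨z, hz, rfl⟩ := hr.surj z'
      rw [← hφ, ← hr.comm_pow hs hL.stable _ _ hz] at hz'
      have h3 : (x ^ (a.2 - 1)) z - (x ^ (m - 1)) w ∈ κ ∙ v := by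
        rw [← hr.ker _ (Submodule.sub_mem _ (stable_pow (hs.orth_stable hL.stable) _ _ hz)
          (hWL (pow_mem_cyc x w _))), map_sub, hz', sub_self]
      obtain ⟨c, hc⟩ := Submodule.mem_span_singleton.1 h3
      have h4 := congrArg x hc
      rw [map_smul, hxv, smul_zero, map_sub, ← Module.End.mul_apply, ← Module.End.mul_apply,
        ← pow_succ', ← pow_succ', Nat.sub_add_cancel (Nat.one_le_iff_ne_zero.2 hm)] at h4
      exact ⟨z, hz v (Submodule.mem_span_singleton_self v), (sub_eq_zero.1 h4.symm)⟩
    have hlt : ∀ a ∈ L, a.2 < h := by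
      intro a ha
      obtain ⟨z, -, hz⟩ := hbelow a ha
      by_contra hc
      exact hv (range_pow_anti x (show h ≤ a.2 - 1 + 1 by omega) ⟨z, hz⟩)
    have hpos : ∀ a ∈ L, 1 ≤ a.2 := by
      intro a ha
      have := hadm.above a ha
      rcases a with ⟨_ | _, k⟩
      · simpa using this.2 rfl
      · have := (this.1 rfl).1
        simp at *
        omega
    -- if the addition changes a single part `h - 2`, the next lower height cannot be `h - 1`:
    -- otherwise `v` would be a power of `x` of a vector orthogonal to `v`
    have hgap : ω u v ≠ 0 → ∀ a ∈ L, a.2 + 2 ≤ h := by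
      intro hb a ha
      obtain ⟨z, hz0, hz⟩ := hbelow a ha
      have h5 := hlt a ha
      have h6 := hpos a ha
      by_contra hc
      have hah : a.2 - 1 + 1 = h - 1 := by omega
      rw [hah] at hz
      refine hb ?_
      rw [← hz, ← mul_right_inj' (pow_ne_zero (h - 1) (neg_ne_zero.2 (one_ne_zero (α := κ)))),
        ← hs.skew_pow, hu, hz0, mul_zero]
    -- for odd `h` the bilinear form `ω a (x ^ (h - 1) b)` is alternating
    have heven : ω u v ≠ 0 → Even h := by
      intro hb
      by_contra hodd
      rw [Nat.not_even_iff_odd] at hodd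
      have h5 := hs.skew_pow (h - 1) u u
      rw [hu, (Nat.Odd.sub_odd hodd odd_one).neg_one_pow, one_mul, hs.neg v u] at h5
      refine hb ?_
      have h6 : (2 : κ) * ω u v = 0 := by linear_combination -h5
      exact (mul_eq_zero.1 h6).resolve_left h2
    set b : Bool := decide (ω u v ≠ 0) with hbdef
    have hb : b = true ↔ ω u v ≠ 0 := by simp [hbdef]
    have hab : Above 0 (b, h) := by
      refine ⟨fun hbt => ?_, fun _ => by simpa using hh⟩
      have he := heven (hb.1 hbt)
      exact ⟨by obtain ⟨k, hk⟩ := he; simp; omega, he⟩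
    have htotal : ∀ j, 1 ≤ j → mult (kerDim x) j =
        mult (kerDimQuot ω x (cyc x w)) j + total (L ++ [(b, h)]) j := by
      intro j hj
      rw [total_append, ← add_assoc, ← htot j hj, hker]
      simp only [total_cons, total_nil, add_zero]
      refine mult_sub_eq_delta hj hh b (fun hbt => (hab.1 hbt).1) fun i => ?_
      rw [hline i]
      simp only [hb]
    refine ⟨L ++ [(b, h)], by simp [hlen], ?_, ⟨?_, ?_, ?_⟩, htotal⟩
    · intro a ha k hk
      obtain rfl : k = m := by omega
      rcases List.mem_append.1 ha with ha | ha
      · obtain ⟨z, -, hz⟩ := hbelow a ha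
        exact range_pow_anti x (Nat.le_succ _) ⟨z, hz⟩
      · obtain rfl : a = (b, h) := by simpa using ha
        exact ⟨u, hu⟩
    · intro a ha
      rcases List.mem_append.1 ha with ha | ha
      · exact hadm.above a ha
      · obtain rfl : a = (b, h) := by simpa using ha
        exact hab
    · refine List.pairwise_append.2 ⟨hadm.pairwise, List.pairwise_singleton _ _, ?_⟩
      intro a ha a' ha'
      obtain rfl : a' = (b, h) := by simpa using ha'
      exact ⟨hlt a ha, fun hbt => hgap (hb.1 hbt) a ha⟩
    · intro t ht
      rcases List.prefix_concat_iff.1 ht with rfl | ht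
      · intro j hj
        change 0 ≤ _ + total _ j
        rw [← htotal j hj]
        exact valid_mult_kerDim x j hj
      · exact hadm.valid t ht

end

/-! ### Isotropic stable subspaces -/

section

open Module

variable {κ : Type*} [Field κ]

/-- The case of a cyclic isotropic subspace: all the boxes that were added to the partition of `W^⊥
/ W` are collapsed to a new pair of parts `m, m`. -/
theorem cyc_reach (h2 : (2 : κ) ≠ 0) {V : Type*} [AddCommGroup V] [Module κ V]
    [FiniteDimensional κ V] {ω : LinearMap.BilinForm κ V} {x : End κ V} {w : V} {m : ℕ}
    (hs : IsSN ω x) (hw : HasOrder x w m) (hiso : ∀ i, ω w ((x ^ i) w) = 0) :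
    Reach (mult (kerDim x)) fun j => 2 * ind m j + mult (kerDimQuot ω x (cyc x w)) j := by
  obtain ⟨L, hlen, -, hadm, htot⟩ := cyc_admissible h2 m hs hw hiso
  have hbase : ∀ j, 1 ≤ j → base 0 0 (mult (kerDimQuot ω x (cyc x w))) j =
      mult (kerDimQuot ω x (cyc x w)) j := fun j hj => by
    simp [base, ind, Nat.one_le_iff_ne_zero.1 hj]
  refine Reach.trans (Reach.of_eq fun j hj => ?_)
    (reach_of_admissible (m + 1) 0 0 _ L m (by omega) (Or.inl rfl) hadm.first
      (hadm.congr hadm.above fun t _ j hj h0 => ?_) (by omega))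
  · rw [htot j hj, hbase j hj]
  · rwa [hbase j hj]

theorem mult_add (c d : ℕ → ℕ) (j : ℕ) :
    mult (fun i => c i + d i) j = mult c j + mult d j := by
  simp only [mult]
  push_cast
  ring

theorem mult_min (m : ℕ) {j : ℕ} (hj : 1 ≤ j) : mult (fun i => min m i) j = ind m j := by
  simp only [mult, ind]
  split_ifs <;> omega

/-- The partition of the graded space `F ⊕ F^⊥ / F ⊕ V / F^⊥` of an isotropic stable subspace `F`
is obtained from that of `V` by moves. This is proved by induction on `F`, splitting off a cyclic
subspace of maximal order. -/
theorem isoStable_reach (h2 : (2 : κ) ≠ 0) (N : ℕ) :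
    ∀ {V : Type*} [AddCommGroup V] [Module κ V] [FiniteDimensional κ V]
      {ω : LinearMap.BilinForm κ V} {x : End κ V} {F : Submodule κ V}, IsSN ω x →
      IsoStable ω x F → finrank κ F ≤ N →
      (Valid fun j => mult (kerDimOn x F) j) ∧
      Reach (mult (kerDim x)) fun j => 2 * mult (kerDimOn x F) j + mult (kerDimQuot ω x F) j := by
  induction N with
  | zero =>
    intro V _ _ _ ω x F hs hF hN
    obtain rfl : F = ⊥ := Submodule.finrank_eq_zero.1 (by omega)
    have hk : kerDimQuot ω x ⊥ = kerDim x := funext (kerDimQuot_bot ω x)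
    have hk0 : kerDimOn x ⊥ = fun _ => 0 := funext fun j => by
      rw [kerDimOn, bot_inf_eq, finrank_bot]
    have h0 : ∀ j, mult (kerDimOn x ⊥) j = 0 := fun j => by simp [hk0, mult]
    exact ⟨fun j _ => by simp [h0], Reach.of_eq fun j _ => by simp [h0, hk]⟩
  | succ N ih =>
    intro V _ _ _ ω x F hs hF hN
    by_cases hF0 : F = ⊥
    · exact ih hs hF (by rw [hF0, finrank_bot]; omega)
    classical
    -- a vector of `F` of maximal order
    have hex : ∃ m, F ≤ LinearMap.ker (x ^ m) := by
      obtain ⟨k, hk⟩ := hs.nil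
      exact ⟨k, by simp [hk]⟩
    obtain ⟨m, hm, hmin⟩ : ∃ m, F ≤ LinearMap.ker (x ^ m) ∧
        ∀ k, k < m → ¬ F ≤ LinearMap.ker (x ^ k) :=
      ⟨Nat.find hex, Nat.find_spec hex, fun k hk => Nat.find_min hex hk⟩
    have hm0 : m ≠ 0 := by
      rintro rfl
      exact hF0 (by rw [eq_bot_iff]; simpa [Module.End.one_eq_id] using hm)
    obtain ⟨w, hwF, hwm⟩ := SetLike.not_le_iff_exists.1 (hmin (m - 1) (by omega))
    have hw : HasOrder x w m := hasOrder_of (hm hwF) fun _ => hwm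
    have hiso : ∀ i, ω w ((x ^ i) w) = 0 := fun i =>
      hF.iso _ hwF _ (stable_pow hF.stable i w hwF)
    have hWF : cyc x w ≤ F := cyc_le_of_stable hF.stable hwF
    have hW := hs.isoStable_cyc hiso
    obtain ⟨C, ω', x', φ, hr, hs'⟩ := exists_reduction hs hW
    have hFW : F ≤ ω.orthogonal (cyc x w) :=
      hF.le_orth.trans (LinearMap.BilinForm.orthogonal_le hWF)
    have hF' := hr.isoStable hF hWF
    have hdim := hr.finrank_map hWF hFW
    rw [hw.finrank_cyc] at hdim
    obtain ⟨hv', hr'⟩ := ih hs' hF' (by omega)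
    have hq : kerDimQuot ω' x' (F.map φ) = kerDimQuot ω x F :=
      funext (hr.kerDimQuot_map hs hW.stable hF hWF)
    have hk : kerDim x' = kerDimQuot ω x (cyc x w) := funext (hr.kerDim_eq hs hW)
    -- since the order of `w` is maximal, its cyclic subspace is a direct summand of `F`
    have hon : kerDimOn x F = fun j => min m j + kerDimOn x' (F.map φ) j := by
      funext j
      have hS : F ⊓ (cyc x w).comap (x ^ j) = cyc x w ⊔ (F ⊓ LinearMap.ker (x ^ j)) := by
        apply le_antisymm
        · rintro a ⟨haF, haW⟩
          obtain ⟨b, hb, hab⟩ : ∃ b ∈ cyc x w, (x ^ j) b = (x ^ j) a := by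
            rcases Nat.le_total j m with hj | hj
            · have h3 : (x ^ j) a ∈ cyc x w ⊓ LinearMap.ker (x ^ (m - j)) := by
                refine ⟨haW, ?_⟩
                change (x ^ (m - j)) ((x ^ j) a) = 0
                rw [← Module.End.mul_apply, ← pow_add, Nat.sub_add_cancel hj]
                exact hm haF
              rwa [hw.cyc_inf_ker hj] at h3
            · refine ⟨0, zero_mem _, ?_⟩
              rw [map_zero, ← Nat.sub_add_cancel hj, pow_add, Module.End.mul_apply,
                LinearMap.mem_ker.1 (hm haF), map_zero]
          rw [← add_sub_cancel b a]
          exact Submodule.add_mem_sup hb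
            ⟨F.sub_mem haF (hWF hb), by simp [hab]⟩
        · refine sup_le (le_inf hWF fun a ha => stable_pow hW.stable j a ha)
            (inf_le_inf_left _ (LinearMap.ker_le_comap _))
      have hmap : F.map φ ⊓ LinearMap.ker (x' ^ j) = (F ⊓ (cyc x w).comap (x ^ j)).map φ := by
        ext v
        obtain ⟨a, ha, rfl⟩ := hr.surj v
        rw [hr.mem_map (hS ▸ le_sup_left) (inf_le_left.trans hFW) ha, Submodule.mem_inf,
          hr.mem_map hWF hFW ha, LinearMap.mem_ker, ← hr.comm_pow hs hW.stable j a ha,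
          hr.ker _ (stable_pow (hs.orth_stable hW.stable) j a ha)]
        rfl
      have h3 := hr.finrank_map (S := F ⊓ (cyc x w).comap (x ^ j)) (hS ▸ le_sup_left)
        (inf_le_left.trans hFW)
      have h4 := Submodule.finrank_sup_add_finrank_inf_eq (cyc x w) (F ⊓ LinearMap.ker (x ^ j))
      have h5 : cyc x w ⊓ (F ⊓ LinearMap.ker (x ^ j)) = cyc x w ⊓ LinearMap.ker (x ^ j) := by
        rw [← inf_assoc, inf_eq_left.2 hWF]
      have h6 := hw.kerDimOn_cyc j
      rw [← hmap, hS] at h3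
      rw [h5] at h4
      unfold kerDimOn at h6 ⊢
      omega
    have hmon : ∀ j, 1 ≤ j →
        mult (kerDimOn x F) j = ind m j + mult (kerDimOn x' (F.map φ)) j := fun j hj => by
      rw [hon, mult_add, mult_min m hj]
    have hind : Valid fun j => 2 * ind m j := fun j _ => by
      simp only [ind]
      split_ifs <;> simp
    refine ⟨fun j hj => ?_, ?_⟩
    · have := hv' j hj
      simp only [hmon j hj, ind] at this ⊢
      split_ifs <;> omega
    · refine (cyc_reach h2 hs hw hiso).trans ?_
      rw [← hk]
      refine Reach.trans (Reach.of_eq fun j _ => ?_)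
        ((hr'.add_right hind).trans (Reach.of_eq fun j hj => ?_))
      · exact add_comm _ _
      · simp only [hmon j hj, hq]
        ring

end

/-! ### Partitions as multiplicity functions -/

section

/-- The multiplicity function of a multiset. -/
def cnt (A : Multiset ℕ) : ℕ → ℤ := fun j => A.count j

theorem cnt_add (A B : Multiset ℕ) (j : ℕ) : cnt (A + B) j = cnt A j + cnt B j := by
  simp [cnt]

theorem cnt_singleton (a j : ℕ) : cnt {a} j = ind a j := by
  simp only [cnt, ind, Multiset.count_singleton]
  split_ifs <;> rfl

theorem cnt_cons (a : ℕ) (A : Multiset ℕ) (j : ℕ) : cnt (a ::ₘ A) j = ind a j + cnt A j := by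
  rw [← Multiset.singleton_add, cnt_add, cnt_singleton]

theorem cnt_filter (A : Multiset ℕ) {j : ℕ} (hj : 1 ≤ j) :
    cnt (A.filter (0 < ·)) j = cnt A j := by
  simp only [cnt]
  rw [Multiset.count_filter_of_pos (by omega)]

theorem sum_filter_pos (A : Multiset ℕ) : (A.filter (0 < ·)).sum = A.sum := by
  induction A using Multiset.induction_on with
  | empty => simp
  | cons a A ih =>
    rcases Nat.eq_zero_or_pos a with rfl | ha
    · simp [ih]
    · rw [Multiset.filter_cons_of_pos (p := (0 < ·)) _ ha]
      simp [ih]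

theorem eq_of_cnt {N : ℕ} {π ρ : N.Partition} (h : ∀ j, 1 ≤ j → cnt π.parts j = cnt ρ.parts j) :
    π = ρ := by
  apply Nat.Partition.ext
  refine Multiset.ext.2 fun j => ?_
  rcases Nat.eq_zero_or_pos j with rfl | hj
  · rw [Multiset.count_eq_zero_of_notMem fun h => (π.parts_pos h).ne rfl,
      Multiset.count_eq_zero_of_notMem fun h => (ρ.parts_pos h).ne rfl]
  · have := h j hj
    simpa [cnt] using this

/-- The parts changed by a move, as multisets. -/
theorem MoveData.exists_replaces {A B : ℕ → ℤ} (h : MoveData A B) :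
    ∃ S T : Multiset ℕ, S.sum = T.sum ∧ A = cnt S ∧ B = cnt T ∧
      ∀ (N : ℕ) (π ρ : N.Partition), Replaces S T π ρ → Move π ρ := by
  cases h with
  | m1 a b h =>
    refine ⟨{2 * a, 2 * b}, {a + b, a + b}, ?_, ?_, ?_,
      fun N π ρ h' => Or.inl ⟨a, b, h, h'⟩⟩
    · simp
      omega
    all_goals
      funext j
      simp only [Multiset.insert_eq_cons, cnt_cons, cnt_singleton]
      try ring
  | m2 a m h =>
    refine ⟨{2 * a, m, m}, {2 * a - 2, m + 1, m + 1}, ?_, ?_, ?_,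
      fun N π ρ h' => Or.inr (Or.inl ⟨a, m, h, h'⟩)⟩
    · simp
      omega
    all_goals
      funext j
      simp only [Multiset.insert_eq_cons, cnt_cons, cnt_singleton]
      try ring
  | m3 m a h =>
    refine ⟨{m, m, 2 * a}, {m - 1, m - 1, 2 * a + 2}, ?_, ?_, ?_,
      fun N π ρ h' => Or.inr (Or.inr (Or.inl ⟨m, a, h, h'⟩))⟩
    · simp
      omega
    all_goals
      funext j
      simp only [Multiset.insert_eq_cons, cnt_cons, cnt_singleton]
      try ring
  | m4 m k h =>
    refine ⟨{m, m, k, k}, {m - 1, m - 1, k + 1, k + 1}, ?_, ?_, ?_,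
      fun N π ρ h' => Or.inr (Or.inr (Or.inr ⟨m, k, h, h'⟩))⟩
    · simp
      omega
    all_goals
      funext j
      simp only [Multiset.insert_eq_cons, cnt_cons, cnt_singleton]
      try ring

/-- A sequence of moves on multiplicity functions starting at a partition is a sequence of moves
on partitions. -/
theorem Reach.exists_partition {f g : ℕ → ℤ} (h : Reach f g) {N : ℕ} (π : N.Partition)
    (hπ : ∀ j, 1 ≤ j → f j = cnt π.parts j) :
    ∃ ρ : N.Partition, (∀ j, 1 ≤ j → g j = cnt ρ.parts j) ∧ Relation.ReflTransGen Move π ρ := by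
  induction h with
  | refl => exact ⟨π, hπ, Relation.ReflTransGen.refl⟩
  | @tail g g' _ hs ih =>
    obtain ⟨ρ, hρ, hr⟩ := ih
    rcases hs with hs | ⟨A, B, hd, hA, hB⟩
    · exact ⟨ρ, fun j hj => by rw [← hs j hj, hρ j hj], hr⟩
    obtain ⟨S, T, hST, rfl, rfl, hmove⟩ := hd.exists_replaces
    have hle : S.filter (0 < ·) ≤ ρ.parts := by
      refine Multiset.le_iff_count.2 fun j => ?_
      rcases Nat.eq_zero_or_pos j with rfl | hj
      · simp
      · have h1 := hA j hj
        rw [hρ j hj, ← cnt_filter S hj] at h1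
        simpa only [cnt, Nat.cast_le] using h1
    have hμ : (ρ.parts - S.filter (0 < ·)) + S.filter (0 < ·) = ρ.parts :=
      Multiset.sub_add_cancel hle
    set μ := ρ.parts - S.filter (0 < ·)
    have hμpos : μ.filter (0 < ·) = μ :=
      Multiset.filter_eq_self.2 fun a ha =>
        ρ.parts_pos (hμ ▸ Multiset.mem_add.2 (Or.inl ha))
    have hsum : ((μ + T).filter (0 < ·)).sum = N := by
      have h1 : μ.sum + (S.filter (0 < ·)).sum = N := by
        rw [← Multiset.sum_add, hμ, ρ.parts_sum]
      rw [sum_filter_pos] at h1 ⊢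
      rw [Multiset.sum_add, ← hST, h1]
    refine ⟨⟨(μ + T).filter (0 < ·), fun {i} hi => (Multiset.mem_filter.1 hi).2, hsum⟩,
      fun j hj => ?_, hr.tail (hmove _ _ _ ⟨μ, ?_, rfl⟩)⟩
    · rw [hB j hj, hρ j hj, cnt_filter _ hj, cnt_add, ← hμ, cnt_add, cnt_filter _ hj]
      ring
    · rw [Multiset.filter_add, hμpos, hμ]

/-- The dimensions of the kernels of the powers of a nilpotent endomorphism with the given Jordan
block sizes. -/
def kerSum (A : Multiset ℕ) (j : ℕ) : ℕ := (A.map fun p => min p j).sum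

theorem kerSum_add (A B : Multiset ℕ) (j : ℕ) : kerSum (A + B) j = kerSum A j + kerSum B j := by
  simp [kerSum]

theorem kerSum_singleton (a j : ℕ) : kerSum {a} j = min a j := by simp [kerSum]

theorem kerSum_cons (a : ℕ) (A : Multiset ℕ) (j : ℕ) :
    kerSum (a ::ₘ A) j = min a j + kerSum A j := by simp [kerSum]

theorem kerSum_filter (A : Multiset ℕ) (j : ℕ) : kerSum (A.filter (0 < ·)) j = kerSum A j := by
  induction A using Multiset.induction_on with
  | empty => rfl
  | cons a A ih =>
    rcases Nat.eq_zero_or_pos a with rfl | ha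
    · simp [kerSum_cons, ih]
    · rw [Multiset.filter_cons_of_pos (p := (0 < ·)) _ ha, kerSum_cons, kerSum_cons, ih]

theorem mult_kerSum (A : Multiset ℕ) {j : ℕ} (hj : 1 ≤ j) : mult (kerSum A) j = cnt A j := by
  induction A using Multiset.induction_on with
  | empty => simp [mult, kerSum, cnt]
  | cons a A ih =>
    have : kerSum (a ::ₘ A) = fun i => min a i + kerSum A i := funext (kerSum_cons a A)
    rw [this, mult_add (fun i => min a i), mult_min a hj, ih, cnt_cons]

end

/-! ### Gradings with weights 1, 0 and -1 -/

section

open Module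

variable {κ : Type*} [Field κ] {V : Type*} [AddCommGroup V] [Module κ V]

/-- A grading of `V` in weights `1`, `0`, `-1` which is compatible with `ω`, given by the
projections `p`, `q`, `r`, for which `x` has no components of negative weight; `z` is the
component of `x` of weight `0`. -/
structure Degen (ω : LinearMap.BilinForm κ V) (x z p q r : End κ V) : Prop where
  sum : p + q + r = 1
  pp : p * p = p
  qq : q * q = q
  rr : r * r = r
  pq : p * q = 0
  qp : q * p = 0
  pr : p * r = 0
  rp : r * p = 0
  qr : q * r = 0
  rq : r * q = 0
  adj : ∀ a b, ω (p a) b = ω a (r b)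
  adj' : ∀ a b, ω (q a) b = ω a (q b)
  qxp : q * x * p = 0
  rxp : r * x * p = 0
  rxq : r * x * q = 0
  eq : z = p * x * p + q * x * q + r * x * r

namespace Degen

variable {ω : LinearMap.BilinForm κ V} {x z p q r : End κ V}

theorem adj_symm (h : Degen ω x z p q r) (a b : V) : ω (r a) b = ω a (p b) := by
  have h1 : ∀ c, c = p c + q c + r c := fun c => by
    conv_lhs => rw [← Module.End.one_apply (R := κ) c, ← h.sum]
    rfl
  have e1 : ω a b = ω (p a) b + ω (q a) b + ω (r a) b := by
    conv_lhs => rw [h1 a]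
    simp
  have e2 : ω a b = ω a (p b) + ω a (q b) + ω a (r b) := by
    conv_lhs => rw [h1 b]
    simp
  rw [h.adj, h.adj'] at e1
  rw [e1] at e2
  linear_combination e2

theorem z_p (h : Degen ω x z p q r) : z * p = p * x * p := by
  rw [h.eq]
  simp only [add_mul, mul_assoc, h.pp, h.qp, h.rp, mul_zero, add_zero]

theorem p_z (h : Degen ω x z p q r) : p * z = p * x * p := by
  rw [h.eq]
  simp only [mul_add, ← mul_assoc, h.pp, h.pq, h.pr, zero_mul, add_zero]

theorem z_q (h : Degen ω x z p q r) : z * q = q * x * q := by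
  rw [h.eq]
  simp only [add_mul, mul_assoc, h.pq, h.qq, h.rq, mul_zero, add_zero, zero_add]

theorem q_z (h : Degen ω x z p q r) : q * z = q * x * q := by
  rw [h.eq]
  simp only [mul_add, ← mul_assoc, h.qp, h.qq, h.qr, zero_mul, add_zero, zero_add]

theorem z_r (h : Degen ω x z p q r) : z * r = r * x * r := by
  rw [h.eq]
  simp only [add_mul, mul_assoc, h.pr, h.qr, h.rr, mul_zero, zero_add]

theorem r_z (h : Degen ω x z p q r) : r * z = r * x * r := by
  rw [h.eq]
  simp only [mul_add, ← mul_assoc, h.rp, h.rq, h.rr, zero_mul, zero_add]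

theorem commute_p (h : Degen ω x z p q r) : Commute z p := h.z_p.trans h.p_z.symm
theorem commute_q (h : Degen ω x z p q r) : Commute z q := h.z_q.trans h.q_z.symm
theorem commute_r (h : Degen ω x z p q r) : Commute z r := h.z_r.trans h.r_z.symm

theorem x_p (h : Degen ω x z p q r) : x * p = z * p := by
  have : (p + q + r) * (x * p) = x * p := by rw [h.sum, one_mul]
  rw [← this, h.z_p, add_mul, add_mul, ← mul_assoc, ← mul_assoc, ← mul_assoc, h.qxp, h.rxp,
    add_zero, add_zero]

theorem r_x (h : Degen ω x z p q r) : r * x = r * z := by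
  have : r * x * (p + q + r) = r * x := by rw [h.sum, mul_one]
  rw [← this, h.r_z, mul_add, mul_add, h.rxp, h.rxq, zero_add, zero_add]

theorem pow_p (h : Degen ω x z p q r) (j : ℕ) : x ^ j * p = z ^ j * p := by
  induction j with
  | zero => simp
  | succ j ih =>
    rw [pow_succ, mul_assoc, h.x_p, h.commute_p.eq, ← mul_assoc, ih, mul_assoc, ← h.commute_p.eq,
      ← mul_assoc, pow_succ]

theorem r_pow (h : Degen ω x z p q r) (j : ℕ) : r * x ^ j = r * z ^ j := by
  induction j with
  | zero => simp
  | succ j ih =>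
    rw [pow_succ', ← mul_assoc, h.r_x, ← h.commute_r.eq, mul_assoc, ih, ← mul_assoc,
      h.commute_r.eq, mul_assoc, pow_succ']

theorem q_pow_p (h : Degen ω x z p q r) (j : ℕ) : q * x ^ j * p = 0 := by
  rw [mul_assoc, h.pow_p, (h.commute_p.pow_left j).eq, ← mul_assoc, h.qp, zero_mul]

theorem q_pow_q (h : Degen ω x z p q r) (j : ℕ) : q * x ^ j * q = z ^ j * q := by
  induction j with
  | zero => simp [h.qq]
  | succ j ih =>
    have h1 : x * q = p * (x * q) + q * (x * q) := by
      have : (p + q + r) * (x * q) = x * q := by rw [h.sum, one_mul]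
      conv_lhs => rw [← this]
      rw [add_mul, add_mul, ← mul_assoc r, h.rxq, add_zero]
    calc q * x ^ (j + 1) * q = q * x ^ j * (x * q) := by rw [pow_succ]; simp only [mul_assoc]
      _ = (q * x ^ j * p) * (x * q) + (q * x ^ j * q) * (x * q) := by
        rw [h1, mul_add, ← mul_assoc _ p, ← mul_assoc _ q, ← h1]
      _ = z ^ (j + 1) * q := by
        rw [h.q_pow_p, ih, zero_mul, zero_add, mul_assoc, ← mul_assoc q, ← h.z_q, ← mul_assoc,
          pow_succ]

theorem isSN (h : Degen ω x z p q r) (hs : IsSN ω x) : IsSN ω z := by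
  refine ⟨hs.alt, hs.nondeg, fun a b => ?_, ?_⟩
  · rw [h.eq]
    simp only [LinearMap.add_apply, Module.End.mul_apply, map_add, h.adj, h.adj', h.adj_symm,
      hs.skew]
    ring
  · obtain ⟨k, hk⟩ := hs.nil
    refine ⟨k, ?_⟩
    have h1 := h.pow_p k
    have h2 := h.q_pow_q k
    have h3 := h.r_pow k
    rw [← (h.commute_r.pow_left k).eq] at h3
    rw [hk] at h1 h2 h3
    rw [← mul_one (z ^ k), ← h.sum, mul_add, mul_add, ← h1, ← h2, ← h3]
    simp

theorem orth (h : Degen ω x z p q r) (hs : IsSN ω x) :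
    ω.orthogonal (LinearMap.range p) = LinearMap.ker r :=
  orth_range_of_adjoint hs.nondeg h.adj

theorem isoStable (h : Degen ω x z p q r) : IsoStable ω x (LinearMap.range p) := by
  constructor
  · rintro _ ⟨a, rfl⟩ _ ⟨b, rfl⟩
    rw [h.adj, ← Module.End.mul_apply, h.rp]
    simp
  · rintro _ ⟨a, rfl⟩
    rw [← Module.End.mul_apply, h.x_p, h.commute_p.eq]
    exact ⟨z a, rfl⟩

/-- The image of the kernel of an endomorphism under a commuting projection. -/
theorem _root_.SympAccess.map_ker_inf_of_commute {e f : End κ V} (he : e * e = e)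
    (hc : Commute f e) {T : Submodule κ V} (hT : ∀ a ∈ T, e a ∈ T) :
    (LinearMap.ker f ⊓ T).map e = LinearMap.range e ⊓ LinearMap.ker f ⊓ T := by
  apply le_antisymm
  · rintro _ ⟨a, ⟨ha, haT⟩, rfl⟩
    refine ⟨⟨⟨a, rfl⟩, ?_⟩, hT a haT⟩
    change f (e a) = 0
    rw [← Module.End.mul_apply, hc.eq, Module.End.mul_apply, LinearMap.mem_ker.1 ha, map_zero]
  · rintro _ ⟨⟨⟨a, rfl⟩, ha⟩, haT⟩
    refine ⟨e a, ⟨ha, haT⟩, ?_⟩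
    rw [← Module.End.mul_apply, he]

/-- The associated graded endomorphism `z` acts on `F ⊕ F^⊥ / F ⊕ V / F^⊥`, for `F` the part of
weight `1`; the last summand is dual to `F`. -/
theorem kerDim_eq [FiniteDimensional κ V] (h : Degen ω x z p q r) (hs : IsSN ω x) (j : ℕ) :
    kerDim z j = 2 * kerDimOn x (LinearMap.range p) j + kerDimQuot ω x (LinearMap.range p) j := by
  have hcp := h.commute_p.pow_left j
  have hcq := h.commute_q.pow_left j
  have hcr := h.commute_r.pow_left j
  have hx : ∀ a, p a + q a + r a = a := fun a => by
    conv_rhs => rw [← Module.End.one_apply (R := κ) a, ← h.sum]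
    rfl
  -- splitting the kernel of `z ^ j` into its graded components
  have hP : LinearMap.range p ⊓ LinearMap.ker (z ^ j) =
      LinearMap.range p ⊓ LinearMap.ker (x ^ j) := by
    ext a
    simp only [Submodule.mem_inf, LinearMap.mem_range, LinearMap.mem_ker]
    refine and_congr_right ?_
    rintro ⟨b, rfl⟩
    rw [← Module.End.mul_apply, ← Module.End.mul_apply, h.pow_p]
  have h1 := finrank_map_add_inf_ker p (LinearMap.ker (z ^ j))
  have e1 := map_ker_inf_of_commute (T := ⊤) h.pp hcp fun _ _ => trivial
  rw [inf_top_eq, inf_top_eq, hP] at e1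
  rw [e1] at h1
  have h2 := finrank_map_add_inf_ker r (LinearMap.ker (z ^ j) ⊓ LinearMap.ker p)
  have hrp : LinearMap.range r ≤ LinearMap.ker p := by
    rintro _ ⟨a, rfl⟩
    rw [LinearMap.mem_ker, ← Module.End.mul_apply, h.pr, LinearMap.zero_apply]
  rw [map_ker_inf_of_commute h.rr hcr fun a _ => hrp ⟨a, rfl⟩,
    inf_eq_left.2 (inf_le_left.trans hrp)] at h2
  have hQ : LinearMap.ker (z ^ j) ⊓ LinearMap.ker p ⊓ LinearMap.ker r =
      LinearMap.range q ⊓ LinearMap.ker (z ^ j) := by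
    ext a
    simp only [Submodule.mem_inf, LinearMap.mem_range, LinearMap.mem_ker]
    constructor
    · rintro ⟨⟨hz, hp⟩, hr⟩
      refine ⟨⟨a, ?_⟩, hz⟩
      conv_rhs => rw [← hx a, hp, hr]
      simp
    · rintro ⟨⟨b, rfl⟩, hz⟩
      refine ⟨⟨hz, ?_⟩, ?_⟩ <;> rw [← Module.End.mul_apply]
      · rw [h.pq, LinearMap.zero_apply]
      · rw [h.rq, LinearMap.zero_apply]
  rw [hQ] at h2
  -- the components of weight `1` and `-1` are dual to each other
  have h3 : finrank κ (LinearMap.range r ⊓ LinearMap.ker (z ^ j) : Submodule κ V) =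
      finrank κ (LinearMap.range p ⊓ LinearMap.ker (x ^ j) : Submodule κ V) := by
    rw [← hP]
    have a1 := finrank_map_add_inf_ker (z ^ j) (LinearMap.range p)
    have a2 := finrank_map_add_inf_ker (z ^ j) (LinearMap.range r)
    rw [← LinearMap.range_comp] at a1 a2
    have a3 := finrank_range_of_adjoint hs.nondeg h.adj
    have a4 : finrank κ (LinearMap.range ((z ^ j) ∘ₗ p)) =
        finrank κ (LinearMap.range ((z ^ j) ∘ₗ r)) := by
      have : LinearMap.range ((z ^ j) ∘ₗ r) =
          LinearMap.range (((-1) ^ j : κ) • ((z ^ j) ∘ₗ r)) := by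
        rcases neg_one_pow_eq_or κ j with h1 | h1
        · rw [h1, one_smul]
        · rw [h1, neg_one_smul, LinearMap.range_neg]
      rw [this]
      refine finrank_range_of_adjoint hs.nondeg fun a b => ?_
      rw [LinearMap.comp_apply, (h.isSN hs).skew_pow, h.adj, ← Module.End.mul_apply, ← hcr.eq]
      simp
    omega
  -- the component of weight `0` is `F^⊥ / F` for `F` the component of weight `1`
  have h4 : finrank κ (LinearMap.range q ⊓ LinearMap.ker (z ^ j) : Submodule κ V) =
      kerDimQuot ω x (LinearMap.range p) j := by
    have b1 := h.isoStable.finrank_quotKer (ω := ω) j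
    have b2 := finrank_map_add_inf_ker q (quotKer ω x (LinearMap.range p) j)
    have hmem : ∀ a, a ∈ quotKer ω x (LinearMap.range p) j ↔ r a = 0 ∧ (z ^ j) (q a) = 0 := by
      intro a
      rw [quotKer, Submodule.mem_inf, h.orth hs, LinearMap.mem_ker, Submodule.mem_comap]
      refine and_congr_right fun hr => ?_
      have c1 : r ((x ^ j) a) = 0 := by
        rw [← Module.End.mul_apply, h.r_pow, ← hcr.eq, Module.End.mul_apply, hr, map_zero]
      have c2 : q ((x ^ j) a) = (z ^ j) (q a) := by
        conv_lhs => rw [← hx a, hr, add_zero, map_add, map_add]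
        have := LinearMap.congr_fun (h.q_pow_p j) a
        have h' := LinearMap.congr_fun (h.q_pow_q j) a
        simp only [Module.End.mul_apply, LinearMap.zero_apply] at this h'
        rw [this, h', zero_add]
      rw [← c2]
      constructor
      · rintro ⟨b, hb⟩
        rw [← hb, ← Module.End.mul_apply, h.qp, LinearMap.zero_apply]
      · intro h0
        refine ⟨(x ^ j) a, ?_⟩
        conv_rhs => rw [← hx ((x ^ j) a), c1, h0]
        simp
    have e2 : (quotKer ω x (LinearMap.range p) j).map q =
        LinearMap.range q ⊓ LinearMap.ker (z ^ j) := by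
      ext a
      constructor
      · rintro ⟨b, hb, rfl⟩
        exact ⟨⟨b, rfl⟩, ((hmem b).1 hb).2⟩
      · rintro ⟨⟨b, rfl⟩, hb⟩
        refine ⟨q b, (hmem _).2 ⟨?_, ?_⟩, ?_⟩
        · rw [← Module.End.mul_apply, h.rq, LinearMap.zero_apply]
        · rw [← Module.End.mul_apply q, h.qq]
          exact hb
        · rw [← Module.End.mul_apply, h.qq]
    have e3 : quotKer ω x (LinearMap.range p) j ⊓ LinearMap.ker q = LinearMap.range p := by
      ext a
      rw [Submodule.mem_inf, hmem, LinearMap.mem_ker]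
      constructor
      · rintro ⟨⟨h1, -⟩, h2⟩
        refine ⟨a, ?_⟩
        conv_rhs => rw [← hx a, h1, h2]
        simp
      · rintro ⟨b, rfl⟩
        have c1 := LinearMap.congr_fun h.rp b
        have c2 := LinearMap.congr_fun h.qp b
        simp only [Module.End.mul_apply, LinearMap.zero_apply] at c1 c2
        simp [c1, c2]
    rw [e2, e3] at b2
    omega
  unfold kerDimOn
  change finrank κ _ = _
  omega

/-- The component of weight `0` is obtained by moves. -/
theorem reach [FiniteDimensional κ V] (h2 : (2 : κ) ≠ 0) (h : Degen ω x z p q r)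
    (hs : IsSN ω x) : Reach (mult (kerDim x)) (mult (kerDim z)) := by
  refine (isoStable_reach h2 _ hs h.isoStable le_rfl).2.trans (Reach.of_eq fun j _ => ?_)
  have : kerDim z = fun j => (kerDimOn x (LinearMap.range p) j + kerDimOn x (LinearMap.range p) j) +
      kerDimQuot ω x (LinearMap.range p) j := funext fun j => by rw [h.kerDim_eq hs]; ring
  rw [this, mult_add (fun j => kerDimOn x (LinearMap.range p) j + kerDimOn x (LinearMap.range p) j),
    mult_add]
  ring

end Degen

end

/-! ### Gradings by the integers -/

section

open Module

variable {κ : Type*} [Field κ] {V : Type*} [AddCommGroup V] [Module κ V]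

/-- A grading of `V` by the integers which is compatible with `ω`, given by the projections
`p k`. -/
structure Grading (ω : LinearMap.BilinForm κ V) (p : ℤ → End κ V) (S : Finset ℤ) : Prop where
  sum : ∑ k ∈ S, p k = 1
  idem : ∀ k, p k * p k = p k
  orth : ∀ k l, k ≠ l → p k * p l = 0
  adj : ∀ k a b, ω (p k a) b = ω a (p (-k) b)

namespace Grading

variable {ω : LinearMap.BilinForm κ V} {p : ℤ → End κ V} {S : Finset ℤ}

theorem ext (h : Grading ω p S) {x y : End κ V} (he : ∀ k l, p k * x * p l = p k * y * p l) :
    x = y := by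
  have h1 : ∀ z : End κ V, z = ∑ k ∈ S, ∑ l ∈ S, p k * z * p l := fun z => by
    simp_rw [← Finset.mul_sum, h.sum, mul_one, ← Finset.sum_mul, h.sum, one_mul]
  rw [h1 x, h1 y]
  simp_rw [he]

theorem mul_mul (h : Grading ω p S) (k l m o : ℤ) (x : End κ V) :
    p k * (p l * x * p m) * p o = if k = l ∧ m = o then p k * x * p o else 0 := by
  split_ifs with h1
  · obtain ⟨rfl, rfl⟩ := h1
    rw [← mul_assoc, ← mul_assoc, h.idem, mul_assoc, h.idem]
  · by_cases hk : k = l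
    · rw [mul_assoc, mul_assoc _ _ (p o), h.orth m o fun hm => h1 ⟨hk, hm⟩, mul_zero, mul_zero]
    · rw [← mul_assoc, ← mul_assoc, h.orth k l hk, zero_mul, zero_mul, zero_mul]

/-- The component `z` of weight `0` of an endomorphism `x` without components of negative weight has
a Jordan type obtained by moves. The weights `t` and `-t` of largest absolute value are separated
from the other ones by a `Degen`, and the bound `T` on the absolute values of the remaining weights
decreases. -/
theorem reach [FiniteDimensional κ V] (h2 : (2 : κ) ≠ 0) (h : Grading ω p S) (T : ℕ) :
    ∀ {x z : End κ V}, IsSN ω x → (∀ k l, k < l → p k * x * p l = 0) →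
      (∀ k l, k ≠ l → ((T : ℤ) < |k| ∨ (T : ℤ) < |l|) → p k * x * p l = 0) →
      (∀ k, p k * z * p k = p k * x * p k) → (∀ k l, k ≠ l → p k * z * p l = 0) →
      Reach (mult (kerDim x)) (mult (kerDim z)) := by
  induction T with
  | zero =>
    intro x z _ _ hx hd hz
    obtain rfl : x = z := h.ext fun k l => by
      by_cases hkl : k = l
      · subst hkl
        exact (hd k).symm
      · rw [hz k l hkl, hx k l hkl]
        rcases eq_or_ne k 0 with rfl | hk
        · exact Or.inr (by simpa using (Ne.symm hkl))
        · exact Or.inl (by simpa using hk)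
    exact Relation.ReflTransGen.refl
  | succ T ih =>
    intro x z hs hlt hx hd hz
    set t : ℤ := (T : ℤ) + 1 with ht
    have htt : t ≠ -t := by omega
    have habs : |t| = t := abs_of_nonneg (by omega)
    have hTt : ((T + 1 : ℕ) : ℤ) = t := by rw [ht]; push_cast; rfl
    have hxl : ∀ k, k ≠ t → p k * x * p t = 0 := fun k hk => by
      rcases lt_or_gt_of_ne hk with h1 | h1
      · exact hlt k t h1
      · refine hx k t hk (Or.inl ?_)
        rw [hTt, lt_abs]
        exact Or.inl h1
    have hxr : ∀ k, k ≠ -t → p (-t) * x * p k = 0 := fun k hk => by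
      rcases lt_or_gt_of_ne hk with h1 | h1
      · refine hx _ k hk.symm (Or.inr ?_)
        rw [hTt, lt_abs]
        exact Or.inr (by omega)
      · exact hlt _ k h1
    -- `t` is the highest weight, so `x` preserves the part of weight `t`
    have hxt : x * p t = p t * x * p t := h.ext fun k l => by
      by_cases hk : k = t
      · rw [hk, ← mul_assoc, ← mul_assoc, ← mul_assoc, h.idem]
      · rw [← mul_assoc, hxl k hk, ← mul_assoc, ← mul_assoc, h.orth k t hk]
        simp
    -- dually for the lowest weight
    have hrx : p (-t) * x = p (-t) * x * p (-t) := h.ext fun k l => by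
      by_cases hl : l = -t
      · simp only [hl, mul_assoc, h.idem]
      · rw [mul_assoc, hxr l hl, mul_assoc, mul_assoc, h.orth _ l (Ne.symm hl)]
        simp
    have hpr := h.orth t (-t) htt
    have hrp := h.orth (-t) t htt.symm
    set q := 1 - p t - p (-t) with hq
    have hpq : p t * q = 0 := by rw [hq, mul_sub, mul_sub, h.idem, hpr, mul_one]; simp
    have hqp : q * p t = 0 := by rw [hq, sub_mul, sub_mul, h.idem, hrp, one_mul]; simp
    have hrq : p (-t) * q = 0 := by rw [hq, mul_sub, mul_sub, h.idem, hrp, mul_one]; simp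
    have hqr : q * p (-t) = 0 := by rw [hq, sub_mul, sub_mul, h.idem, hpr, one_mul]; simp
    have hdeg : Degen ω x (p t * x * p t + q * x * q + p (-t) * x * p (-t)) (p t) q (p (-t)) := by
      refine ⟨by rw [hq]; abel, h.idem t, ?_, h.idem _, hpq, hqp, hpr, hrp, hqr, hrq, h.adj t,
        fun a b => ?_, ?_, ?_, ?_, rfl⟩
      · nth_rewrite 1 [hq]
        rw [sub_mul, sub_mul, one_mul, hpq, hrq, sub_zero, sub_zero]
      · simp only [hq, LinearMap.sub_apply, Module.End.one_apply, map_sub, h.adj, neg_neg]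
        ring
      · rw [mul_assoc, hxt, ← mul_assoc, ← mul_assoc, hqp, zero_mul, zero_mul]
      · rw [mul_assoc, hxt, ← mul_assoc, ← mul_assoc, hrp, zero_mul, zero_mul]
      · rw [hrx, mul_assoc, hrq, mul_zero]
    have hkq : ∀ k, p k * q = if k = t ∨ k = -t then 0 else p k := fun k => by
      split_ifs with hk
      · rcases hk with rfl | rfl
        exacts [hpq, hrq]
      · push Not at hk
        rw [hq, mul_sub, mul_sub, h.orth k t hk.1, h.orth k _ hk.2, mul_one, sub_zero, sub_zero]
    have hqk : ∀ k, q * p k = if k = t ∨ k = -t then 0 else p k := fun k => by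
      split_ifs with hk
      · rcases hk with rfl | rfl
        exacts [hqp, hqr]
      · push Not at hk
        rw [hq, sub_mul, sub_mul, h.orth t k hk.1.symm, h.orth _ k hk.2.symm, one_mul, sub_zero,
          sub_zero]
    -- the components which remain after the weights `t` and `-t` have been separated
    have hcomp : ∀ k l, p k * (p t * x * p t + q * x * q + p (-t) * x * p (-t)) * p l =
        if k = l ∨ (¬ (k = t ∨ k = -t) ∧ ¬ (l = t ∨ l = -t)) then p k * x * p l else 0 := by
      intro k l
      have h1 : p k * (q * x * q) * p l = (p k * q) * x * (q * p l) := by simp only [mul_assoc]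
      rw [mul_add, mul_add, add_mul, add_mul, h.mul_mul, h.mul_mul, h1, hkq, hqk]
      by_cases h1 : k = t <;> by_cases h2 : k = -t <;> by_cases h3 : l = t <;>
        by_cases h4 : l = -t <;> by_cases h5 : k = l <;>
        first | (exfalso; omega) | simp [h1, h2, h3, h4, h5, htt, htt.symm, Ne.symm]
    refine (hdeg.reach h2 hs).trans (ih (hdeg.isSN hs) (fun k l hkl => ?_)
      (fun k l hkl hT => ?_) (fun k => ?_) hz)
    · rw [hcomp, hlt k l hkl, ite_self]
    · rw [hcomp]
      split_ifs with h1
      · refine hx k l hkl ?_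
        push_cast
        have h1 := h1.resolve_left hkl
        simp only [lt_abs] at hT ⊢
        omega
      · rfl
    · rw [hcomp, if_pos (Or.inl rfl), hd]

end Grading

end

/-! ### The standard symplectic space -/

section

open Module Matrix

variable {κ : Type*} [Field κ] {n : ℕ}

/-- The standard symplectic form. -/
noncomputable def spForm (n : ℕ) (κ : Type*) [Field κ] :
    LinearMap.BilinForm κ (Fin n ⊕ Fin n → κ) :=
  Matrix.toBilin' (Matrix.J (Fin n) κ)

theorem spForm_apply (u v : Fin n ⊕ Fin n → κ) :
    spForm n κ u v = ∑ i, (u (Sum.inr i) * v (Sum.inl i) - u (Sum.inl i) * v (Sum.inr i)) := by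
  rw [spForm, Matrix.toBilin'_apply', J]
  simp [dotProduct, Fintype.sum_sum_type, Matrix.mulVec, Matrix.one_apply, fromBlocks,
    ← sub_eq_neg_add]

theorem spForm_isAlt : (spForm n κ).IsAlt := fun u => by
  rw [spForm_apply]
  exact Finset.sum_eq_zero fun i _ => by ring

theorem spForm_nondegenerate : (spForm n κ).Nondegenerate :=
  (Matrix.nondegenerate_of_det_ne_zero (isUnit_det_J (Fin n) κ).ne_zero).toBilin'

theorem adjoint_iff {A B : Matrix (Fin n ⊕ Fin n) (Fin n ⊕ Fin n) κ} :
    (∀ u v, spForm n κ (toLin' A u) v = spForm n κ u (toLin' B v)) ↔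
      Aᵀ * Matrix.J (Fin n) κ = Matrix.J (Fin n) κ * B := by
  have h1 : toBilin' (Aᵀ * Matrix.J (Fin n) κ) = (spForm n κ).comp (toLin' A) LinearMap.id := by
    rw [spForm, ← toLin'_one, toBilin'_comp, mul_one]
  have h2 : toBilin' (Matrix.J (Fin n) κ * B) = (spForm n κ).comp LinearMap.id (toLin' B) := by
    rw [spForm, ← toLin'_one, toBilin'_comp, transpose_one, one_mul]
  rw [← (toBilin' (R₁ := κ)).injective.eq_iff, h1, h2]
  constructor
  · intro h
    exact LinearMap.ext fun u => LinearMap.ext fun v => h u v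
  · intro h u v
    exact LinearMap.congr_fun (LinearMap.congr_fun h u) v

theorem mem_sp_iff {A : Matrix (Fin n ⊕ Fin n) (Fin n ⊕ Fin n) κ} :
    A ∈ LieAlgebra.Symplectic.sp (Fin n) κ ↔
      ∀ u v, spForm n κ (toLin' A u) v = -spForm n κ u (toLin' A v) := by
  have h : A ∈ LieAlgebra.Symplectic.sp (Fin n) κ ↔
      Aᵀ * Matrix.J (Fin n) κ = Matrix.J (Fin n) κ * (-A) := by
    rw [LieAlgebra.Symplectic.sp, mem_skewAdjointMatricesLieSubalgebra,
      mem_skewAdjointMatricesSubmodule]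
    rfl
  rw [h, ← adjoint_iff]
  simp only [map_neg, LinearMap.neg_apply]

theorem mem_symplectic_iff {A : Matrix (Fin n ⊕ Fin n) (Fin n ⊕ Fin n) κ} :
    A ∈ symplecticGroup (Fin n) κ ↔
      ∀ u v, spForm n κ (toLin' A u) (toLin' A v) = spForm n κ u v := by
  rw [SymplecticGroup.mem_iff']
  have h : toBilin' (Aᵀ * Matrix.J (Fin n) κ * A) = (spForm n κ).comp (toLin' A) (toLin' A) := by
    rw [spForm, toBilin'_comp]
  rw [← (toBilin' (R₁ := κ)).injective.eq_iff, h]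
  constructor
  · intro h u v
    exact LinearMap.congr_fun (LinearMap.congr_fun h u) v
  · intro h
    exact LinearMap.ext fun u => LinearMap.ext fun v => h u v

theorem isSN_toLin' (x : NilCone n κ) : IsSN (spForm n κ) (toLin' x.1) := by
  refine ⟨spForm_isAlt, spForm_nondegenerate, mem_sp_iff.1 x.2.1, ?_⟩
  obtain ⟨k, hk⟩ := x.2.2
  exact ⟨k, by rw [← toLin'_pow, hk, map_zero]⟩

/-- The nilpotent element of `sp` given by a skew nilpotent endomorphism. -/
noncomputable def NilCone.ofEnd (x : End κ (Fin n ⊕ Fin n → κ)) (h : IsSN (spForm n κ) x) :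
    NilCone n κ :=
  ⟨LinearMap.toMatrix' x, mem_sp_iff.2 fun u v => by rw [toLin'_toMatrix', h.skew], by
    obtain ⟨k, hk⟩ := h.nil
    refine ⟨k, ?_⟩
    have : toLin' (LinearMap.toMatrix' x ^ k) = toLin' 0 := by
      rw [toLin'_pow, toLin'_toMatrix', hk, map_zero]
    exact toLin'.injective this⟩

@[simp] theorem NilCone.toLin'_ofEnd (x : End κ (Fin n ⊕ Fin n → κ))
    (h : IsSN (spForm n κ) x) : toLin' (NilCone.ofEnd x h).1 = x :=
  toLin'_toMatrix' x

/-- An isometry intertwining two elements shows that they are conjugate. -/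
theorem mem_orbit_of_intertwiner {x y : NilCone n κ} (g : End κ (Fin n ⊕ Fin n → κ))
    (hg : ∀ u v, spForm n κ (g u) (g v) = spForm n κ u v)
    (hc : ∀ u, g (toLin' x.1 u) = toLin' y.1 (g u)) : y ∈ orbit x := by
  have hmem : LinearMap.toMatrix' g ∈ symplecticGroup (Fin n) κ :=
    mem_symplectic_iff.2 fun u v => by rw [toLin'_toMatrix', hg]
  refine ⟨⟨_, hmem⟩, ?_⟩
  have h1 : LinearMap.toMatrix' g * x.1 = y.1 * LinearMap.toMatrix' g := by
    apply toLin'.injective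
    rw [toLin'_mul, toLin'_mul, toLin'_toMatrix']
    exact LinearMap.ext hc
  have h2 : LinearMap.toMatrix' g *
      (((⟨_, hmem⟩ : symplecticGroup (Fin n) κ)⁻¹ : symplecticGroup (Fin n) κ) :
        Matrix (Fin n ⊕ Fin n) (Fin n ⊕ Fin n) κ) = 1 :=
    congrArg Subtype.val (mul_inv_cancel (⟨_, hmem⟩ : symplecticGroup (Fin n) κ))
  change y.1 = LinearMap.toMatrix' g * x.1 * _
  rw [h1, mul_assoc, h2, mul_one]

theorem kerDim_of_mem_orbit {x y : NilCone n κ} (h : y ∈ orbit x) :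
    kerDim (toLin' y.1) = kerDim (toLin' x.1) := by
  obtain ⟨g, hg⟩ := h
  have h1 : (g : Matrix (Fin n ⊕ Fin n) (Fin n ⊕ Fin n) κ) *
      ((g⁻¹ : symplecticGroup (Fin n) κ) : Matrix (Fin n ⊕ Fin n) (Fin n ⊕ Fin n) κ) = 1 :=
    congrArg Subtype.val (mul_inv_cancel g)
  have h2 : ((g⁻¹ : symplecticGroup (Fin n) κ) : Matrix (Fin n ⊕ Fin n) (Fin n ⊕ Fin n) κ) *
      (g : Matrix (Fin n ⊕ Fin n) (Fin n ⊕ Fin n) κ) = 1 :=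
    congrArg Subtype.val (inv_mul_cancel g)
  funext j
  have hpow : ∀ j, y.1 ^ j = (g : Matrix (Fin n ⊕ Fin n) (Fin n ⊕ Fin n) κ) * x.1 ^ j *
      ((g⁻¹ : symplecticGroup (Fin n) κ) : Matrix (Fin n ⊕ Fin n) (Fin n ⊕ Fin n) κ) := by
    intro j
    induction j with
    | zero => simp [h1]
    | succ j ih =>
      rw [pow_succ, ih, hg, pow_succ]
      simp only [mul_assoc]
      rw [← mul_assoc _ (g : Matrix (Fin n ⊕ Fin n) (Fin n ⊕ Fin n) κ), h2, one_mul]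
  have e : LinearMap.ker (toLin' y.1 ^ j) = (LinearMap.ker (toLin' x.1 ^ j)).map
      (toLin'OfInv h2 h1 : (Fin n ⊕ Fin n → κ) →ₗ[κ] (Fin n ⊕ Fin n → κ)) := by
    ext u
    rw [← toLin'_pow, ← toLin'_pow, Submodule.mem_map, hpow]
    constructor
    · intro hu
      rw [LinearMap.mem_ker, mul_assoc, toLin'_mul_apply, toLin'_mul_apply] at hu
      have := congrArg (toLin' ((g⁻¹ : symplecticGroup (Fin n) κ) :
        Matrix (Fin n ⊕ Fin n) (Fin n ⊕ Fin n) κ)) hu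
      rw [map_zero, ← toLin'_mul_apply, h2, toLin'_one, LinearMap.id_apply] at this
      refine ⟨_, this, ?_⟩
      change toLin' _ (toLin' _ u) = u
      rw [← toLin'_mul_apply, h1, toLin'_one, LinearMap.id_apply]
    · rintro ⟨v, hv, rfl⟩
      change toLin' _ (toLin' _ v) = 0
      rw [← toLin'_mul_apply, mul_assoc, h2, mul_one, toLin'_mul_apply, LinearMap.mem_ker.1 hv,
        map_zero]
  rw [kerDim, e]
  exact LinearEquiv.finrank_map_eq (toLin'OfInv h2 h1) _

end

/-! ### Limits along cocharacters -/

section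

open Module Matrix

variable {κ : Type*} [Field κ] {n : ℕ}

/-- A Laurent polynomial function is a linear combination of characters of the multiplicative group.
-/
theorem laurent_eval (f : LaurentPolynomial κ) : ∃ c : ℤ →₀ κ, ∀ a : κˣ,
    LaurentPolynomial.eval₂ (RingHom.id κ) a f = c.sum fun k r => r * ((a ^ k : κˣ) : κ) := by
  induction f using LaurentPolynomial.induction_on' with
  | add p q hp hq =>
    obtain ⟨c, hc⟩ := hp
    obtain ⟨d, hd⟩ := hq
    refine ⟨c + d, fun a => ?_⟩
    rw [map_add, hc, hd, Finsupp.sum_add_index' (fun _ => zero_mul _) fun _ _ _ => add_mul _ _ _]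
  | C_mul_T k r =>
    refine ⟨Finsupp.single k r, fun a => ?_⟩
    rw [LaurentPolynomial.eval₂_C_mul_T, Finsupp.sum_single_index (zero_mul _)]
    rfl

theorem eq_zero_of_eval_units [Infinite κ] {f : Polynomial κ}
    (h : ∀ a : κˣ, f.eval (a : κ) = 0) : f = 0 := by
  refine Polynomial.eq_zero_of_infinite_isRoot f
    (((Set.finite_singleton (0 : κ)).infinite_compl).mono fun a ha => ?_)
  exact h (Units.mk0 a ha)

/-- The characters `a ↦ a ^ k` of the multiplicative group are linearly independent. -/
theorem zpow_independent [Infinite κ] {I : Type*} (S : Finset ℤ) {P Q : ℤ → Matrix I I κ}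
    (h : ∀ a : κˣ, ∑ k ∈ S, ((a ^ k : κˣ) : κ) • P k = ∑ k ∈ S, ((a ^ k : κˣ) : κ) • Q k) :
    ∀ k ∈ S, P k = Q k := by
  have hinj : Function.Injective fun k : ℤ => (Units.coeHom κ).comp (zpowGroupHom k) := by
    intro k l hkl
    by_contra hne
    have hpow : ∀ d : ℕ, 0 < d → ∃ a : κˣ, a ^ d ≠ 1 := by
      intro d hd
      by_contra! hall
      have h0 : (Polynomial.X ^ d - 1 : Polynomial κ) = 0 :=
        eq_zero_of_eval_units fun a => by
          simp [← Units.val_pow_eq_pow_val, hall a]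
      have := congrArg (Polynomial.eval 0) h0
      simp [hd.ne'] at this
    have hkl' : ∀ a : κˣ, a ^ k = a ^ l := fun a => Units.ext (DFunLike.congr_fun hkl a)
    obtain ⟨a, ha⟩ := hpow (k - l).natAbs (by omega)
    apply ha
    have h1 : a ^ (k - l) = 1 := by rw [_root_.zpow_sub, hkl' a, mul_inv_cancel]
    rcases Int.natAbs_eq (k - l) with h2 | h2
    · rw [← zpow_natCast, ← h2, h1]
    · rw [h2, _root_.zpow_neg, inv_eq_one, zpow_natCast] at h1
      exact h1
  have hli := (linearIndependent_monoidHom κˣ κ).comp _ hinj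
  rw [linearIndependent_iff'] at hli
  intro k hk
  ext i j
  refine sub_eq_zero.1 (hli S (fun k => P k i j - Q k i j) (funext fun a => ?_) k hk)
  have := congrFun (congrFun (h a) i) j
  simp only [Matrix.sum_apply, Matrix.smul_apply, smul_eq_mul] at this
  simp only [Finset.sum_apply, Pi.smul_apply, Function.comp_apply, smul_eq_mul, sub_mul,
    Finset.sum_sub_distrib, MonoidHom.comp_apply, zpowGroupHom_apply, Units.coeHom_apply,
    Pi.zero_apply]
  rw [sub_eq_zero]
  simpa only [mul_comm] using this

/-- A monomial `a ^ d * m` which extends to a polynomial `f` has nonnegative degree unless `m = 0`,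
and its value at `0` is the coefficient of degree `0`. -/
theorem limit_entry [Infinite κ] {f : Polynomial κ} {m : κ} {d : ℤ}
    (h : ∀ a : κˣ, f.eval (a : κ) = ((a ^ d : κˣ) : κ) * m) :
    (d < 0 → m = 0) ∧ f.eval 0 = if d = 0 then m else 0 := by
  rcases lt_or_ge d 0 with hd | hd
  · obtain ⟨e, he⟩ : ∃ e : ℕ, d = -(e : ℤ) := ⟨d.natAbs, by omega⟩
    have h0 : f * Polynomial.X ^ e - Polynomial.C m = 0 :=
      eq_zero_of_eval_units fun a => by
        rw [Polynomial.eval_sub, Polynomial.eval_mul, h, he, _root_.zpow_neg, zpow_natCast,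
          Polynomial.eval_pow, Polynomial.eval_X, Polynomial.eval_C, mul_right_comm,
          ← Units.val_pow_eq_pow_val, Units.inv_mul, one_mul, sub_self]
    have hm : m = 0 := by
      have := congrArg (Polynomial.eval 0) h0
      simpa [show e ≠ 0 by omega] using this
    refine ⟨fun _ => hm, ?_⟩
    have : f = 0 := eq_zero_of_eval_units fun a => by rw [h, hm, mul_zero]
    simp [this, hm]
  · obtain ⟨e, rfl⟩ := Int.eq_ofNat_of_zero_le hd
    refine ⟨fun h => by omega, ?_⟩
    have h0 : f - Polynomial.C m * Polynomial.X ^ e = 0 :=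
      eq_zero_of_eval_units fun a => by
        rw [Polynomial.eval_sub, h, zpow_natCast, Polynomial.eval_mul, Polynomial.eval_pow,
          Polynomial.eval_X, Polynomial.eval_C, Units.val_pow_eq_pow_val, mul_comm, sub_self]
    rw [sub_eq_zero.1 h0]
    rcases Nat.eq_zero_or_pos e with rfl | he
    · simp
    · simp [he.ne']

/-- The weight spaces of a cocharacter: it is the sum of `a ^ k` times projections `P k`. -/
theorem Cocharacter.exists_weights [Infinite κ] (c : Cocharacter n κ) :
    ∃ (N : ℕ) (P : ℤ → Matrix (Fin n ⊕ Fin n) (Fin n ⊕ Fin n) κ),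
      (∀ k, (N : ℤ) < |k| → P k = 0) ∧
      (∀ a : κˣ, (c.toHom a).1 = ∑ k ∈ Finset.Icc (-(N : ℤ)) N, ((a ^ k : κˣ) : κ) • P k) ∧
      (∀ k l, P k * P l = if k = l then P k else 0) ∧
      (∑ k ∈ Finset.Icc (-(N : ℤ)) N, P k = 1) ∧
      ∀ k, (P k)ᵀ * Matrix.J (Fin n) κ = Matrix.J (Fin n) κ * P (-k) := by
  obtain ⟨L, hL⟩ := c.regular
  choose d hd using fun i j => laurent_eval (L i j)
  obtain ⟨N, hN⟩ : ∃ N : ℕ, ∀ i j, ∀ k ∈ (d i j).support, |k| ≤ (N : ℤ) := by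
    refine ⟨∑ i, ∑ j, ∑ k ∈ (d i j).support, k.natAbs, fun i j k hk => ?_⟩
    rw [Int.abs_eq_natAbs]
    refine Int.ofNat_le.2 ((Finset.single_le_sum (f := Int.natAbs)
      (fun _ _ => Nat.zero_le _) hk).trans
      ((Finset.single_le_sum (f := fun j => ∑ k ∈ (d i j).support, k.natAbs)
        (fun _ _ => Nat.zero_le _) (Finset.mem_univ j)).trans
      (Finset.single_le_sum (f := fun i => ∑ j, ∑ k ∈ (d i j).support, k.natAbs)
        (fun _ _ => Nat.zero_le _) (Finset.mem_univ i))))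
  set S := Finset.Icc (-(N : ℤ)) N with hS
  have hmem : ∀ k, k ∈ S ↔ |k| ≤ (N : ℤ) := fun k => by rw [hS, Finset.mem_Icc, abs_le]
  set P : ℤ → Matrix (Fin n ⊕ Fin n) (Fin n ⊕ Fin n) κ := fun k => Matrix.of fun i j => d i j k
    with hP
  have hP0 : ∀ k, (N : ℤ) < |k| → P k = 0 := fun k hk => by
    ext i j
    exact Finsupp.notMem_support_iff.1 fun h => (hN i j k h).not_gt hk
  have hc : ∀ a : κˣ, (c.toHom a).1 = ∑ k ∈ S, ((a ^ k : κˣ) : κ) • P k := fun a => by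
    ext i j
    have h1 : (c.toHom a).1 i j = _ := hL a i j
    have h2 := Finsupp.sum_of_support_subset (d i j) (fun k hk => (hmem k).2 (hN i j k hk))
      (fun k r => r * ((a ^ k : κˣ) : κ)) fun _ _ => zero_mul _
    rw [h1, hd, h2]
    simp [Matrix.sum_apply, hP, mul_comm]
  -- compare coefficients of `a ^ k` in `c (a * b) = c a * c b`
  have hPc : ∀ k (b : κˣ), P k * (c.toHom b).1 = ((b ^ k : κˣ) : κ) • P k := fun k b => by
    by_cases hk : k ∈ S
    · refine zpow_independent S (P := fun k => P k * (c.toHom b).1)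
        (Q := fun k => ((b ^ k : κˣ) : κ) • P k) (fun a => ?_) k hk
      have h1 : (c.toHom (a * b)).1 = (c.toHom a).1 * (c.toHom b).1 := by rw [map_mul]; rfl
      rw [hc a, Finset.sum_mul, hc (a * b)] at h1
      simp only [Matrix.smul_mul] at h1
      rw [← h1]
      refine Finset.sum_congr rfl fun k _ => ?_
      rw [mul_zpow, smul_smul, Units.val_mul]
    · rw [hP0 k (not_le.1 fun h => hk ((hmem k).2 h))]
      simp
  -- compare coefficients of `a ^ l` in the preceding identity
  have hPP : ∀ k l, P k * P l = if k = l then P k else 0 := fun k l => by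
    by_cases hl : l ∈ S
    · refine zpow_independent S (P := fun l => P k * P l)
        (Q := fun l => if k = l then P k else 0) (fun a => ?_) l hl
      have h1 := hPc k a
      rw [hc a, Finset.mul_sum] at h1
      simp only [Matrix.mul_smul] at h1
      rw [h1]
      by_cases hk : k ∈ S
      · rw [Finset.sum_eq_single_of_mem k hk fun l _ hl => by rw [if_neg hl.symm, smul_zero],
          if_pos rfl]
      · rw [hP0 k (not_le.1 fun h => hk ((hmem k).2 h))]
        simp
    · have h0 := hP0 l (not_le.1 fun h => hl ((hmem l).2 h))
      split_ifs with h
      · rw [h, h0, mul_zero]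
      · rw [h0, mul_zero]
  refine ⟨N, P, hP0, hc, hPP, ?_, fun k => ?_⟩
  · have h1 := hc 1
    rw [map_one] at h1
    simpa using h1.symm
  · by_cases hk : k ∈ S
    · refine zpow_independent S (P := fun k => (P k)ᵀ * Matrix.J (Fin n) κ)
        (Q := fun k => Matrix.J (Fin n) κ * P (-k)) (fun a => ?_) k hk
      have h1 := SymplecticGroup.mem_iff'.1 (c.toHom a).2
      have h2 : (c.toHom a).1 * (c.toHom a⁻¹).1 = 1 := by
        have : c.toHom a * c.toHom a⁻¹ = 1 := by rw [← map_mul, mul_inv_cancel, map_one]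
        exact congrArg Subtype.val this
      have h3 : (c.toHom a).1ᵀ * Matrix.J (Fin n) κ = Matrix.J (Fin n) κ * (c.toHom a⁻¹).1 := by
        conv_rhs => rw [← h1]
        rw [mul_assoc, h2, mul_one]
      rw [hc a, hc a⁻¹, Matrix.transpose_sum, Finset.sum_mul, Finset.mul_sum] at h3
      simp only [Matrix.transpose_smul, Matrix.smul_mul, Matrix.mul_smul] at h3
      rw [h3]
      refine Finset.sum_equiv (Equiv.neg ℤ) (fun k => ?_) fun k _ => ?_
      · rw [hmem, hmem]
        simp
      · simp
    · have hk' := not_le.1 fun h => hk ((hmem k).2 h)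
      rw [hP0 k hk', hP0 (-k) (by rwa [abs_neg])]
      simp

/-- The partition of a limit along a cocharacter is obtained by moves. -/
theorem IsLimit.reach [Infinite κ] (h2 : (2 : κ) ≠ 0) {c : Cocharacter n κ} {x z : NilCone n κ}
    (h : IsLimit c x z) : Reach (mult (kerDim (toLin' x.1))) (mult (kerDim (toLin' z.1))) := by
  obtain ⟨N, P, hP0, hc, hPP, hP1, hPJ⟩ := c.exists_weights
  obtain ⟨Q, hQ, hQ0⟩ := h
  set p : ℤ → End κ (Fin n ⊕ Fin n → κ) := fun k => toLin' (P k) with hp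
  have hmul : ∀ A B : Matrix (Fin n ⊕ Fin n) (Fin n ⊕ Fin n) κ,
      toLin' A * toLin' B = toLin' (A * B) := fun A B => (toLin'_mul A B).symm
  have hgr : Grading (spForm n κ) p (Finset.Icc (-(N : ℤ)) N) := by
    refine ⟨?_, fun k => ?_, fun k l hkl => ?_, fun k => adjoint_iff.2 (hPJ k)⟩
    · rw [hp, ← map_sum, hP1, toLin'_one]
      rfl
    · rw [hp, hmul, hPP, if_pos rfl]
    · rw [hp, hmul, hPP, if_neg hkl, map_zero]
  have hPc : ∀ k (a : κˣ), P k * (c.toHom a).1 = ((a ^ k : κˣ) : κ) • P k := fun k a => by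
    by_cases hk : (N : ℤ) < |k|
    · rw [hP0 k hk]
      simp
    rw [hc, Finset.mul_sum, Finset.sum_eq_single_of_mem k
      (Finset.mem_Icc.2 (abs_le.1 (not_lt.1 hk))) fun l _ hl => by
        rw [Matrix.mul_smul, hPP, if_neg hl.symm, smul_zero], Matrix.mul_smul, hPP, if_pos rfl]
  have hcP : ∀ k (a : κˣ), (c.toHom a).1 * P k = ((a ^ k : κˣ) : κ) • P k := fun k a => by
    by_cases hk : (N : ℤ) < |k|
    · rw [hP0 k hk]
      simp
    rw [hc, Finset.sum_mul, Finset.sum_eq_single_of_mem k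
      (Finset.mem_Icc.2 (abs_le.1 (not_lt.1 hk))) fun l _ hl => by
        rw [Matrix.smul_mul, hPP, if_neg hl, smul_zero], Matrix.smul_mul, hPP, if_pos rfl]
  -- the component of weight `k - l` of `x` is multiplied by `a ^ (k - l)`
  have key : ∀ k l i j, (k - l < 0 → (P k * x.1 * P l) i j = 0) ∧
      (P k * z.1 * P l) i j = if k - l = 0 then (P k * x.1 * P l) i j else 0 := fun k l i j => by
    have hev : ∀ t : κ, (((P k).map Polynomial.C * Q * (P l).map Polynomial.C) i j).eval t =
        (P k * Q.map (Polynomial.eval t) * P l) i j := fun t => by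
      simp [Matrix.mul_apply, Polynomial.eval_finsetSum]
    rw [← hQ0, ← hev]
    refine limit_entry fun a => ?_
    have h1 : ((c.toHom a)⁻¹ : symplecticGroup (Fin n) κ) = c.toHom a⁻¹ := (map_inv c.toHom a).symm
    rw [hev, hQ, h1]
    have h3 : P k * ((c.toHom a).1 * x.1 * (c.toHom a⁻¹).1) * P l =
        (P k * (c.toHom a).1) * x.1 * ((c.toHom a⁻¹).1 * P l) := by simp only [mul_assoc]
    rw [h3, hPc, hcP]
    simp only [Matrix.smul_mul, Matrix.mul_smul, Matrix.smul_apply, smul_eq_mul,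
      _root_.zpow_sub, Units.val_mul,
      _root_.inv_zpow]
    ring
  refine hgr.reach h2 N (isSN_toLin' x) (fun k l hkl => ?_) (fun k l hkl hT => ?_) (fun k => ?_)
    fun k l hkl => ?_
  · rw [hp, hmul, hmul, show P k * x.1 * P l = 0 from
      Matrix.ext fun i j => (key k l i j).1 (by omega), map_zero]
  · rcases hT with hT | hT <;> simp [hp, hP0 _ hT]
  · simp only [hp, hmul]
    congr 1
    ext i j
    rw [(key k k i j).2, if_pos (sub_self k)]
  · rw [hp, hmul, hmul, show P k * z.1 * P l = 0 from
      Matrix.ext fun i j => by rw [(key k l i j).2, if_neg (sub_ne_zero.2 hkl)]; rfl, map_zero]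

theorem OneAccessible.reach [Infinite κ] (h2 : (2 : κ) ≠ 0) {x y : NilCone n κ}
    (h : OneAccessible x y) :
    Reach (mult (kerDim (toLin' x.1))) (mult (kerDim (toLin' y.1))) := by
  obtain ⟨c, z, hz, ho⟩ := h
  rw [← kerDim_of_mem_orbit ho]
  exact hz.reach h2

theorem Accessible.reach [Infinite κ] (h2 : (2 : κ) ≠ 0) {x y : NilCone n κ}
    (h : Accessible x y) : Reach (mult (kerDim (toLin' x.1))) (mult (kerDim (toLin' y.1))) := by
  induction h with
  | refl => exact Relation.ReflTransGen.refl
  | tail _ hs ih => exact ih.trans (hs.reach h2)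

end

/-! ### Kernels on stable subspaces -/

section

open Module

variable {κ : Type*} [Field κ] {V : Type*} [AddCommGroup V] [Module κ V]
  {ω : LinearMap.BilinForm κ V} {x : End κ V}

/-- A stable subspace of a nilpotent endomorphism meets the kernel unless it is trivial. -/
theorem eq_bot_of_inf_ker (hx : IsNilpotent x) {A : Submodule κ V} (hA : ∀ a ∈ A, x a ∈ A)
    (h : A ⊓ LinearMap.ker x = ⊥) : A = ⊥ := by
  classical
  rw [eq_bot_iff]
  intro a ha
  by_contra h0
  have hex : ∃ k, (x ^ k) a = 0 := by
    obtain ⟨k, hk⟩ := hx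
    exact ⟨k, by simp [hk]⟩
  have hk := Nat.find_spec hex
  set k := Nat.find hex with hkdef
  have hk0 : k ≠ 0 := fun hk0 => h0 (by simpa [hk0] using hk)
  have h1 : (x ^ (k - 1)) a ∈ A ⊓ LinearMap.ker x := by
    refine ⟨stable_pow hA _ a ha, ?_⟩
    change x ((x ^ (k - 1)) a) = 0
    rw [← Module.End.mul_apply, ← pow_succ', show k - 1 + 1 = k by omega, hk]
  rw [h, Submodule.mem_bot] at h1
  exact Nat.find_min hex (show k - 1 < k by omega) h1

theorem kerDimOn_top (x : End κ V) (j : ℕ) : kerDimOn x ⊤ j = kerDim x j := by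
  rw [kerDimOn, top_inf_eq, kerDim]

theorem kerDimOn_sup [FiniteDimensional κ V] {A B : Submodule κ V} (hA : ∀ a ∈ A, x a ∈ A)
    (hB : ∀ a ∈ B, x a ∈ B) (hAB : A ⊓ B = ⊥) (j : ℕ) :
    kerDimOn x (A ⊔ B) j = kerDimOn x A j + kerDimOn x B j := by
  have h1 : (A ⊔ B) ⊓ LinearMap.ker (x ^ j) =
      (A ⊓ LinearMap.ker (x ^ j)) ⊔ (B ⊓ LinearMap.ker (x ^ j)) := by
    apply le_antisymm
    · rintro _ ⟨hab, hk⟩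
      obtain ⟨a, ha, b, hb, rfl⟩ := Submodule.mem_sup.1 hab
      have hk : (x ^ j) (a + b) = 0 := hk
      rw [map_add] at hk
      have h2 : (x ^ j) a ∈ A ⊓ B := by
        refine ⟨stable_pow hA j a ha, ?_⟩
        rw [eq_neg_of_add_eq_zero_left hk]
        exact B.neg_mem (stable_pow hB j b hb)
      rw [hAB, Submodule.mem_bot] at h2
      rw [h2, zero_add] at hk
      exact Submodule.add_mem_sup ⟨ha, h2⟩ ⟨hb, hk⟩
    · exact le_inf (sup_le_sup inf_le_left inf_le_left) (sup_le inf_le_right inf_le_right)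
  have h2 := Submodule.finrank_sup_add_finrank_inf_eq (A ⊓ LinearMap.ker (x ^ j))
    (B ⊓ LinearMap.ker (x ^ j))
  have h3 : (A ⊓ LinearMap.ker (x ^ j)) ⊓ (B ⊓ LinearMap.ker (x ^ j)) = ⊥ := by
    rw [eq_bot_iff, ← hAB]
    exact inf_le_inf inf_le_left inf_le_left
  rw [h3, finrank_bot, add_zero, ← h1] at h2
  exact h2

theorem sup_stable {A B : Submodule κ V} (hA : ∀ a ∈ A, x a ∈ A) (hB : ∀ a ∈ B, x a ∈ B) :
    ∀ a ∈ A ⊔ B, x a ∈ A ⊔ B := by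
  intro c hc
  obtain ⟨a, ha, b, hb, rfl⟩ := Submodule.mem_sup.1 hc
  rw [map_add]
  exact Submodule.add_mem_sup (hA a ha) (hB b hb)

/-- The last nonzero power of `x` on a cyclic subspace spans its intersection with `ker x`. -/
theorem HasOrder.socle [FiniteDimensional κ V] {w : V} {m : ℕ} (h : HasOrder x w m) {a : V}
    (ha : a ∈ cyc x w) (hx : x a = 0) : ∃ c : κ, a = c • (x ^ (m - 1)) w := by
  rcases Nat.eq_zero_or_pos m with rfl | hm
  · refine ⟨0, ?_⟩
    have := h.cyc_le_ker ha
    simpa [Module.End.one_eq_id] using this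
  · have h1 : a ∈ cyc x w ⊓ LinearMap.ker (x ^ (m - (m - 1))) := by
      refine ⟨ha, ?_⟩
      rw [show m - (m - 1) = 1 by omega, pow_one]
      exact hx
    rw [h.cyc_inf_ker (by omega), map_pow_cyc, cyc_eq_sup] at h1
    have h2 : cyc x (x ((x ^ (m - 1)) w)) = ⊥ := by
      rw [eq_bot_iff, cyc_le]
      intro i
      rw [← Module.End.mul_apply x, ← pow_succ', show m - 1 + 1 = m by omega, h.1, map_zero]
      exact zero_mem _
    rw [h2, sup_bot_eq, Submodule.mem_span_singleton] at h1
    obtain ⟨c, hc⟩ := h1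
    exact ⟨c, hc.symm⟩

/-! ### Nondegenerate stable subspaces -/

/-- `U` is stable under `x`, and `V` is the orthogonal direct sum of `U` and `U^⊥`. -/
structure IsSummand (ω : LinearMap.BilinForm κ V) (x : End κ V) (U : Submodule κ V) : Prop where
  stable : ∀ a ∈ U, x a ∈ U
  inf_orth : U ⊓ ω.orthogonal U = ⊥

theorem isSummand_bot : IsSummand ω x ⊥ := by
  refine ⟨fun a ha => ?_, bot_inf_eq _⟩
  rw [Submodule.mem_bot] at ha ⊢
  rw [ha, map_zero]

theorem IsSummand.sup_orth [FiniteDimensional κ V] {U : Submodule κ V} (h : IsSummand ω x U)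
    (hω : ω.Nondegenerate) : U ⊔ ω.orthogonal U = ⊤ := by
  apply Submodule.eq_top_of_finrank_eq
  have h1 := Submodule.finrank_sup_add_finrank_inf_eq U (ω.orthogonal U)
  have h2 := finrank_orth_add hω U
  rw [h.inf_orth, finrank_bot] at h1
  omega

theorem IsSummand.sup {U W : Submodule κ V} (hs : IsSN ω x) (hU : IsSummand ω x U)
    (hW : IsSummand ω x W) (hUW : W ≤ ω.orthogonal U) : IsSummand ω x (U ⊔ W) := by
  refine ⟨sup_stable hU.stable hW.stable, ?_⟩
  rw [eq_bot_iff]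
  rintro _ ⟨hab, ho⟩
  obtain ⟨a, ha, b, hb, rfl⟩ := Submodule.mem_sup.1 hab
  have ha0 : a ∈ U ⊓ ω.orthogonal U := ⟨ha, fun c hc => by
    have h1 : ω c (a + b) = 0 := ho c (Submodule.mem_sup_left hc)
    have h2 : ω c b = 0 := hUW hb c hc
    change ω c a = 0
    rwa [map_add, h2, add_zero] at h1⟩
  have hb0 : b ∈ W ⊓ ω.orthogonal W := ⟨hb, fun c hc => by
    have h1 : ω c (a + b) = 0 := ho c (Submodule.mem_sup_right hc)
    have h2 : ω c a = 0 := hs.zero_iff.1 (hUW hc a ha)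
    change ω c b = 0
    rwa [map_add, h2, zero_add] at h1⟩
  rw [hU.inf_orth, Submodule.mem_bot] at ha0
  rw [hW.inf_orth, Submodule.mem_bot] at hb0
  rw [ha0, hb0, add_zero]
  exact zero_mem _

theorem IsSummand.inf_eq_bot {U W : Submodule κ V} (hU : IsSummand ω x U)
    (hUW : W ≤ ω.orthogonal U) : U ⊓ W = ⊥ := by
  rw [eq_bot_iff, ← hU.inf_orth]
  exact inf_le_inf_left _ hUW

theorem restrict_pow {W : Submodule κ V} {x' : End κ W} (hx : ∀ a, (x' a : V) = x a) (j : ℕ)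
    (a : W) : (((x' ^ j) a : W) : V) = (x ^ j) a := by
  induction j generalizing a with
  | zero => simp
  | succ j ih => rw [pow_succ, pow_succ, Module.End.mul_apply, Module.End.mul_apply, ih, hx]

theorem kerDim_restrict {W : Submodule κ V} {x' : End κ W} (hx : ∀ a, (x' a : V) = x a) (j : ℕ) :
    kerDim x' j = kerDimOn x W j := by
  have : (LinearMap.ker (x' ^ j)).map W.subtype = W ⊓ LinearMap.ker (x ^ j) := by
    ext a
    constructor
    · rintro ⟨b, hb, rfl⟩
      refine ⟨b.2, ?_⟩
      change (x ^ j) (b : V) = 0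
      rw [← restrict_pow hx, LinearMap.mem_ker.1 hb]
      rfl
    · rintro ⟨ha, hk⟩
      refine ⟨⟨a, ha⟩, ?_, rfl⟩
      change (x' ^ j) _ = 0
      rw [← Submodule.coe_eq_zero, restrict_pow hx]
      exact hk
  rw [kerDim, kerDimOn, ← this, Submodule.finrank_map_subtype_eq]

/-- The complement of a nondegenerate stable subspace, with the restricted form and
endomorphism. -/
theorem IsSummand.exists_complement [FiniteDimensional κ V] {U : Submodule κ V} (hs : IsSN ω x)
    (hU : IsSummand ω x U) : ∃ x' : End κ (ω.orthogonal U), (∀ a, (x' a : V) = x a) ∧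
      IsSN (ω.restrict (ω.orthogonal U)) x' ∧
      ∀ j, kerDim x j = kerDimOn x U j + kerDim x' j := by
  have hst := hs.orth_stable hU.stable
  refine ⟨x.restrict hst, fun a => rfl, ⟨fun a => hs.alt _, ?_, fun a b => hs.skew _ _, ?_⟩,
    fun j => ?_⟩
  · have key : ∀ a : ω.orthogonal U, (∀ b : ω.orthogonal U, ω (a : V) b = 0) → a = 0 := by
      intro a ha
      by_contra h0
      obtain ⟨b, hb⟩ := hs.exists_ne (fun h => h0 (Subtype.ext h) : (a : V) ≠ 0)
      obtain ⟨c, hc, d, hd, rfl⟩ := Submodule.mem_sup.1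
        (show b ∈ U ⊔ ω.orthogonal U by rw [hU.sup_orth hs.nondeg]; trivial)
      rw [map_add, ha ⟨d, hd⟩, hs.zero_iff.1 (a.2 c hc)] at hb
      exact hb (add_zero 0)
    exact ⟨fun a ha => key a ha, fun a ha => key a fun b => hs.zero_iff.1 (ha b)⟩
  · obtain ⟨k, hk⟩ := hs.nil
    refine ⟨k, LinearMap.ext fun a => Subtype.ext ?_⟩
    rw [restrict_pow (x := x) fun a => rfl, hk]
    rfl
  · rw [kerDim_restrict (x := x) (fun a => rfl), ← kerDimOn_sup hU.stable hst hU.inf_orth,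
      hU.sup_orth hs.nondeg, kerDimOn_top]

/-! ### Blocks -/

/-- A vector generating a nondegenerate cyclic subspace with a Jordan block of size `h`. -/
structure EBlock (ω : LinearMap.BilinForm κ V) (x : End κ V) (u : V) (h : ℕ) : Prop where
  pow : (x ^ h) u = 0
  form : ∀ i, ω u ((x ^ i) u) = if i + 1 = h then 1 else 0

/-- A pair of vectors generating isotropic cyclic subspaces which are dual to each other, with a
Jordan block of size `h` each. -/
structure DBlock (ω : LinearMap.BilinForm κ V) (x : End κ V) (w w' : V) (h : ℕ) : Prop where
  pow : (x ^ h) w = 0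
  pow' : (x ^ h) w' = 0
  iso : ∀ i, ω w ((x ^ i) w) = 0
  iso' : ∀ i, ω w' ((x ^ i) w') = 0
  form : ∀ i, ω w ((x ^ i) w') = if i + 1 = h then 1 else 0

theorem EBlock.hasOrder {u : V} {h : ℕ} (b : EBlock ω x u h) : HasOrder x u h :=
  hasOrder_of b.pow fun h0 hu => by
    have := b.form (h - 1)
    rw [hu, map_zero, if_pos (by omega)] at this
    exact one_ne_zero this.symm

theorem DBlock.hasOrder' {w w' : V} {h : ℕ} (b : DBlock ω x w w' h) : HasOrder x w' h :=
  hasOrder_of b.pow' fun h0 hu => by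
    have := b.form (h - 1)
    rw [hu, map_zero, if_pos (by omega)] at this
    exact one_ne_zero this.symm

theorem DBlock.form' (hs : IsSN ω x) {w w' : V} {h : ℕ} (b : DBlock ω x w w' h) (i : ℕ) :
    ω w' ((x ^ i) w) = if i + 1 = h then (-1) ^ (i + 1) else 0 := by
  rw [hs.neg, hs.skew_pow, b.form]
  split_ifs
  · ring
  · simp

theorem DBlock.hasOrder (hs : IsSN ω x) {w w' : V} {h : ℕ} (b : DBlock ω x w w' h) :
    HasOrder x w h :=
  hasOrder_of b.pow fun h0 hu => by
    have := b.form' hs (h - 1)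
    rw [hu, map_zero, if_pos (by omega)] at this
    exact pow_ne_zero _ (neg_ne_zero.2 one_ne_zero) this.symm

theorem EBlock.isSummand [FiniteDimensional κ V] (hs : IsSN ω x) {u : V} {h : ℕ}
    (b : EBlock ω x u h) : IsSummand ω x (cyc x u) := by
  refine ⟨cyc_stable x u, eq_bot_of_inf_ker hs.nil (fun a ha => ⟨cyc_stable x u a ha.1,
    hs.orth_stable (cyc_stable x u) a ha.2⟩) ?_⟩
  rw [eq_bot_iff]
  rintro a ⟨⟨ha, ho⟩, hk⟩
  obtain ⟨c, rfl⟩ := b.hasOrder.socle ha hk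
  have h1 : ω u (c • (x ^ (h - 1)) u) = 0 := ho u (mem_cyc x u)
  rcases Nat.eq_zero_or_pos h with rfl | hh
  · have := b.pow
    simp only [pow_zero, Module.End.one_apply] at this
    simp [this]
  · rw [map_smul, b.form, if_pos (by omega), smul_eq_mul, mul_one] at h1
    rw [h1, zero_smul]
    exact zero_mem _

/-- Two isotropic cyclic subspaces which are dual to each other intersect trivially. -/
theorem DBlock.inf_eq_bot [FiniteDimensional κ V] (hs : IsSN ω x) {w w' : V} {h : ℕ}
    (b : DBlock ω x w w' h) : cyc x w ⊓ cyc x w' = ⊥ := by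
  refine eq_bot_of_inf_ker hs.nil (fun a ha => ⟨cyc_stable x w a ha.1, cyc_stable x w' a ha.2⟩) ?_
  rw [eq_bot_iff]
  rintro a ⟨⟨ha, ha'⟩, hk⟩
  obtain ⟨c, rfl⟩ := b.hasOrder'.socle ha' hk
  have h1 : ω w (c • (x ^ (h - 1)) w') = 0 := (hs.isoStable_cyc b.iso).iso w (mem_cyc x w) _ ha
  rcases Nat.eq_zero_or_pos h with rfl | hh
  · have := b.pow'
    simp only [pow_zero, Module.End.one_apply] at this
    simp [this]
  · rw [map_smul, b.form, if_pos (by omega), smul_eq_mul, mul_one] at h1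
    rw [h1, zero_smul]
    exact zero_mem _

theorem DBlock.isSummand [FiniteDimensional κ V] (hs : IsSN ω x) {w w' : V} {h : ℕ}
    (b : DBlock ω x w w' h) : IsSummand ω x (cyc x w ⊔ cyc x w') := by
  have hst := sup_stable (cyc_stable x w) (cyc_stable x w')
  refine ⟨hst, eq_bot_of_inf_ker hs.nil (fun a ha => ⟨hst a ha.1, hs.orth_stable hst a ha.2⟩) ?_⟩
  rw [eq_bot_iff]
  rintro _ ⟨⟨hab, ho⟩, hk⟩
  obtain ⟨a, ha, a', ha', rfl⟩ := Submodule.mem_sup.1 hab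
  have hx : x a + x a' = 0 := by rw [← map_add]; exact hk
  have h2 : x a ∈ cyc x w ⊓ cyc x w' := by
    refine ⟨cyc_stable x w a ha, ?_⟩
    rw [eq_neg_of_add_eq_zero_left hx]
    exact (cyc x w').neg_mem (cyc_stable x w' a' ha')
  rw [b.inf_eq_bot hs, Submodule.mem_bot] at h2
  rw [h2, zero_add] at hx
  obtain ⟨c, rfl⟩ := (b.hasOrder hs).socle ha h2
  obtain ⟨c', rfl⟩ := b.hasOrder'.socle ha' hx
  rcases Nat.eq_zero_or_pos h with rfl | hh
  · have h3 := b.pow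
    have h4 := b.pow'
    simp only [pow_zero, Module.End.one_apply] at h3 h4
    simp [h3, h4]
  · have h3 : ω w (c • (x ^ (h - 1)) w + c' • (x ^ (h - 1)) w') = 0 :=
      ho w (Submodule.mem_sup_left (mem_cyc x w))
    have h4 : ω w' (c • (x ^ (h - 1)) w + c' • (x ^ (h - 1)) w') = 0 :=
      ho w' (Submodule.mem_sup_right (mem_cyc x w'))
    simp only [map_add, map_smul, b.iso, b.iso', b.form, b.form' hs, smul_eq_mul,
      if_pos (show h - 1 + 1 = h by omega), mul_zero, zero_add, add_zero, mul_one] at h3 h4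
    rw [h3, (mul_eq_zero.1 h4).resolve_right (pow_ne_zero _ (neg_ne_zero.2 one_ne_zero))]
    simp

theorem EBlock.kerDimOn [FiniteDimensional κ V] {u : V} {h : ℕ} (b : EBlock ω x u h) (j : ℕ) :
    kerDimOn x (cyc x u) j = kerSum {h} j := by
  rw [b.hasOrder.kerDimOn_cyc, kerSum_singleton]

theorem DBlock.kerDimOn [FiniteDimensional κ V] (hs : IsSN ω x) {w w' : V} {h : ℕ}
    (b : DBlock ω x w w' h) (j : ℕ) :
    kerDimOn x (cyc x w ⊔ cyc x w') j = kerSum {h, h} j := by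
  rw [kerDimOn_sup (cyc_stable x w) (cyc_stable x w') (b.inf_eq_bot hs),
    (b.hasOrder hs).kerDimOn_cyc, b.hasOrder'.kerDimOn_cyc, Multiset.insert_eq_cons, kerSum_cons,
    kerSum_singleton]

end

/-! ### Existence of blocks -/

section

open Module

variable {κ : Type*} [Field κ] {V : Type*} [AddCommGroup V] [Module κ V]
  {ω : LinearMap.BilinForm κ V} {x : End κ V}

theorem pow_apply_eq_zero {a : V} {h i : ℕ} (ha : (x ^ h) a = 0) (hi : h ≤ i) : (x ^ i) a = 0 := by
  rw [← Nat.sub_add_cancel hi, pow_add, Module.End.mul_apply, ha, map_zero]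

theorem IsSN.even_self (hs : IsSN ω x) (h2 : (2 : κ) ≠ 0) (u : V) {i : ℕ} (hi : Even i) :
    ω u ((x ^ i) u) = 0 := by
  have h1 := hs.neg u ((x ^ i) u)
  rw [hs.skew_pow, hi.neg_one_pow, one_mul] at h1
  have h3 : 2 * ω u ((x ^ i) u) = 0 := by linear_combination h1
  exact (mul_eq_zero.1 h3).resolve_left h2

/-- The form `ω a (x ^ i b)` is symmetric for odd `i` and antisymmetric for even `i`. -/
theorem IsSN.swap (hs : IsSN ω x) (a b : V) (i : ℕ) :
    ω b ((x ^ i) a) = -(-1) ^ i * ω a ((x ^ i) b) := by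
  rw [hs.neg, hs.skew_pow]
  ring

theorem IsSN.expand (hs : IsSN ω x) (a a' b b' : V) (c c' : κ) (s i : ℕ) :
    ω (a + c • (x ^ s) b) ((x ^ i) (a' + c' • (x ^ s) b')) =
      ω a ((x ^ i) a') + c' * ω a ((x ^ (i + s)) b') + c * (-1) ^ s * ω b ((x ^ (i + s)) a') +
        c * c' * (-1) ^ s * ω b ((x ^ (i + 2 * s)) b') := by
  simp only [map_add, map_smul, LinearMap.add_apply, LinearMap.smul_apply, hs.skew_pow,
    ← Module.End.mul_apply, ← pow_add, smul_eq_mul]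
  rw [show i + 2 * s = s + (i + s) by ring, add_comm s i]
  ring

theorem pow_add_smul_eq_zero {a b : V} {h : ℕ} (ha : (x ^ h) a = 0) (hb : (x ^ h) b = 0) (c : κ)
    (s : ℕ) : (x ^ h) (a + c • (x ^ s) b) = 0 := by
  rw [map_add, map_smul, ha, ← Module.End.mul_apply, ← pow_add,
    pow_apply_eq_zero hb (Nat.le_add_right h s), smul_zero, add_zero]

/-- Vectors of order at most `h` pairing to a nonzero value with the power `h - 1`. -/
theorem exists_pairing [FiniteDimensional κ V] (hs : IsSN ω x) {h : ℕ} (hh : 1 ≤ h)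
    (hm : 1 ≤ mult (kerDim x) h) :
    ∃ a b, (x ^ h) a = 0 ∧ (x ^ h) b = 0 ∧ ω a ((x ^ (h - 1)) b) = 1 := by
  obtain ⟨u, hu, hr⟩ := exists_height_of_mult hh hm
  rw [← hs.orth_ker_pow, mem_orth] at hr
  push Not at hr
  obtain ⟨b, hb, hbu⟩ := hr
  refine ⟨(ω b ((x ^ (h - 1)) u))⁻¹ • b, u, ?_, hu, ?_⟩
  · rw [map_smul, LinearMap.mem_ker.1 hb, smul_zero]
  · rw [map_smul, LinearMap.smul_apply, smul_eq_mul, inv_mul_cancel₀ hbu]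

/-- A part of even size `h` gives a nondegenerate cyclic subspace. A vector `u` with `ω u (x ^ (h -
1) u) = 1` is corrected by multiples of `x ^ s u`, so that the values at lower powers of `x` vanish
one after the other. -/
theorem exists_eBlock [FiniteDimensional κ V] [IsAlgClosed κ] (h2 : (2 : κ) ≠ 0) (hs : IsSN ω x)
    {h : ℕ} (he : Even h) (hm : 1 ≤ h → 1 ≤ mult (kerDim x) h) : ∃ u, EBlock ω x u h := by
  rcases Nat.eq_zero_or_pos h with rfl | hh
  · exact ⟨0, by simp, by simp⟩
  have hodd : Odd (h - 1) := Nat.Even.sub_odd hh he odd_one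
  -- the symmetric form `ω a (x ^ (h - 1) b)` on the kernel of `x ^ h` is nonzero, hence has a
  -- vector which is not isotropic
  have h1 : ∃ u, (x ^ h) u = 0 ∧ ω u ((x ^ (h - 1)) u) ≠ 0 := by
    obtain ⟨a, b, ha, hb, hab⟩ := exists_pairing hs hh (hm hh)
    by_contra! hc
    have e1 := hc (a + b) (by rw [map_add, ha, hb, add_zero])
    have e2 := hs.swap a b (h - 1)
    rw [hodd.neg_one_pow, hab] at e2
    simp only [map_add, LinearMap.add_apply, hc a ha, hc b hb, hab, e2] at e1
    apply h2
    linear_combination e1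
  -- the values at the powers `h - 1 - t, …, h - 2` have been made zero
  have key : ∀ t, ∃ u, (x ^ h) u = 0 ∧ ω u ((x ^ (h - 1)) u) = 1 ∧
      ∀ i, i + 1 < h → h ≤ i + 1 + t → ω u ((x ^ i) u) = 0 := by
    intro t
    induction t with
    | zero =>
      obtain ⟨u, hu, hne⟩ := h1
      obtain ⟨c, hc⟩ := IsAlgClosed.exists_eq_mul_self (ω u ((x ^ (h - 1)) u))⁻¹
      refine ⟨c • u, by rw [map_smul, hu, smul_zero], ?_, fun i h3 h4 => by omega⟩
      rw [map_smul, map_smul, map_smul, LinearMap.smul_apply, smul_eq_mul, smul_eq_mul, ← mul_assoc,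
        ← hc, inv_mul_cancel₀ hne]
    | succ t ih =>
      obtain ⟨u, hu, hu1, hu0⟩ := ih
      rcases Nat.lt_or_ge h (t + 2) with hlt | hge
      · exact ⟨u, hu, hu1, fun i h3 h4 => hu0 i h3 (by omega)⟩
      rcases Nat.even_or_odd (t + 1) with ht | ht
      · refine ⟨u + (-ω u ((x ^ (h - 1 - (t + 1))) u) / 2) • (x ^ (t + 1)) u,
          pow_add_smul_eq_zero hu hu _ _, ?_, fun i h3 h4 => ?_⟩
        · rw [hs.expand, hu1, pow_apply_eq_zero hu (show h ≤ h - 1 + (t + 1) by omega),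
            pow_apply_eq_zero hu (show h ≤ h - 1 + 2 * (t + 1) by omega)]
          simp
        · rw [hs.expand, ht.neg_one_pow, pow_apply_eq_zero hu (show h ≤ i + 2 * (t + 1) by omega)]
          rcases Nat.eq_or_lt_of_le h4 with h5 | h5
          · rw [show i + (t + 1) = h - 1 by omega, hu1, show h - 1 - (t + 1) = i by omega]
            simp only [map_zero]
            field_simp
            ring
          · rw [pow_apply_eq_zero hu (show h ≤ i + (t + 1) by omega), hu0 i h3 (by omega)]
            simp
      · refine ⟨u, hu, hu1, fun i h3 h4 => ?_⟩
        rcases Nat.eq_or_lt_of_le h4 with h5 | h5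
        · refine hs.even_self h2 u ?_
          rw [show i = h - 1 - (t + 1) by omega]
          exact Nat.Odd.sub_odd hodd ht
        · exact hu0 i h3 (by omega)
  obtain ⟨u, hu, hu1, hu0⟩ := key h
  refine ⟨u, hu, fun i => ?_⟩
  split_ifs with hi
  · rw [show i = h - 1 by omega, hu1]
  · rcases Nat.lt_or_ge i h with h3 | h3
    · exact hu0 i (by omega) (by omega)
    · rw [pow_apply_eq_zero hu h3, map_zero]

/-- A part of odd size `h` gives a pair of cyclic isotropic subspaces which are dual to each other.
As the form `ω a (x ^ (h - 1) b)` is alternating, one starts from two vectors pairing to `1`. -/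
theorem exists_dBlock_of_odd [FiniteDimensional κ V] (h2 : (2 : κ) ≠ 0) (hs : IsSN ω x)
    {h : ℕ} (ho : Odd h) (hm : 1 ≤ mult (kerDim x) h) : ∃ w w', DBlock ω x w w' h := by
  have hh : 1 ≤ h := ho.pos
  have hev : Even (h - 1) := Nat.Odd.sub_odd ho odd_one
  obtain ⟨a, b, ha, hb, hab⟩ := exists_pairing hs hh hm
  -- a vector is made isotropic by adding multiples of powers of `x` applied to a dual vector
  have key : ∀ {a b : V}, (x ^ h) a = 0 → (x ^ h) b = 0 → ω a ((x ^ (h - 1)) b) = 1 →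
      ∀ t, ∃ w, (x ^ h) w = 0 ∧ ω w ((x ^ (h - 1)) b) = 1 ∧
        ∀ i, h ≤ i + 1 + t → ω w ((x ^ i) w) = 0 := by
    intro a b ha hb hab t
    induction t with
    | zero =>
      refine ⟨a, ha, hab, fun i h3 => ?_⟩
      rcases Nat.eq_or_lt_of_le h3 with h4 | h4
      · refine hs.even_self h2 a ?_
        rwa [show i = h - 1 by omega]
      · rw [pow_apply_eq_zero ha (by omega), map_zero]
    | succ t ih =>
      obtain ⟨w, hw, hw1, hw0⟩ := ih
      rcases Nat.lt_or_ge h (t + 2) with hlt | hge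
      · exact ⟨w, hw, hw1, fun i h4 => hw0 i (by omega)⟩
      rcases Nat.even_or_odd (t + 1) with ht | ht
      · refine ⟨w, hw, hw1, fun i h4 => ?_⟩
        rcases Nat.eq_or_lt_of_le h4 with h5 | h5
        · refine hs.even_self h2 w ?_
          rw [show i = h - 1 - (t + 1) by omega]
          exact (Nat.even_sub (by omega)).2 (iff_of_true hev ht)
        · exact hw0 i (by omega)
      · refine ⟨w + (-ω w ((x ^ (h - 1 - (t + 1))) w) / 2) • (x ^ (t + 1)) b,
          pow_add_smul_eq_zero hw hb _ _, ?_, fun i h4 => ?_⟩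
        · have := hs.expand w b b (0 : V) (-ω w ((x ^ (h - 1 - (t + 1))) w) / 2) 0 (t + 1) (h - 1)
          rw [zero_smul, add_zero] at this
          rw [this, hw1, pow_apply_eq_zero hb (show h ≤ h - 1 + (t + 1) by omega)]
          simp
        · rw [hs.expand, ht.neg_one_pow, pow_apply_eq_zero hb (show h ≤ i + 2 * (t + 1) by omega),
            hs.swap w b]
          rcases Nat.eq_or_lt_of_le h4 with h5 | h5
          · rw [show i + (t + 1) = h - 1 by omega, hw1, hev.neg_one_pow,
              show h - 1 - (t + 1) = i by omega]
            simp only [map_zero]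
            field_simp
            ring
          · rw [pow_apply_eq_zero hb (show h ≤ i + (t + 1) by omega), hw0 i (by omega)]
            simp
  obtain ⟨w, hw, hw1, hw0⟩ := key ha hb hab h
  have hw0 : ∀ i, ω w ((x ^ i) w) = 0 := fun i => hw0 i (by omega)
  -- the second vector is made dual to `w`, and then isotropic
  have key2 : ∀ t, ∃ v, (x ^ h) v = 0 ∧ ω w ((x ^ (h - 1)) v) = 1 ∧
      ∀ i, i + 1 < h → h ≤ i + 1 + t → ω w ((x ^ i) v) = 0 := by
    intro t
    induction t with
    | zero => exact ⟨b, hb, hw1, fun i h3 h4 => by omega⟩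
    | succ t ih =>
      obtain ⟨v, hv, hv1, hv0⟩ := ih
      rcases Nat.lt_or_ge h (t + 2) with hlt | hge
      · exact ⟨v, hv, hv1, fun i h3 h4 => hv0 i h3 (by omega)⟩
      have hexp : ∀ i, ω w ((x ^ i) (v + (-ω w ((x ^ (h - 1 - (t + 1))) v)) • (x ^ (t + 1)) v)) =
          ω w ((x ^ i) v) - ω w ((x ^ (h - 1 - (t + 1))) v) * ω w ((x ^ (i + (t + 1))) v) := by
        intro i
        rw [map_add, map_smul, map_add, map_smul, ← Module.End.mul_apply, ← pow_add, smul_eq_mul]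
        ring
      refine ⟨_, pow_add_smul_eq_zero hv hv (-ω w ((x ^ (h - 1 - (t + 1))) v)) (t + 1), ?_,
        fun i h3 h4 => ?_⟩
      · rw [hexp, hv1, pow_apply_eq_zero hv (show h ≤ h - 1 + (t + 1) by omega)]
        simp
      · rw [hexp]
        rcases Nat.eq_or_lt_of_le h4 with h5 | h5
        · rw [show i + (t + 1) = h - 1 by omega, hv1, show h - 1 - (t + 1) = i by omega]
          ring
        · rw [pow_apply_eq_zero hv (show h ≤ i + (t + 1) by omega), hv0 i h3 (by omega)]
          simp
  obtain ⟨v, hv, hv1, hv0⟩ := key2 h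
  have hv0 : ∀ i, ω w ((x ^ i) v) = if i + 1 = h then 1 else 0 := fun i => by
    split_ifs with hi
    · rw [show i = h - 1 by omega, hv1]
    · rcases Nat.lt_or_ge i h with h3 | h3
      · exact hv0 i (by omega) (by omega)
      · rw [pow_apply_eq_zero hv h3, map_zero]
  have key3 : ∀ t, ∃ v, (x ^ h) v = 0 ∧ (∀ i, ω w ((x ^ i) v) = if i + 1 = h then 1 else 0) ∧
      ∀ i, h ≤ i + 1 + t → ω v ((x ^ i) v) = 0 := by
    intro t
    induction t with
    | zero =>
      refine ⟨v, hv, hv0, fun i h3 => ?_⟩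
      rcases Nat.eq_or_lt_of_le h3 with h4 | h4
      · refine hs.even_self h2 v ?_
        rwa [show i = h - 1 by omega]
      · rw [pow_apply_eq_zero hv (by omega), map_zero]
    | succ t ih =>
      obtain ⟨v, hv, hv1, hv0⟩ := ih
      rcases Nat.lt_or_ge h (t + 2) with hlt | hge
      · exact ⟨v, hv, hv1, fun i h4 => hv0 i (by omega)⟩
      rcases Nat.even_or_odd (t + 1) with ht | ht
      · refine ⟨v, hv, hv1, fun i h4 => ?_⟩
        rcases Nat.eq_or_lt_of_le h4 with h5 | h5
        · refine hs.even_self h2 v ?_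
          rw [show i = h - 1 - (t + 1) by omega]
          exact (Nat.even_sub (by omega)).2 (iff_of_true hev ht)
        · exact hv0 i (by omega)
      · refine ⟨v + (ω v ((x ^ (h - 1 - (t + 1))) v) / 2) • (x ^ (t + 1)) w,
          pow_add_smul_eq_zero hv hw _ _, fun i => ?_, fun i h4 => ?_⟩
        · rw [map_add, map_smul, map_add, map_smul, ← Module.End.mul_apply, ← pow_add, hw0,
            smul_zero, add_zero, hv1]
        · rw [hs.expand, ht.neg_one_pow, hw0, hv1, hs.swap w v, hv1]
          rcases Nat.eq_or_lt_of_le h4 with h5 | h5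
          · rw [if_pos (show i + (t + 1) + 1 = h by omega), show i + (t + 1) = h - 1 by omega,
              hev.neg_one_pow, show h - 1 - (t + 1) = i by omega]
            field_simp
            ring
          · rw [if_neg (show ¬ i + (t + 1) + 1 = h by omega), hv0 i (by omega)]
            simp
  obtain ⟨v', hv', hv1', hv0'⟩ := key3 h
  exact ⟨w, v', hw, hv', hw0, fun i => hv0' i (by omega), hv1'⟩

end

/-! ### Blocks in orthogonal complements -/

section

open Module

variable {κ : Type*} [Field κ] {V : Type*} [AddCommGroup V] [Module κ V]
  {ω : LinearMap.BilinForm κ V} {x : End κ V}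

theorem EBlock.coe {W : Submodule κ V} {x' : End κ W} (hx : ∀ a, (x' a : V) = x a) {u : W} {h : ℕ}
    (b : EBlock (ω.restrict W) x' u h) : EBlock ω x (u : V) h := by
  refine ⟨?_, fun i => ?_⟩
  · rw [← restrict_pow hx, b.pow]
    rfl
  · rw [← restrict_pow hx, ← b.form i]
    rfl

theorem DBlock.coe {W : Submodule κ V} {x' : End κ W} (hx : ∀ a, (x' a : V) = x a) {w w' : W}
    {h : ℕ} (b : DBlock (ω.restrict W) x' w w' h) : DBlock ω x (w : V) (w' : V) h := by
  refine ⟨?_, ?_, fun i => ?_, fun i => ?_, fun i => ?_⟩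
  · rw [← restrict_pow hx, b.pow]
    rfl
  · rw [← restrict_pow hx, b.pow']
    rfl
  · rw [← restrict_pow hx, ← b.iso i]
    rfl
  · rw [← restrict_pow hx, ← b.iso' i]
    rfl
  · rw [← restrict_pow hx, ← b.form i]
    rfl

/-- If the even number `h` occurs besides the parts of the nondegenerate stable subspace `U`, there
is a block of size `h` orthogonal to `U`. -/
theorem exists_eBlock_orth [FiniteDimensional κ V] [IsAlgClosed κ] (h2 : (2 : κ) ≠ 0)
    (hs : IsSN ω x) {U : Submodule κ V} (hU : IsSummand ω x U) {h : ℕ} (he : Even h)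
    (hm : 1 ≤ h → mult (kerDimOn x U) h + 1 ≤ mult (kerDim x) h) :
    ∃ u ∈ ω.orthogonal U, EBlock ω x u h := by
  obtain ⟨x', hx, hs', hk⟩ := hU.exists_complement hs
  obtain ⟨u, hu⟩ := exists_eBlock h2 hs' he fun hh => by
    have := hm hh
    rw [show kerDim x = fun j => kerDimOn x U j + kerDim x' j from funext hk, mult_add] at this
    linarith
  exact ⟨u, u.2, hu.coe hx⟩

/-- If `h` occurs twice besides the parts of the nondegenerate stable subspace `U`, there is a
double block of size `h` orthogonal to `U`. -/
theorem exists_dBlock_orth [FiniteDimensional κ V] [IsAlgClosed κ] (h2 : (2 : κ) ≠ 0)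
    (hs : IsSN ω x) {U : Submodule κ V} (hU : IsSummand ω x U) {h : ℕ}
    (hm : 1 ≤ h → mult (kerDimOn x U) h + 2 ≤ mult (kerDim x) h) :
    ∃ w ∈ ω.orthogonal U, ∃ w' ∈ ω.orthogonal U, DBlock ω x w w' h := by
  rcases Nat.even_or_odd h with he | ho
  · -- two orthogonal blocks are combined to a pair of isotropic ones
    obtain ⟨u, hu, bu⟩ := exists_eBlock_orth h2 hs hU he fun hh => by linarith [hm hh]
    have hcu : cyc x u ≤ ω.orthogonal U := cyc_le_of_stable (hs.orth_stable hU.stable) hu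
    have hU' := hU.sup hs (bu.isSummand hs) hcu
    obtain ⟨v, hv, bv⟩ := exists_eBlock_orth h2 hs hU' he fun hh => by
      have e : kerDimOn x (U ⊔ cyc x u) = fun j => kerDimOn x U j + kerSum {h} j :=
        funext fun j => by
        rw [kerDimOn_sup hU.stable (cyc_stable x u) (hU.inf_eq_bot hcu), bu.kerDimOn]
      have := hm hh
      rw [e, mult_add, mult_kerSum _ hh]
      simp only [cnt_singleton, ind, if_true]
      linarith
    have hvU : v ∈ ω.orthogonal U := LinearMap.BilinForm.orthogonal_le le_sup_left hv
    have huv : ∀ i, ω u ((x ^ i) v) = 0 := hs.mem_orth_cyc.1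
      (LinearMap.BilinForm.orthogonal_le le_sup_right hv)
    have hvu : ∀ i, ω v ((x ^ i) u) = 0 := fun i => by rw [hs.swap, huv, mul_zero]
    -- `u + c v` and `u - c v` are isotropic when `c ^ 2 = -1`
    obtain ⟨c, hc⟩ := IsAlgClosed.exists_eq_mul_self (-1 : κ)
    refine ⟨u + c • v, Submodule.add_mem _ hu (Submodule.smul_mem _ c hvU),
      (2 : κ)⁻¹ • (u - c • v), Submodule.smul_mem _ _ (Submodule.sub_mem _ hu
        (Submodule.smul_mem _ c hvU)), ?_, ?_, fun i => ?_, fun i => ?_, fun i => ?_⟩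
    · simp [bu.pow, bv.pow]
    · simp [bu.pow, bv.pow]
    · simp only [map_add, map_smul, LinearMap.add_apply, LinearMap.smul_apply, bu.form, bv.form,
        huv, hvu, smul_eq_mul]
      split_ifs
      · linear_combination -hc
      · ring
    · simp only [map_sub, map_smul, LinearMap.sub_apply, LinearMap.smul_apply, bu.form, bv.form,
        huv, hvu, smul_eq_mul]
      split_ifs
      · linear_combination -((2 : κ)⁻¹ * 2⁻¹ * hc)
      · ring
    · simp only [map_add, map_sub, map_smul, LinearMap.add_apply, LinearMap.smul_apply, bu.form,
        bv.form, huv, hvu, smul_eq_mul]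
      split_ifs
      · have : (2 : κ)⁻¹ * 2 = 1 := inv_mul_cancel₀ h2
        linear_combination (2 : κ)⁻¹ * hc + this
      · ring
  · obtain ⟨x', hx, hs', hk⟩ := hU.exists_complement hs
    obtain ⟨w, w', b⟩ := exists_dBlock_of_odd h2 hs' ho (by
      have := hm ho.pos
      rw [show kerDim x = fun j => kerDimOn x U j + kerDim x' j from funext hk, mult_add] at this
      linarith)
    exact ⟨w, w.2, w', w'.2, b.coe hx⟩

/-! ### Classification by the Jordan type -/

/-- The nilpotency index is the largest part. -/
theorem one_le_mult_of_pow {h : ℕ} [FiniteDimensional κ V] (hh : 1 ≤ h) (h0 : x ^ h = 0)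
    (h1 : x ^ (h - 1) ≠ 0) : 1 ≤ mult (kerDim x) h := by
  have hpos : 0 < finrank κ (LinearMap.range (x ^ (h - 1)) ⊓ LinearMap.ker x : Submodule κ V) := by
    rw [Nat.pos_iff_ne_zero]
    intro hz
    have hz := Submodule.finrank_eq_zero.1 hz
    apply h1
    ext a
    have : (x ^ (h - 1)) a ∈ (LinearMap.range (x ^ (h - 1)) ⊓ LinearMap.ker x : Submodule κ V) := by
      refine ⟨⟨a, rfl⟩, ?_⟩
      change x ((x ^ (h - 1)) a) = 0
      rw [← Module.End.mul_apply, ← pow_succ', Nat.sub_add_cancel hh, h0, LinearMap.zero_apply]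
    rwa [hz] at this
  have h3 : (LinearMap.range (x ^ h) ⊓ LinearMap.ker x : Submodule κ V) = ⊥ := by
    rw [h0, LinearMap.range_zero, bot_inf_eq]
  rw [mult_kerDim x hh, h3, finrank_bot]
  omega

theorem exists_block [FiniteDimensional κ V] (hs : IsSN ω x) (hV : 0 < finrank κ V) :
    ∃ h, 1 ≤ h ∧ 1 ≤ mult (kerDim x) h := by
  classical
  have hk := Nat.find_spec hs.nil
  set k := Nat.find hs.nil with hkdef
  have hk0 : k ≠ 0 := fun h0 => by
    rw [h0, pow_zero] at hk
    have : Subsingleton V := ⟨fun a b => by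
      rw [← Module.End.one_apply (R := κ) a, ← Module.End.one_apply (R := κ) b, hk]
      rfl⟩
    rw [finrank_zero_of_subsingleton] at hV
    exact lt_irrefl _ hV
  exact ⟨k, by omega, one_le_mult_of_pow (by omega) hk (Nat.find_min hs.nil (by omega))⟩

end

section

open Module

variable {κ : Type*} [Field κ] {V V' : Type*} [AddCommGroup V] [Module κ V] [AddCommGroup V']
  [Module κ V'] {ω : LinearMap.BilinForm κ V} {x : End κ V} {ω' : LinearMap.BilinForm κ V'}
  {x' : End κ V'}

/-- The orthogonal sum of `ω` and `-ω'`. The graph of an isometry is isotropic for this form. -/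
def diffForm (ω : LinearMap.BilinForm κ V) (ω' : LinearMap.BilinForm κ V') :
    LinearMap.BilinForm κ (V × V') :=
  ω.comp (LinearMap.fst κ V V') (LinearMap.fst κ V V') -
    ω'.comp (LinearMap.snd κ V V') (LinearMap.snd κ V V')

theorem diffForm_apply (a b : V × V') : diffForm ω ω' a b = ω a.1 b.1 - ω' a.2 b.2 := rfl

theorem prodMap_pow (i : ℕ) (a : V × V') :
    ((x.prodMap x' : End κ (V × V')) ^ i) a = ((x ^ i) a.1, (x' ^ i) a.2) := by
  induction i generalizing a with
  | zero => rfl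
  | succ i ih =>
    rw [pow_succ, pow_succ, pow_succ, Module.End.mul_apply, ih]
    rfl

theorem isSN_diffForm (hs : IsSN ω x) (hs' : IsSN ω' x') :
    IsSN (diffForm ω ω') (x.prodMap x') := by
  refine ⟨fun a => ?_, ⟨fun a ha => ?_, fun a ha => ?_⟩, fun a b => ?_, ?_⟩
  · rw [diffForm_apply, hs.alt, hs'.alt, sub_zero]
  · refine Prod.ext (hs.nondeg.1 _ fun b => ?_) (hs'.nondeg.1 _ fun b => ?_)
    · simpa [diffForm_apply] using ha (b, 0)
    · simpa [diffForm_apply] using ha (0, b)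
  · refine Prod.ext (hs.nondeg.2 _ fun b => ?_) (hs'.nondeg.2 _ fun b => ?_)
    · simpa [diffForm_apply] using ha (b, 0)
    · simpa [diffForm_apply] using ha (0, b)
  · rw [diffForm_apply, diffForm_apply, LinearMap.prodMap_apply, LinearMap.prodMap_apply]
    simp only [hs.skew, hs'.skew]
    ring
  · obtain ⟨k, hk⟩ := hs.nil
    obtain ⟨k', hk'⟩ := hs'.nil
    refine ⟨k + k', LinearMap.ext fun a => ?_⟩
    rw [prodMap_pow, pow_add, pow_add, hk, hk']
    simp

theorem IsoStable.sup (hs : IsSN ω x) {A B : Submodule κ V} (hA : IsoStable ω x A)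
    (hB : IsoStable ω x B) (hAB : B ≤ ω.orthogonal A) : IsoStable ω x (A ⊔ B) := by
  refine ⟨?_, sup_stable hA.stable hB.stable⟩
  intro a ha b hb
  obtain ⟨a1, ha1, a2, ha2, rfl⟩ := Submodule.mem_sup.1 ha
  obtain ⟨b1, hb1, b2, hb2, rfl⟩ := Submodule.mem_sup.1 hb
  have h1 : ω a1 b2 = 0 := hAB hb2 a1 ha1
  have h2 : ω a2 b1 = 0 := hs.zero_iff.1 (hAB ha2 b1 hb1)
  simp [hA.iso a1 ha1 b1 hb1, hB.iso a2 ha2 b2 hb2, h1, h2]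

/-- A correspondence: an isotropic stable subspace of `V × V'` which projects onto `V`. Such
subspaces are built from pieces more easily than isometries are. -/
def IsCorr (ω : LinearMap.BilinForm κ V) (x : End κ V) (ω' : LinearMap.BilinForm κ V')
    (x' : End κ V') (G : Submodule κ (V × V')) : Prop :=
  IsoStable (diffForm ω ω') (x.prodMap x') G ∧ G.map (LinearMap.fst κ V V') = ⊤

/-- Correspondences on a nondegenerate stable subspace and on its orthogonal add up. -/
theorem glue [FiniteDimensional κ V] (hs : IsSN ω x) (hs' : IsSN ω' x') {U : Submodule κ V}
    {U' : Submodule κ V'} (hU : IsSummand ω x U) {A : Submodule κ (V × V')}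
    (hA : IsoStable (diffForm ω ω') (x.prodMap x') A) (hAU : A.map (LinearMap.fst κ V V') = U)
    (hAU' : A.map (LinearMap.snd κ V V') ≤ U') {y : End κ (ω.orthogonal U)}
    {y' : End κ (ω'.orthogonal U')} (hy : ∀ a, (y a : V) = x a) (hy' : ∀ a, (y' a : V') = x' a)
    (h : ∃ G, IsCorr (ω.restrict (ω.orthogonal U)) y (ω'.restrict (ω'.orthogonal U')) y' G) :
    ∃ G, IsCorr ω x ω' x' G := by
  obtain ⟨G, ⟨hiso, hst⟩, htop⟩ := h
  set φ := (ω.orthogonal U).subtype.prodMap (ω'.orthogonal U').subtype with hφ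
  refine ⟨A ⊔ G.map φ, IsoStable.sup (isSN_diffForm hs hs') hA ⟨?_, ?_⟩ ?_, ?_⟩
  · rintro _ ⟨a, ha, rfl⟩ _ ⟨b, hb, rfl⟩
    exact hiso a ha b hb
  · rintro _ ⟨a, ha, rfl⟩
    refine ⟨_, hst a ha, ?_⟩
    exact Prod.ext (hy a.1) (hy' a.2)
  · rintro _ ⟨a, ha, rfl⟩ b hb
    have h1 : ω b.1 a.1 = 0 := a.1.2 b.1 (hAU ▸ ⟨b, hb, rfl⟩)
    have h2 : ω' b.2 a.2 = 0 := a.2.2 b.2 (hAU' ⟨b, hb, rfl⟩)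
    change ω b.1 a.1 - ω' b.2 a.2 = 0
    rw [h1, h2, sub_zero]
  · have h1 : (G.map φ).map (LinearMap.fst κ V V') =
        (G.map (LinearMap.fst κ _ _)).map (ω.orthogonal U).subtype := by
      rw [← Submodule.map_comp, ← Submodule.map_comp]
      rfl
    rw [Submodule.map_sup, hAU, h1, htop, Submodule.map_top, Submodule.range_subtype,
      hU.sup_orth hs.nondeg]

theorem map_fst_cyc (u : V) (u' : V') :
    (cyc (x.prodMap x' : End κ (V × V')) (u, u')).map (LinearMap.fst κ V V') = cyc x u :=
  map_cyc (φ := LinearMap.fst κ V V') (x' := x) fun i => by rw [prodMap_pow]; rfl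

theorem map_snd_cyc (u : V) (u' : V') :
    (cyc (x.prodMap x' : End κ (V × V')) (u, u')).map (LinearMap.snd κ V V') = cyc x' u' :=
  map_cyc (φ := LinearMap.snd κ V V') (x' := x') fun i => by rw [prodMap_pow]; rfl

/-- Equal Jordan types allow a correspondence, by splitting off blocks of the same size on both
sides. -/
theorem exists_corr [IsAlgClosed κ] (h2 : (2 : κ) ≠ 0) (N : ℕ) :
    ∀ {V V' : Type*} [AddCommGroup V] [Module κ V] [AddCommGroup V'] [Module κ V']
      [FiniteDimensional κ V] [FiniteDimensional κ V'] {ω : LinearMap.BilinForm κ V} {x : End κ V}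
      {ω' : LinearMap.BilinForm κ V'} {x' : End κ V'}, IsSN ω x → IsSN ω' x' →
      finrank κ V ≤ N → kerDim x = kerDim x' → ∃ G, IsCorr ω x ω' x' G := by
  induction N with
  | zero =>
    intro V V' _ _ _ _ _ _ ω x ω' x' hs hs' hN hk
    have : Subsingleton V := finrank_zero_iff.1 (Nat.le_zero.1 hN)
    refine ⟨⊥, ⟨fun a ha b hb => ?_, fun a ha => ?_⟩, Subsingleton.elim _ _⟩
    · rw [(Submodule.mem_bot κ).1 ha, map_zero, LinearMap.zero_apply]
    · rw [(Submodule.mem_bot κ).1 ha, map_zero]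
      exact zero_mem _
  | succ N ih =>
    intro V V' _ _ _ _ _ _ ω x ω' x' hs hs' hN hk
    rcases Nat.eq_zero_or_pos (finrank κ V) with h0 | hpos
    · exact ih hs hs' (by omega) hk
    obtain ⟨h, hh, hm⟩ := exists_block hs hpos
    have hS := isSN_diffForm hs hs'
    -- `U` and `U'` are spanned by blocks of size `h`, and the correspondence exists on `U × U'`
    have main : ∃ (U : Submodule κ V) (U' : Submodule κ V') (A : Submodule κ (V × V')),
        IsSummand ω x U ∧ IsSummand ω' x' U' ∧ (∀ j, kerDimOn x U j = kerDimOn x' U' j) ∧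
        0 < finrank κ U ∧ IsoStable (diffForm ω ω') (x.prodMap x') A ∧
        A.map (LinearMap.fst κ V V') = U ∧ A.map (LinearMap.snd κ V V') = U' := by
      rcases Nat.even_or_odd h with he | ho
      · obtain ⟨u, b⟩ := exists_eBlock h2 hs he fun _ => hm
        obtain ⟨u', b'⟩ := exists_eBlock h2 hs' he fun _ => hk ▸ hm
        refine ⟨_, _, cyc (x.prodMap x') (u, u'), b.isSummand hs, b'.isSummand hs',
          fun j => by rw [b.kerDimOn, b'.kerDimOn], ?_, hS.isoStable_cyc fun i => ?_,
          map_fst_cyc u u', map_snd_cyc u u'⟩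
        · rw [b.hasOrder.finrank_cyc]
          exact hh
        · rw [prodMap_pow, diffForm_apply, b.form, b'.form, sub_self]
      · obtain ⟨w, v, b⟩ := exists_dBlock_of_odd h2 hs ho hm
        obtain ⟨w', v', b'⟩ := exists_dBlock_of_odd h2 hs' ho (hk ▸ hm)
        refine ⟨_, _, cyc (x.prodMap x') (w, w') ⊔ cyc (x.prodMap x') (v, v'), b.isSummand hs,
          b'.isSummand hs', fun j => by rw [b.kerDimOn hs, b'.kerDimOn hs'], ?_,
          (hS.isoStable_cyc fun i => ?_).sup hS (hS.isoStable_cyc fun i => ?_)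
            (hS.cyc_isotropic_pair fun i => ?_), ?_, ?_⟩
        · refine lt_of_lt_of_le ?_ (Submodule.finrank_mono le_sup_left)
          rw [(b.hasOrder hs).finrank_cyc]
          exact hh
        · rw [prodMap_pow, diffForm_apply, b.iso, b'.iso, sub_self]
        · rw [prodMap_pow, diffForm_apply, b.iso', b'.iso', sub_self]
        · rw [prodMap_pow, diffForm_apply, b.form, b'.form, sub_self]
        · rw [Submodule.map_sup, map_fst_cyc, map_fst_cyc]
        · rw [Submodule.map_sup, map_snd_cyc, map_snd_cyc]
    obtain ⟨U, U', A, hU, hU', hUU, hfin, hA, hAU, hAU'⟩ := main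
    obtain ⟨y, hy, hys, hyk⟩ := hU.exists_complement hs
    obtain ⟨y', hy', hys', hyk'⟩ := hU'.exists_complement hs'
    refine glue hs hs' hU hA hAU hAU'.le hy hy' (ih hys hys' ?_ (funext fun j => ?_))
    · have := finrank_orth_add hs.nondeg U
      omega
    · have h3 := hyk j
      rw [hk, hyk' j, hUU] at h3
      omega

/-- Two symplectic nilpotent endomorphisms of the same Jordan type are conjugate by an
isometry. -/
theorem exists_intertwiner [IsAlgClosed κ] (h2 : (2 : κ) ≠ 0) [FiniteDimensional κ V]
    [FiniteDimensional κ V'] (hs : IsSN ω x) (hs' : IsSN ω' x')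
    (hd : finrank κ V = finrank κ V') (hk : kerDim x = kerDim x') :
    ∃ g : V →ₗ[κ] V', (∀ a b, ω' (g a) (g b) = ω a b) ∧ ∀ a, g (x a) = x' (g a) := by
  obtain ⟨G, hG, htop⟩ := exists_corr h2 _ hs hs' le_rfl hk
  have hS := isSN_diffForm hs hs'
  -- `G` is isotropic, so its dimension is at most that of `V`
  have hle := Submodule.finrank_mono hG.le_orth
  have hadd := finrank_orth_add hS.nondeg G
  rw [Module.finrank_prod] at hadd
  set f := (LinearMap.fst κ V V').comp G.subtype with hf
  have hsurj : Function.Surjective f := by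
    rw [← LinearMap.range_eq_top, hf, LinearMap.range_comp, Submodule.range_subtype, htop]
  have hinj : Function.Injective f := by
    rw [← LinearMap.ker_eq_bot, ← Submodule.finrank_eq_zero]
    have h1 := LinearMap.finrank_range_add_finrank_ker f
    rw [LinearMap.range_eq_top.2 hsurj, finrank_top] at h1
    omega
  let e := LinearEquiv.ofBijective f ⟨hinj, hsurj⟩
  have he : ∀ v, (e.symm v : V × V').1 = v := fun v => e.apply_symm_apply v
  refine ⟨(LinearMap.snd κ V V').comp (G.subtype.comp e.symm.toLinearMap), fun a b => ?_,
    fun a => ?_⟩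
  · have h1 := hG.iso _ (e.symm a).2 _ (e.symm b).2
    rw [diffForm_apply, he, he, sub_eq_zero] at h1
    exact h1.symm
  · have h1 : e.symm (x a) = ⟨_, hG.stable _ (e.symm a).2⟩ := by
      rw [LinearEquiv.symm_apply_eq]
      change x a = x (e.symm a : V × V').1
      rw [he]
    change (e.symm (x a) : V × V').2 = _
    rw [h1]
    rfl

/-- The dimensions of the kernels of the powers of `x` determine the orbit of `x`. -/
theorem mem_orbit_of_kerDim [IsAlgClosed κ] (h2 : (2 : κ) ≠ 0) {n : ℕ} {x y : NilCone n κ}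
    (h : kerDim (Matrix.toLin' x.1) = kerDim (Matrix.toLin' y.1)) : y ∈ orbit x := by
  obtain ⟨g, hg, hc⟩ := exists_intertwiner h2 (isSN_toLin' x) (isSN_toLin' y) rfl h
  exact mem_orbit_of_intertwiner g hg hc

/-- The blocks of odd size come in pairs. -/
theorem even_mult_of_odd [IsAlgClosed κ] (h2 : (2 : κ) ≠ 0) {i : ℕ} (hi : Odd i) (N : ℕ) :
    ∀ {V : Type*} [AddCommGroup V] [Module κ V] [FiniteDimensional κ V]
      {ω : LinearMap.BilinForm κ V} {x : End κ V}, IsSN ω x → finrank κ V ≤ N →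
      Even (mult (kerDim x) i) := by
  induction N with
  | zero =>
    intro V _ _ _ ω x hs hN
    have : kerDim x = fun _ => 0 := funext fun j => by
      have := Submodule.finrank_le (LinearMap.ker (x ^ j))
      rw [kerDim]
      omega
    simp [this, mult]
  | succ N ih =>
    intro V _ _ _ ω x hs hN
    rcases Nat.eq_zero_or_pos (finrank κ V) with h0 | hpos
    · exact ih hs (by omega)
    obtain ⟨h, hh, hm⟩ := exists_block hs hpos
    have main : ∃ (U : Submodule κ V) (S : Multiset ℕ), IsSummand ω x U ∧
        (∀ j, kerDimOn x U j = kerSum S j) ∧ 0 < finrank κ U ∧ Even (cnt S i) := by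
      rcases Nat.even_or_odd h with he | ho
      · obtain ⟨u, b⟩ := exists_eBlock h2 hs he fun _ => hm
        refine ⟨_, {h}, b.isSummand hs, b.kerDimOn, ?_, ?_⟩
        · rw [b.hasOrder.finrank_cyc]
          exact hh
        · rw [cnt_singleton, ind, if_neg fun hih : i = h => Nat.not_even_iff_odd.2 hi (hih ▸ he)]
          exact Even.zero
      · obtain ⟨w, v, b⟩ := exists_dBlock_of_odd h2 hs ho hm
        refine ⟨_, {h, h}, b.isSummand hs, b.kerDimOn hs, ?_, ?_⟩
        · refine lt_of_lt_of_le ?_ (Submodule.finrank_mono le_sup_left)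
          rw [(b.hasOrder hs).finrank_cyc]
          exact hh
        · rw [Multiset.insert_eq_cons, cnt_cons, cnt_singleton]
          exact ⟨_, rfl⟩
    obtain ⟨U, S, hU, hS, hfin, hev⟩ := main
    obtain ⟨y, -, hys, hyk⟩ := hU.exists_complement hs
    have h1 : kerDim x = fun j => kerSum S j + kerDim y j := funext fun j => by rw [hyk, hS]
    rw [h1, mult_add, mult_kerSum _ hi.pos]
    refine hev.add (ih hys ?_)
    have := finrank_orth_add hs.nondeg U
    omega

end

/-! ### Subspaces realizing the moves -/

section

open Module

variable {κ : Type*} [Field κ] {V : Type*} [AddCommGroup V] [Module κ V]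
  {ω : LinearMap.BilinForm κ V} {x : End κ V}

theorem exists_hasOrder (hx : IsNilpotent x) (w : V) : ∃ m, HasOrder x w m := by
  classical
  have hex : ∃ k, (x ^ k) w = 0 := by
    obtain ⟨k, hk⟩ := hx
    exact ⟨k, by simp [hk]⟩
  exact ⟨Nat.find hex, Nat.find_spec hex, fun k hk => Nat.find_min hex hk⟩

/-- If `F` lies in a nondegenerate stable subspace `U`, and the part of `F^⊥ / F` coming from `U`
has dimension `k` and contains a vector pairing nontrivially with its image under `x ^ (k - 1)`,
then this part is a single Jordan block. -/
theorem kerDimQuot_of_cyclic [FiniteDimensional κ V] (hs : IsSN ω x) {U F : Submodule κ V}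
    (hU : IsSummand ω x U) (hF : IsoStable ω x F) (hFU : F ≤ U) {k : ℕ}
    (hd : finrank κ U = 2 * finrank κ F + k) {y : V} (hyU : y ∈ U) (hyF : y ∈ ω.orthogonal F)
    (hy : 1 ≤ k → ω y ((x ^ (k - 1)) y) ≠ 0) (j : ℕ) :
    kerDimQuot ω x F j = min k j + kerDimOn x (ω.orthogonal U) j := by
  obtain ⟨C, ω', x', φ, hr, hs'⟩ := exists_reduction hs hF
  set P := ω.orthogonal U with hP
  have hPF : P ≤ ω.orthogonal F := LinearMap.BilinForm.orthogonal_le hFU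
  have hPst := hs.orth_stable hU.stable
  have hFP : ∀ a ∈ F, a ∈ P → a = 0 := fun a ha hp => by
    have : a ∈ U ⊓ P := ⟨hFU ha, hp⟩
    rwa [hU.inf_orth, Submodule.mem_bot] at this
  set Q := U ⊓ ω.orthogonal F with hQ
  have hFQ : F ≤ Q := le_inf hFU hF.le_orth
  have hPQ : P ⊔ Q = ω.orthogonal F := by
    rw [hQ, ← sup_inf_assoc_of_le U hPF, sup_comm, hU.sup_orth hs.nondeg, top_inf_eq]
  have hPQ0 : P ⊓ Q = ⊥ := by
    rw [eq_bot_iff, ← hU.inf_orth]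
    exact fun a ha => ⟨ha.2.1, ha.1⟩
  have hQdim : finrank κ Q = finrank κ F + k := by
    have h1 := Submodule.finrank_sup_add_finrank_inf_eq P Q
    have h2 := finrank_orth_add hs.nondeg U
    have h3 := finrank_orth_add hs.nondeg F
    rw [hPQ, hPQ0, finrank_bot] at h1
    rw [← hP] at h2
    omega
  have hQmap : finrank κ (Q.map φ) = k := by
    have := hr.finrank_map hFQ inf_le_right
    omega
  have hcomm := hr.comm_pow hs hF.stable
  have hstable : ∀ {S : Submodule κ V}, S ≤ ω.orthogonal F → (∀ a ∈ S, x a ∈ S) →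
      ∀ v ∈ S.map φ, x' v ∈ S.map φ := by
    rintro S hSF hS _ ⟨a, ha, rfl⟩
    exact ⟨x a, hS a ha, hr.comm a (hSF ha)⟩
  have hQst : ∀ a ∈ Q, x a ∈ Q := fun a ha =>
    ⟨hU.stable a ha.1, hs.orth_stable hF.stable a ha.2⟩
  -- the image of `U ⊓ F^⊥` is generated by the image of `y`
  obtain ⟨m, hm⟩ := exists_hasOrder hs'.nil (φ y)
  have hcyc : cyc x' (φ y) ≤ Q.map φ :=
    cyc_le_of_stable (hstable inf_le_right hQst) ⟨y, ⟨hyU, hyF⟩, rfl⟩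
  have hmk : m = k := by
    apply le_antisymm
    · rw [← hm.finrank_cyc, ← hQmap]
      exact Submodule.finrank_mono hcyc
    · by_contra hlt
      have hk1 : 1 ≤ k := by omega
      apply hy hk1
      rw [← hr.form y hyF _ (stable_pow (hs.orth_stable hF.stable) _ y hyF), hcomm _ y hyF,
        pow_apply_eq_zero hm.1 (by omega), map_zero]
  have hcycQ : cyc x' (φ y) = Q.map φ :=
    Submodule.eq_of_le_of_finrank_eq hcyc (by rw [hm.finrank_cyc, hQmap, hmk])
  have htop : Q.map φ ⊔ P.map φ = ⊤ := by
    rw [← Submodule.map_sup, sup_comm, hPQ, eq_top_iff]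
    intro v _
    obtain ⟨a, ha, rfl⟩ := hr.surj v
    exact ⟨a, ha, rfl⟩
  have hinf : Q.map φ ⊓ P.map φ = ⊥ := by
    rw [eq_bot_iff]
    rintro _ ⟨⟨q, hq, rfl⟩, ⟨p, hp, hpq⟩⟩
    have h1 : p - q ∈ F := by
      rw [← hr.ker _ (Submodule.sub_mem _ (hPF hp) hq.2), map_sub, hpq, sub_self]
    have h2 : p ∈ U ⊓ P := by
      refine ⟨?_, hp⟩
      rw [← sub_add_cancel p q]
      exact U.add_mem (hFU h1) hq.1
    rw [hU.inf_orth, Submodule.mem_bot] at h2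
    rw [Submodule.mem_bot, ← hpq, h2, map_zero]
  have hker : P.map φ ⊓ LinearMap.ker (x' ^ j) = (P ⊓ LinearMap.ker (x ^ j)).map φ := by
    apply le_antisymm
    · rintro _ ⟨⟨p, hp, rfl⟩, hk⟩
      refine ⟨p, ⟨hp, ?_⟩, rfl⟩
      have hk : (x' ^ j) (φ p) = 0 := hk
      rw [← hcomm j p (hPF hp), hr.ker _ (hPF (stable_pow hPst j p hp))] at hk
      exact hFP _ hk (stable_pow hPst j p hp)
    · rintro _ ⟨p, ⟨hp, hk⟩, rfl⟩
      refine ⟨⟨p, hp, rfl⟩, ?_⟩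
      change (x' ^ j) (φ p) = 0
      rw [← hcomm j p (hPF hp), LinearMap.mem_ker.1 hk, map_zero]
  have hP' : kerDimOn x' (P.map φ) j = kerDimOn x P j := by
    have h1 := finrank_map_add_inf_ker φ (P ⊓ LinearMap.ker (x ^ j))
    have h2 : P ⊓ LinearMap.ker (x ^ j) ⊓ LinearMap.ker φ = ⊥ := by
      rw [eq_bot_iff]
      rintro p ⟨⟨hp, -⟩, hk⟩
      exact hFP p ((hr.ker p (hPF hp)).1 hk) hp
    rw [h2, finrank_bot] at h1
    rw [kerDimOn, hker, kerDimOn]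
    exact h1
  rw [← hr.kerDim_eq hs hF j, ← kerDimOn_top, ← htop,
    kerDimOn_sup (hstable inf_le_right hQst) (hstable hPF hPst) hinf, hP', ← hcycQ,
    hm.kerDimOn_cyc, hmk]

/-- `F` realizes the replacement of the parts `S` by the parts `T`: the graded space of `F` has
the Jordan type obtained from that of `x` by this replacement. -/
def Realizes (ω : LinearMap.BilinForm κ V) (x : End κ V) (S T : Multiset ℕ) (F : Submodule κ V) :
    Prop :=
  IsoStable ω x F ∧
    ∀ j, 2 * kerDimOn x F j + kerDimQuot ω x F j + kerSum S j = kerDim x j + kerSum T j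

theorem kerSum_eq_sum {A : Multiset ℕ} {j : ℕ} (hj : A.sum ≤ j) : kerSum A j = A.sum := by
  induction A using Multiset.induction_on with
  | empty => rfl
  | cons a A ih =>
    rw [Multiset.sum_cons] at hj
    rw [kerSum_cons, ih (by omega), Multiset.sum_cons]
    omega

/-- The criterion by which the moves are realized: `F` lies in a sum `U` of blocks whose sizes are
the parts `S`, and what remains of `U` in `F^⊥ / F` is a single Jordan block of size `k`. -/
theorem realizes_of_cyclic [FiniteDimensional κ V] (hs : IsSN ω x) {U F : Submodule κ V}
    {S T : Multiset ℕ} (hST : S.sum = T.sum) (hU : IsSummand ω x U)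
    (hUS : ∀ j, kerDimOn x U j = kerSum S j) (hF : IsoStable ω x F) (hFU : F ≤ U) {k : ℕ}
    (hFT : ∀ j, 2 * kerDimOn x F j + min k j = kerSum T j) {y : V} (hyU : y ∈ U)
    (hyF : y ∈ ω.orthogonal F) (hy : 1 ≤ k → ω y ((x ^ (k - 1)) y) ≠ 0) :
    Realizes ω x S T F := by
  have hd : finrank κ U = 2 * finrank κ F + k := by
    obtain ⟨N, hN⟩ := hs.nil
    have h0 : ∀ W : Submodule κ V, kerDimOn x W (N + S.sum + k) = finrank κ W := fun W => by
      rw [kerDimOn, add_assoc, pow_add, hN, zero_mul, LinearMap.ker_zero, inf_top_eq]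
    have h1 := hUS (N + S.sum + k)
    have h2 := hFT (N + S.sum + k)
    rw [h0, kerSum_eq_sum (by omega)] at h1 h2
    omega
  refine ⟨hF, fun j => ?_⟩
  have h1 := kerDimQuot_of_cyclic hs hU hF hFU hd hyU hyF hy j
  have h2 := kerDimOn_sup hU.stable (hs.orth_stable hU.stable) hU.inf_orth j
  rw [hU.sup_orth hs.nondeg, kerDimOn_top, hUS] at h2
  have h3 := hFT j
  omega

section

variable [FiniteDimensional κ V] [IsAlgClosed κ]

/-- A sum of blocks with sizes `A` can be enlarged by a block of even size `h`, as long as the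
partition of `x` contains `A` and `h`. -/
theorem add_eBlock (h2 : (2 : κ) ≠ 0) (hs : IsSN ω x) {U : Submodule κ V} {A : Multiset ℕ}
    (hU : IsSummand ω x U) (hA : ∀ j, kerDimOn x U j = kerSum A j) {h : ℕ} (he : Even h)
    (hS : ∀ j, 1 ≤ j → cnt (A + {h}) j ≤ mult (kerDim x) j) :
    ∃ u ∈ ω.orthogonal U, EBlock ω x u h ∧ IsSummand ω x (U ⊔ cyc x u) ∧
      ∀ j, kerDimOn x (U ⊔ cyc x u) j = kerSum (A + {h}) j := by
  obtain ⟨u, hu, b⟩ := exists_eBlock_orth h2 hs hU he fun hh => by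
    have := hS h hh
    rw [cnt_add, cnt_singleton, ind, if_pos rfl] at this
    rwa [show kerDimOn x U = kerSum A from funext hA, mult_kerSum _ hh]
  have hcu : cyc x u ≤ ω.orthogonal U := cyc_le_of_stable (hs.orth_stable hU.stable) hu
  refine ⟨u, hu, b, hU.sup hs (b.isSummand hs) hcu, fun j => ?_⟩
  rw [kerDimOn_sup hU.stable (cyc_stable x u) (hU.inf_eq_bot hcu), hA, b.kerDimOn, kerSum_add]

/-- A sum of blocks with sizes `A` can be enlarged by a pair of blocks of size `h`, as long as the
partition of `x` contains `A` and `h, h`. -/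
theorem add_dBlock (h2 : (2 : κ) ≠ 0) (hs : IsSN ω x) {U : Submodule κ V} {A : Multiset ℕ}
    (hU : IsSummand ω x U) (hA : ∀ j, kerDimOn x U j = kerSum A j) {h : ℕ}
    (hS : ∀ j, 1 ≤ j → cnt (A + {h, h}) j ≤ mult (kerDim x) j) :
    ∃ w ∈ ω.orthogonal U, ∃ w' ∈ ω.orthogonal U, DBlock ω x w w' h ∧
      IsSummand ω x (U ⊔ (cyc x w ⊔ cyc x w')) ∧
      ∀ j, kerDimOn x (U ⊔ (cyc x w ⊔ cyc x w')) j = kerSum (A + {h, h}) j := by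
  obtain ⟨w, hw, w', hw', b⟩ := exists_dBlock_orth (h := h) h2 hs hU fun hh => by
    have := hS h hh
    rw [cnt_add, Multiset.insert_eq_cons, cnt_cons, cnt_singleton, ind, if_pos rfl] at this
    rw [show kerDimOn x U = kerSum A from funext hA, mult_kerSum _ hh]
    linarith
  have hst := hs.orth_stable hU.stable
  have hcu : cyc x w ⊔ cyc x w' ≤ ω.orthogonal U :=
    sup_le (cyc_le_of_stable hst hw) (cyc_le_of_stable hst hw')
  refine ⟨w, hw, w', hw', b, hU.sup hs (b.isSummand hs) hcu, fun j => ?_⟩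
  rw [kerDimOn_sup hU.stable (b.isSummand hs).stable (hU.inf_eq_bot hcu), hA, b.kerDimOn hs,
    kerSum_add]

/-- For blocks generated by `u` and `v`, the vector `x ^ (a - b) u + t v` generates a Lagrangian
subspace of their sum, for a suitable constant `t`. -/
theorem exists_realizes_move1 (h2 : (2 : κ) ≠ 0) (hs : IsSN ω x) {a b : ℕ} (hab : b < a)
    (hS : ∀ j, 1 ≤ j → cnt {2 * a, 2 * b} j ≤ mult (kerDim x) j) :
    ∃ F, Realizes ω x {2 * a, 2 * b} {a + b, a + b} F := by
  have hS' : ∀ j, 1 ≤ j → cnt (0 + {2 * a} + {2 * b}) j ≤ mult (kerDim x) j := hS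
  obtain ⟨u, -, bu, hU, hk⟩ := add_eBlock h2 hs (isSummand_bot (ω := ω) (x := x)) (A := 0)
    (h := 2 * a) (fun j => by simp [kerDimOn, kerSum]) (even_two_mul a) fun j hj => by
      refine le_trans ?_ (hS' j hj)
      rw [cnt_add _ {2 * b}]
      simp [cnt]
  rw [bot_sup_eq] at hU hk
  obtain ⟨v, hv, bv, hU, hk⟩ := add_eBlock h2 hs hU hk (even_two_mul b) hS'
  have huv := hs.mem_orth_cyc.1 hv
  have hvu : ∀ i, ω v ((x ^ i) u) = 0 := fun i => by rw [hs.swap, huv, mul_zero]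
  obtain ⟨d, rfl⟩ := Nat.exists_eq_add_of_lt hab
  -- with this choice of `t` the contributions of `u` and `v` to the form cancel
  obtain ⟨t, ht⟩ := IsAlgClosed.exists_eq_mul_self (-(-1 : κ) ^ (d + 1))
  have hst := sup_stable (cyc_stable x u) (cyc_stable x v)
  set f := (x ^ (d + 1)) u + t • v with hf
  have hfU : f ∈ cyc x u ⊔ cyc x v :=
    Submodule.add_mem_sup (pow_mem_cyc x u _) (Submodule.smul_mem _ t (mem_cyc x v))
  have hiso : ∀ i, ω f ((x ^ i) f) = 0 := fun i => by
    have e : d + 1 + (i + (d + 1)) + 1 = 2 * (b + d + 1) ↔ i + 1 = 2 * b := by omega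
    simp only [hf, map_add, map_smul, LinearMap.add_apply, LinearMap.smul_apply, hs.skew_pow,
      ← Module.End.mul_apply, ← pow_add, smul_eq_mul, bu.form, bv.form, huv, hvu, e]
    split_ifs
    · linear_combination -ht
    · ring
  have hord : HasOrder x f (b + d + 1 + b) := by
    have hpow : ∀ i, (x ^ i) f = (x ^ (i + (d + 1))) u + t • (x ^ i) v := fun i => by
      rw [hf, map_add, map_smul, ← Module.End.mul_apply, ← pow_add]
    refine hasOrder_of ?_ fun _ => ?_
    · rw [hpow, pow_apply_eq_zero bu.pow (by omega), pow_apply_eq_zero bv.pow (by omega)]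
      simp
    · rw [hpow, pow_apply_eq_zero bv.pow (by omega), smul_zero, add_zero]
      exact bu.hasOrder.2 _ (by omega)
  refine ⟨cyc x f, realizes_of_cyclic hs (k := 0) (y := 0) (by simp; ring) hU hk
    (hs.isoStable_cyc hiso) (cyc_le_of_stable hst hfU) (fun j => ?_) (zero_mem _) (zero_mem _)
    (fun h => by omega)⟩
  rw [hord.kerDimOn_cyc, Multiset.insert_eq_cons, kerSum_cons, kerSum_singleton]
  omega

end

end

section

open Module

variable {κ : Type*} [Field κ] {V : Type*} [AddCommGroup V] [Module κ V]
  {ω : LinearMap.BilinForm κ V} {x : End κ V} [FiniteDimensional κ V] [IsAlgClosed κ]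

/-- For a block generated by `u` and a pair of blocks generated by `w, w'`, the subspace is
generated by `f = w + x ^ (2 a - 1 - m) u + c x ^ (2 a - 2 - m) w'`; the vector `y`, a combination
of `x u` and `w'`, generates the remaining block. -/
theorem exists_realizes_move2 (h2 : (2 : κ) ≠ 0) (hs : IsSN ω x) {a m : ℕ}
    (ham : m + 1 + 2 ≤ 2 * a)
    (hS : ∀ j, 1 ≤ j → cnt {2 * a, m, m} j ≤ mult (kerDim x) j) :
    ∃ F, Realizes ω x {2 * a, m, m} {2 * a - 2, m + 1, m + 1} F := by
  have hS' : ∀ j, 1 ≤ j → cnt (0 + {2 * a} + {m, m}) j ≤ mult (kerDim x) j := hS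
  obtain ⟨u, -, bu, hU, hk⟩ := add_eBlock h2 hs (isSummand_bot (ω := ω) (x := x)) (A := 0)
    (h := 2 * a) (fun j => by simp [kerDimOn, kerSum]) (even_two_mul a) fun j hj => by
      refine le_trans ?_ (hS' j hj)
      rw [cnt_add _ {m, m}]
      simp [cnt]
  rw [bot_sup_eq] at hU hk
  obtain ⟨w, hw, w', hw', bw, hU, hk⟩ := add_dBlock h2 hs hU hk hS'
  have huw := hs.mem_orth_cyc.1 hw
  have huw' := hs.mem_orth_cyc.1 hw'
  have hwu : ∀ i, ω w ((x ^ i) u) = 0 := fun i => by rw [hs.swap, huw, mul_zero]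
  have hwu' : ∀ i, ω w' ((x ^ i) u) = 0 := fun i => by rw [hs.swap, huw', mul_zero]
  obtain ⟨s, hsm⟩ := Nat.exists_eq_add_of_le ham
  have hsq : (-1 : κ) ^ s * (-1) ^ s = 1 := by rw [← mul_pow]; simp
  have hsign : (-1 : κ) ^ m = -(-1) ^ s := by
    have h1 : (-1 : κ) ^ (m + 1 + 2 + s) = 1 := by rw [← hsm]; simp
    have h3 : (-1 : κ) ^ m * (-1) ^ s = -1 := by
      rw [pow_add, pow_add, pow_add] at h1
      linear_combination -h1
    linear_combination (-1 : κ) ^ s * h3 - (-1) ^ m * hsq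
  have hw'w : ∀ i, ω w' ((x ^ i) w) = if i + 1 = m then -(-1) ^ s else 0 := fun i => by
    rw [bw.form' hs]
    split_ifs with hi
    · rw [hi, hsign]
    · rfl
  have hinv : (2 : κ)⁻¹ * 2 = 1 := inv_mul_cancel₀ h2
  have hst := hU.stable
  -- `c` is chosen such that the pairing of `w` with `w'` cancels that of `u` with itself
  set c : κ := -(-1) ^ s * 2⁻¹ with hc
  set f := w + (x ^ (s + 2)) u + c • (x ^ (s + 1)) w' with hf
  set y := (x ^ 1) u - ((-1 : κ) ^ s) • w' with hy
  have hUw : cyc x w ≤ cyc x u ⊔ (cyc x w ⊔ cyc x w') := le_sup_left.trans le_sup_right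
  have hUw' : cyc x w' ≤ cyc x u ⊔ (cyc x w ⊔ cyc x w') := le_sup_right.trans le_sup_right
  have hUu : cyc x u ≤ cyc x u ⊔ (cyc x w ⊔ cyc x w') := le_sup_left
  have hfU : f ∈ cyc x u ⊔ (cyc x w ⊔ cyc x w') :=
    Submodule.add_mem _ (Submodule.add_mem _ (hUw (mem_cyc x w)) (hUu (pow_mem_cyc x u _)))
      (Submodule.smul_mem _ _ (hUw' (pow_mem_cyc x w' _)))
  have hyU : y ∈ cyc x u ⊔ (cyc x w ⊔ cyc x w') :=
    Submodule.sub_mem _ (hUu (pow_mem_cyc x u _)) (Submodule.smul_mem _ _ (hUw' (mem_cyc x w')))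
  have hiso : ∀ i, ω f ((x ^ i) f) = 0 := fun i => by
    have e1 : s + 2 + (i + (s + 2)) + 1 = 2 * a ↔ i + s + 2 = m := by omega
    have e2 : i + (s + 1) + 1 = m ↔ i + s + 2 = m := by omega
    have e3 : s + 1 + i + 1 = m ↔ i + s + 2 = m := by omega
    simp only [hf, map_add, map_smul, LinearMap.add_apply, LinearMap.smul_apply, hs.skew_pow,
      ← Module.End.mul_apply, ← pow_add, smul_eq_mul, bu.form, bw.form, bw.iso, bw.iso', hw'w, huw,
      huw', hwu, hwu', e1, e2, e3]
    split_ifs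
    · linear_combination -(-1 : κ) ^ s * hinv + c * hsq
    · ring
  have hord : HasOrder x f (m + 1) := by
    have hpow : ∀ i, (x ^ i) f = (x ^ i) w + (x ^ (i + (s + 2))) u + c • (x ^ (i + (s + 1))) w' :=
      fun i => by
        rw [hf, map_add, map_add, map_smul, ← Module.End.mul_apply, ← Module.End.mul_apply,
          ← pow_add, ← pow_add]
    refine hasOrder_of ?_ fun _ => ?_
    · rw [hpow, pow_apply_eq_zero bu.pow (by omega), pow_apply_eq_zero bw.pow (by omega),
        pow_apply_eq_zero bw.pow' (by omega)]
      simp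
    · rw [hpow, pow_apply_eq_zero bw.pow (by omega), pow_apply_eq_zero bw.pow' (by omega),
        smul_zero, zero_add, add_zero]
      exact bu.hasOrder.2 _ (by omega)
  refine ⟨cyc x f, realizes_of_cyclic hs (k := 2 * a - 2) (y := y) (by simp; omega) hU hk
    (hs.isoStable_cyc hiso) (cyc_le_of_stable hst hfU) (fun j => ?_) hyU
    (hs.mem_orth_cyc.2 fun i => ?_) fun _ => ?_⟩
  · rw [hord.kerDimOn_cyc, Multiset.insert_eq_cons, kerSum_cons, Multiset.insert_eq_cons,
      kerSum_cons, kerSum_singleton]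
    omega
  · have e1 : s + 2 + (i + 1) + 1 = 2 * a ↔ i + 1 = m := by omega
    simp only [hf, hy, map_add, map_sub, map_smul, LinearMap.add_apply, LinearMap.smul_apply,
      hs.skew_pow, ← Module.End.mul_apply, ← pow_add, smul_eq_mul, bu.form, bw.form, bw.iso', huw',
      hwu, hwu', e1]
    split_ifs <;> ring
  · have e1 : 1 + (2 * a - 2 - 1 + 1) + 1 = 2 * a := by omega
    have h3 : ω y ((x ^ (2 * a - 2 - 1)) y) = -1 := by
      simp only [hy, map_sub, map_smul, LinearMap.sub_apply, LinearMap.smul_apply,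
        hs.skew_pow, ← Module.End.mul_apply, ← pow_add, smul_eq_mul, bu.form, bw.iso', huw', hwu',
        e1, if_true]
      ring
    rw [h3]
    exact neg_ne_zero.2 one_ne_zero

/-- For a pair of blocks generated by `w, w'` and a block generated by `v`, the subspace is
generated by `f = x w + v + c x ^ (m - 1 - 2 a) w'`; the vector `y = w - c x ^ (m - 2 - 2 a) w'`
generates the remaining block. -/
theorem exists_realizes_move3 (h2 : (2 : κ) ≠ 0) (hs : IsSN ω x) {m a : ℕ}
    (ham : 2 * a + 2 + 1 ≤ m)
    (hS : ∀ j, 1 ≤ j → cnt {m, m, 2 * a} j ≤ mult (kerDim x) j) :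
    ∃ F, Realizes ω x {m, m, 2 * a} {m - 1, m - 1, 2 * a + 2} F := by
  have hS' : ∀ j, 1 ≤ j → cnt (0 + {m, m} + {2 * a}) j ≤ mult (kerDim x) j := hS
  obtain ⟨w, -, w', -, bw, hU, hk⟩ := add_dBlock h2 hs (isSummand_bot (ω := ω) (x := x)) (A := 0)
    (h := m) (fun j => by simp [kerDimOn, kerSum]) fun j hj => by
      refine le_trans ?_ (hS' j hj)
      rw [cnt_add _ {2 * a}]
      simp [cnt]
  rw [bot_sup_eq] at hU hk
  obtain ⟨v, hv, bv, hU, hk⟩ := add_eBlock h2 hs hU hk (even_two_mul a) hS'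
  have hwv := hs.mem_orth_cyc.1 (LinearMap.BilinForm.orthogonal_le le_sup_left hv)
  have hwv' := hs.mem_orth_cyc.1 (LinearMap.BilinForm.orthogonal_le le_sup_right hv)
  have hvw : ∀ i, ω v ((x ^ i) w) = 0 := fun i => by rw [hs.swap, hwv, mul_zero]
  have hvw' : ∀ i, ω v ((x ^ i) w') = 0 := fun i => by rw [hs.swap, hwv', mul_zero]
  obtain ⟨s, hsm⟩ := Nat.exists_eq_add_of_le ham
  have hsq : (-1 : κ) ^ s * (-1) ^ s = 1 := by rw [← mul_pow]; simp
  have hsign : (-1 : κ) ^ m = -(-1) ^ s := by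
    rw [hsm, show 2 * a + 2 + 1 + s = 2 * (a + 1) + 1 + s by ring, pow_add, pow_add, pow_mul]
    simp
  have hw'w : ∀ i, ω w' ((x ^ i) w) = if i + 1 = m then -(-1) ^ s else 0 := fun i => by
    rw [bw.form' hs]
    split_ifs with hi
    · rw [hi, hsign]
    · rfl
  have hinv : (2 : κ)⁻¹ * 2 = 1 := inv_mul_cancel₀ h2
  have hst := hU.stable
  -- `c` is chosen such that the pairing of `w` with `w'` cancels that of `v` with itself
  set c : κ := 2⁻¹ with hc
  set f := (x ^ 1) w + v + c • (x ^ (s + 2)) w' with hf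
  set y := w - c • (x ^ (s + 1)) w' with hy
  have hUw : cyc x w ≤ cyc x w ⊔ cyc x w' ⊔ cyc x v := le_sup_left.trans le_sup_left
  have hUw' : cyc x w' ≤ cyc x w ⊔ cyc x w' ⊔ cyc x v := le_sup_right.trans le_sup_left
  have hUv : cyc x v ≤ cyc x w ⊔ cyc x w' ⊔ cyc x v := le_sup_right
  have hfU : f ∈ cyc x w ⊔ cyc x w' ⊔ cyc x v :=
    Submodule.add_mem _ (Submodule.add_mem _ (hUw (pow_mem_cyc x w _)) (hUv (mem_cyc x v)))
      (Submodule.smul_mem _ _ (hUw' (pow_mem_cyc x w' _)))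
  have hyU : y ∈ cyc x w ⊔ cyc x w' ⊔ cyc x v :=
    Submodule.sub_mem _ (hUw (mem_cyc x w)) (Submodule.smul_mem _ _ (hUw' (pow_mem_cyc x w' _)))
  have hiso : ∀ i, ω f ((x ^ i) f) = 0 := fun i => by
    have e1 : 1 + (i + (s + 2)) + 1 = m ↔ i + 1 = 2 * a := by omega
    have e2 : s + 2 + (i + 1) + 1 = m ↔ i + 1 = 2 * a := by omega
    simp only [hf, map_add, map_smul, LinearMap.add_apply, LinearMap.smul_apply, hs.skew_pow,
      ← Module.End.mul_apply, ← pow_add, smul_eq_mul, bv.form, bw.form, bw.iso, bw.iso', hw'w, hwv,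
      hwv', hvw, hvw', e1, e2]
    split_ifs
    · linear_combination -hinv - c * hsq
    · ring
  have hord : HasOrder x f (m - 1) := by
    have hpow : ∀ i, (x ^ i) f = (x ^ (i + 1)) w + (x ^ i) v + c • (x ^ (i + (s + 2))) w' :=
      fun i => by
        rw [hf, map_add, map_add, map_smul, ← Module.End.mul_apply, ← Module.End.mul_apply,
          ← pow_add, ← pow_add]
    refine hasOrder_of ?_ fun _ => ?_
    · rw [hpow, pow_apply_eq_zero bw.pow (by omega), pow_apply_eq_zero bv.pow (by omega),
        pow_apply_eq_zero bw.pow' (by omega)]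
      simp
    · rw [hpow, pow_apply_eq_zero bv.pow (by omega), pow_apply_eq_zero bw.pow' (by omega),
        smul_zero, add_zero, add_zero]
      exact (bw.hasOrder hs).2 _ (by omega)
  refine ⟨cyc x f, realizes_of_cyclic hs (k := 2 * a + 2) (y := y) (by simp; omega) hU hk
    (hs.isoStable_cyc hiso) (cyc_le_of_stable hst hfU) (fun j => ?_) hyU
    (hs.mem_orth_cyc.2 fun i => ?_) fun _ => ?_⟩
  · rw [hord.kerDimOn_cyc, Multiset.insert_eq_cons, kerSum_cons, Multiset.insert_eq_cons,
      kerSum_cons, kerSum_singleton]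
    omega
  · have e1 : 1 + (i + (s + 1)) + 1 = m ↔ i = 2 * a := by omega
    have e2 : s + 2 + i + 1 = m ↔ i = 2 * a := by omega
    simp only [hf, hy, map_add, map_sub, map_smul, LinearMap.add_apply, LinearMap.smul_apply,
      hs.skew_pow, ← Module.End.mul_apply, ← pow_add, smul_eq_mul, bw.form, bw.iso, bw.iso', hw'w,
      hvw, hvw', e1, e2]
    split_ifs
    · linear_combination -c * hsq
    · ring
  · have e1 : 2 * a + 2 - 1 + (s + 1) + 1 = m := by omega
    have e2 : s + 1 + (2 * a + 2 - 1) + 1 = m := by omega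
    have h3 : ω y ((x ^ (2 * a + 2 - 1)) y) = -1 := by
      simp only [hy, map_sub, map_smul, LinearMap.sub_apply, LinearMap.smul_apply,
        hs.skew_pow, ← Module.End.mul_apply, ← pow_add, smul_eq_mul, bw.form, bw.iso, bw.iso', hw'w,
        e1, e2, if_true]
      linear_combination -hinv - c * hsq
    rw [h3]
    exact neg_ne_zero.2 one_ne_zero

/-- For pairs of blocks generated by `w, w'` and `v, v'`, the vectors `x w + v` and `x ^ (m - k - 1)
w' + v'` generate a Lagrangian subspace of their sum. -/
theorem exists_realizes_move4 (h2 : (2 : κ) ≠ 0) (hs : IsSN ω x) {m k : ℕ} (hkm : k + 1 + 1 ≤ m)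
    (hS : ∀ j, 1 ≤ j → cnt {m, m, k, k} j ≤ mult (kerDim x) j) :
    ∃ F, Realizes ω x {m, m, k, k} {m - 1, m - 1, k + 1, k + 1} F := by
  have hS' : ∀ j, 1 ≤ j → cnt (0 + {m, m} + {k, k}) j ≤ mult (kerDim x) j := hS
  obtain ⟨w, -, w', -, bw, hU, hk⟩ := add_dBlock h2 hs (isSummand_bot (ω := ω) (x := x)) (A := 0)
    (h := m) (fun j => by simp [kerDimOn, kerSum]) fun j hj => by
      refine le_trans ?_ (hS' j hj)
      rw [cnt_add _ {k, k}]
      simp [cnt]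
  rw [bot_sup_eq] at hU hk
  obtain ⟨v, hv, v', hv', bv, hU, hk⟩ := add_dBlock h2 hs hU hk hS'
  have hwv := hs.mem_orth_cyc.1 (LinearMap.BilinForm.orthogonal_le le_sup_left hv)
  have hwv' := hs.mem_orth_cyc.1 (LinearMap.BilinForm.orthogonal_le le_sup_left hv')
  have hw'v := hs.mem_orth_cyc.1 (LinearMap.BilinForm.orthogonal_le le_sup_right hv)
  have hw'v' := hs.mem_orth_cyc.1 (LinearMap.BilinForm.orthogonal_le le_sup_right hv')
  have hvw : ∀ i, ω v ((x ^ i) w) = 0 := fun i => by rw [hs.swap, hwv, mul_zero]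
  have hvw' : ∀ i, ω v ((x ^ i) w') = 0 := fun i => by rw [hs.swap, hw'v, mul_zero]
  have hv'w' : ∀ i, ω v' ((x ^ i) w') = 0 := fun i => by rw [hs.swap, hw'v', mul_zero]
  obtain ⟨s, hsm⟩ := Nat.exists_eq_add_of_le hkm
  have hst := hU.stable
  set f := (x ^ 1) w + v with hf
  set g := (x ^ (s + 1)) w' + v' with hg
  have hUw : cyc x w ≤ cyc x w ⊔ cyc x w' ⊔ (cyc x v ⊔ cyc x v') := le_sup_left.trans le_sup_left
  have hUw' : cyc x w' ≤ cyc x w ⊔ cyc x w' ⊔ (cyc x v ⊔ cyc x v') :=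
    le_sup_right.trans le_sup_left
  have hUv : cyc x v ≤ cyc x w ⊔ cyc x w' ⊔ (cyc x v ⊔ cyc x v') := le_sup_left.trans le_sup_right
  have hUv' : cyc x v' ≤ cyc x w ⊔ cyc x w' ⊔ (cyc x v ⊔ cyc x v') :=
    le_sup_right.trans le_sup_right
  have hfU : f ∈ cyc x w ⊔ cyc x w' ⊔ (cyc x v ⊔ cyc x v') :=
    Submodule.add_mem _ (hUw (pow_mem_cyc x w _)) (hUv (mem_cyc x v))
  have hgU : g ∈ cyc x w ⊔ cyc x w' ⊔ (cyc x v ⊔ cyc x v') :=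
    Submodule.add_mem _ (hUw' (pow_mem_cyc x w' _)) (hUv' (mem_cyc x v'))
  have hiso : ∀ i, ω f ((x ^ i) f) = 0 := fun i => by
    simp only [hf, map_add, LinearMap.add_apply, hs.skew_pow, ← Module.End.mul_apply, ← pow_add,
      bw.iso, bv.iso, hwv, hvw]
    ring
  have hiso' : ∀ i, ω g ((x ^ i) g) = 0 := fun i => by
    simp only [hg, map_add, LinearMap.add_apply, hs.skew_pow, ← Module.End.mul_apply, ← pow_add,
      bw.iso', bv.iso', hw'v', hv'w']
    ring
  have hfg : ∀ i, ω f ((x ^ i) g) = 0 := fun i => by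
    have e1 : 1 + (i + (s + 1)) + 1 = m ↔ i + 1 = k := by omega
    simp only [hf, hg, map_add, LinearMap.add_apply, hs.skew_pow, ← Module.End.mul_apply,
      ← pow_add, bw.form, bv.form, hwv', hvw', e1]
    split_ifs <;> ring
  have hpf : ∀ i, (x ^ i) f = (x ^ (i + 1)) w + (x ^ i) v := fun i => by
    rw [hf, map_add, ← Module.End.mul_apply, ← pow_add]
  have hpg : ∀ i, (x ^ i) g = (x ^ (i + (s + 1))) w' + (x ^ i) v' := fun i => by
    rw [hg, map_add, ← Module.End.mul_apply, ← pow_add]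
  -- the last nonzero powers of `x` on the two vectors
  have htf : (x ^ (m - 1 - 1)) f = (x ^ (m - 1)) w := by
    rw [hpf, pow_apply_eq_zero bv.pow (by omega), add_zero, show m - 1 - 1 + 1 = m - 1 by omega]
  have htg : (x ^ (k + 1 - 1)) g = (x ^ (m - 1)) w' := by
    rw [hpg, pow_apply_eq_zero bv.pow' (by omega), add_zero,
      show k + 1 - 1 + (s + 1) = m - 1 by omega]
  have hof : HasOrder x f (m - 1) := by
    refine hasOrder_of ?_ fun _ => ?_
    · rw [hpf, pow_apply_eq_zero bw.pow (by omega), pow_apply_eq_zero bv.pow (by omega), add_zero]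
    · rw [htf]
      exact (bw.hasOrder hs).2 _ (by omega)
  have hog : HasOrder x g (k + 1) := by
    refine hasOrder_of ?_ fun _ => ?_
    · rw [hpg, pow_apply_eq_zero bw.pow' (by omega), pow_apply_eq_zero bv.pow' (by omega), add_zero]
    · rw [htg]
      exact bw.hasOrder'.2 _ (by omega)
  have hinf : cyc x f ⊓ cyc x g = ⊥ := by
    refine eq_bot_of_inf_ker hs.nil
      (fun a ha => ⟨cyc_stable x f a ha.1, cyc_stable x g a ha.2⟩) ?_
    rw [eq_bot_iff]
    rintro a ⟨⟨ha, ha'⟩, hker⟩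
    obtain ⟨c, hc⟩ := hof.socle ha hker
    obtain ⟨c', hc'⟩ := hog.socle ha' hker
    rw [htf] at hc
    rw [htg] at hc'
    have h3 : ω w a = 0 := by rw [hc, map_smul, bw.iso, smul_zero]
    rw [hc', map_smul, bw.form, if_pos (by omega), smul_eq_mul, mul_one] at h3
    rw [hc', h3, zero_smul]
    exact zero_mem _
  refine ⟨cyc x f ⊔ cyc x g, realizes_of_cyclic hs (k := 0) (y := 0) (by simp; omega) hU hk
    ((hs.isoStable_cyc hiso).sup hs (hs.isoStable_cyc hiso') (hs.cyc_isotropic_pair hfg))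
    (sup_le (cyc_le_of_stable hst hfU) (cyc_le_of_stable hst hgU)) (fun j => ?_) (zero_mem _)
    (zero_mem _) (fun h => by omega)⟩
  rw [kerDimOn_sup (cyc_stable x f) (cyc_stable x g) hinf, hof.kerDimOn_cyc, hog.kerDimOn_cyc]
  simp only [Multiset.insert_eq_cons, kerSum_cons, kerSum_singleton]
  omega

end

/-! ### Cocharacters attached to isotropic subspaces -/

section

open Module

section

variable {κ : Type*} [Field κ] {V : Type*} [AddCommGroup V] [Module κ V]
  {ω : LinearMap.BilinForm κ V} {x : End κ V} [FiniteDimensional κ V]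

/-- The orthogonal of an isotropic subspace has an isotropic complement: a projection `r` with
kernel `F^⊥` is changed to `r - p * r / 2`, for `p` its adjoint. -/
theorem exists_isotropic_projection (h2 : (2 : κ) ≠ 0) (hs : IsSN ω x) {F : Submodule κ V}
    (hF : ∀ a ∈ F, ∀ b ∈ F, ω a b = 0) :
    ∃ r : End κ V, r * r = r ∧ LinearMap.ker r = ω.orthogonal F ∧ ∀ a b, ω (r a) (r b) = 0 := by
  obtain ⟨C, hC⟩ := Submodule.exists_isCompl (ω.orthogonal F)
  set r := C.projectionOnto (ω.orthogonal F) hC.symm with hr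
  set r0 : End κ V := C.subtype.comp r with hr0
  have hker : LinearMap.ker r0 = ω.orthogonal F := by
    rw [hr0, LinearMap.ker_comp, Submodule.ker_subtype, ← LinearMap.ker, hr,
      Submodule.ker_projectionOnto]
  have hrr : r0 * r0 = r0 := by
    ext a
    simp [hr0, hr]
  set p := LinearMap.BilinForm.leftAdjointOfNondegenerate ω hs.nondeg r0 with hp
  have hadj : ∀ a b, ω (p a) b = ω a (r0 b) :=
    LinearMap.BilinForm.isAdjointPairLeftAdjointOfNondegenerate ω hs.nondeg r0
  have hrange : LinearMap.range p = F := by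
    have h1 := orth_range_of_adjoint hs.nondeg hadj
    rw [hker] at h1
    rw [← LinearMap.BilinForm.orthogonal_orthogonal hs.nondeg hs.alt.isRefl (LinearMap.range p), h1,
      LinearMap.BilinForm.orthogonal_orthogonal hs.nondeg hs.alt.isRefl]
  have hrp : ∀ a, r0 (p a) = 0 := fun a => by
    rw [← LinearMap.mem_ker, hker]
    exact fun b hb => hF b hb _ (hrange ▸ ⟨a, rfl⟩)
  have hrr' : ∀ a, r0 (r0 a) = r0 a := fun a => LinearMap.congr_fun hrr a
  have h3 : (2 : κ)⁻¹ * 2 = 1 := inv_mul_cancel₀ h2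
  refine ⟨r0 - (2 : κ)⁻¹ • (p * r0), ?_, ?_, fun a b => ?_⟩
  · ext a
    simp [hrp, hrr']
  · rw [← hker]
    ext a
    simp only [LinearMap.mem_ker, LinearMap.sub_apply, LinearMap.smul_apply, Module.End.mul_apply]
    constructor
    · intro h
      have := congrArg r0 h
      simpa [hrp, hrr'] using this
    · intro h
      simp [h]
  · have e1 : ω (r0 a) (p (r0 b)) = ω (r0 a) (r0 b) := by
      rw [hs.neg, hadj, hrr', ← hs.neg]
    simp only [LinearMap.sub_apply, LinearMap.smul_apply, Module.End.mul_apply, map_sub, map_smul,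
      hadj, e1, hrr', hrp, map_zero, smul_eq_mul]
    linear_combination -ω (r0 a) (r0 b) * h3

/-- Every isotropic stable subspace is the part of weight `1` of a compatible grading. -/
theorem exists_degen (h2 : (2 : κ) ≠ 0) (hs : IsSN ω x) {F : Submodule κ V}
    (hF : IsoStable ω x F) : ∃ z p q r, Degen ω x z p q r ∧ LinearMap.range p = F := by
  obtain ⟨r, hrr, hker, hiso⟩ := exists_isotropic_projection h2 hs hF.iso
  set p := LinearMap.BilinForm.leftAdjointOfNondegenerate ω hs.nondeg r with hp
  have hadj : ∀ a b, ω (p a) b = ω a (r b) :=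
    LinearMap.BilinForm.isAdjointPairLeftAdjointOfNondegenerate ω hs.nondeg r
  have hadj' : ∀ a b, ω (r a) b = ω a (p b) := fun a b => by
    rw [hs.neg, ← hadj, ← hs.neg]
  have hrange : LinearMap.range p = F := by
    have h1 := orth_range_of_adjoint hs.nondeg hadj
    rw [hker] at h1
    rw [← LinearMap.BilinForm.orthogonal_orthogonal hs.nondeg hs.alt.isRefl (LinearMap.range p), h1,
      LinearMap.BilinForm.orthogonal_orthogonal hs.nondeg hs.alt.isRefl]
  have hext : ∀ {S T : End κ V}, (∀ a b, ω (S a) b = ω (T a) b) → S = T := fun h =>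
    LinearMap.ext fun a => sub_eq_zero.1 (hs.nondeg.1 _ fun b => by
      rw [map_sub, LinearMap.sub_apply, h, sub_self])
  have hpp : p * p = p := hext fun a b => by
    rw [Module.End.mul_apply, hadj, hadj, hadj, ← Module.End.mul_apply, hrr]
  have hrp : r * p = 0 := by
    ext a
    change r (p a) = 0
    rw [← LinearMap.mem_ker, hker]
    exact hF.le_orth (hrange ▸ ⟨a, rfl⟩)
  have hpr : p * r = 0 := hext fun a b => by
    rw [Module.End.mul_apply, hadj, hiso]
    simp
  set q := 1 - p - r with hq
  have hqp : q * p = 0 := by rw [hq, sub_mul, sub_mul, hpp, hrp, one_mul]; simp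
  have hpq : p * q = 0 := by rw [hq, mul_sub, mul_sub, hpp, hpr, mul_one]; simp
  have hqr : q * r = 0 := by rw [hq, sub_mul, sub_mul, hrr, hpr, one_mul]; simp
  have hrq : r * q = 0 := by rw [hq, mul_sub, mul_sub, hrr, hrp, mul_one]; simp
  -- `x` preserves `F` and `F^⊥`
  have hxp : ∀ a, ∃ b, p b = x (p a) := fun a => by
    have : x (p a) ∈ F := hF.stable _ (hrange ▸ ⟨a, rfl⟩)
    rwa [← hrange] at this
  refine ⟨_, p, q, r, ⟨by rw [hq]; abel, hpp, ?_, hrr, hpq, hqp, hpr, hrp, hqr, hrq, hadj,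
    fun a b => ?_, ?_, ?_, ?_, rfl⟩, hrange⟩
  · nth_rewrite 1 [hq]
    rw [sub_mul, sub_mul, one_mul, hpq, hrq, sub_zero, sub_zero]
  · simp only [hq, LinearMap.sub_apply, Module.End.one_apply, map_sub, hadj, hadj']
    ring
  · ext a
    obtain ⟨b, hb⟩ := hxp a
    change q (x (p a)) = 0
    rw [← hb, ← Module.End.mul_apply, hqp, LinearMap.zero_apply]
  · ext a
    obtain ⟨b, hb⟩ := hxp a
    change r (x (p a)) = 0
    rw [← hb, ← Module.End.mul_apply, hrp, LinearMap.zero_apply]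
  · ext a
    change r (x (q a)) = 0
    rw [← LinearMap.mem_ker, hker]
    refine hs.orth_stable hF.stable _ ?_
    rw [← hker, LinearMap.mem_ker, ← Module.End.mul_apply, hrq, LinearMap.zero_apply]

end

open Matrix

variable {κ : Type*} [Field κ] {n : ℕ}

namespace Degen

variable {x z p q r : End κ (Fin n ⊕ Fin n → κ)}

/-- The endomorphism acting by `a`, `1`, `a⁻¹` on the parts of weight `1`, `0`, `-1`. -/
def act (p q r : End κ (Fin n ⊕ Fin n → κ)) (a : κˣ) : End κ (Fin n ⊕ Fin n → κ) :=
  (a : κ) • p + q + ((a⁻¹ : κˣ) : κ) • r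

theorem act_mul (h : Degen (spForm n κ) x z p q r) (a b : κˣ) :
    act p q r a * act p q r b = act p q r (a * b) := by
  simp only [act, add_mul, mul_add, smul_mul_assoc, mul_smul_comm, h.pp, h.pq, h.pr, h.qp, h.qq,
    h.qr, h.rp, h.rq, h.rr, smul_zero, add_zero, zero_add, smul_smul, mul_inv, Units.val_mul,
    mul_comm]

theorem act_one (h : Degen (spForm n κ) x z p q r) : act p q r 1 = 1 := by
  simp [act, h.sum]

theorem act_mem (h : Degen (spForm n κ) x z p q r) (a : κˣ) :
    LinearMap.toMatrix' (act p q r a) ∈ symplecticGroup (Fin n) κ := by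
  have hadj : ∀ u v, spForm n κ (act p q r a u) v = spForm n κ u (act p q r a⁻¹ v) := fun u v => by
    simp only [act, LinearMap.add_apply, LinearMap.smul_apply, map_add, map_smul, h.adj, h.adj',
      h.adj_symm, inv_inv]
    ring
  refine mem_symplectic_iff.2 fun u v => ?_
  rw [toLin'_toMatrix', hadj, ← Module.End.mul_apply, h.act_mul, inv_mul_cancel, h.act_one]
  rfl

/-- The cocharacter defined by a grading. -/
noncomputable def cocharacter (h : Degen (spForm n κ) x z p q r) : Cocharacter n κ where
  toHom :=
    { toFun := fun a => ⟨LinearMap.toMatrix' (act p q r a), h.act_mem a⟩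
      map_one' := Subtype.ext ((congrArg _ h.act_one).trans LinearMap.toMatrix'_one)
      map_mul' := fun a b => Subtype.ext
        ((congrArg _ (h.act_mul a b).symm).trans (LinearMap.toMatrix'_mul _ _)) }
  regular := by
    refine ⟨Matrix.of fun i j => LaurentPolynomial.C (LinearMap.toMatrix' p i j) *
      LaurentPolynomial.T 1 + LaurentPolynomial.C (LinearMap.toMatrix' q i j) +
        LaurentPolynomial.C (LinearMap.toMatrix' r i j) * LaurentPolynomial.T (-1),
      fun a i j => ?_⟩
    change LinearMap.toMatrix' (act p q r a) i j = _
    simp only [act, map_add, map_smul, Matrix.add_apply, Matrix.smul_apply, smul_eq_mul,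
      Matrix.of_apply, LaurentPolynomial.eval₂_C_mul_T, LaurentPolynomial.eval₂_C, zpow_one,
      _root_.zpow_neg, RingHom.id_apply]
    ring

/-- Conjugation by the cocharacter multiplies the component of weight `k` of `x` by `a ^ k`, so the
limit at `a = 0` is the component of weight `0`. -/
theorem isLimit {x z : NilCone n κ} (h : Degen (spForm n κ) (toLin' x.1) (toLin' z.1) p q r) :
    IsLimit h.cocharacter x z := by
  set y := toLin' x.1 with hy
  have hx : x.1 = LinearMap.toMatrix' y := (LinearMap.toMatrix'_toLin' _).symm
  have hz : z.1 = LinearMap.toMatrix' (p * y * p + q * y * q + r * y * r) := by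
    rw [← h.eq, LinearMap.toMatrix'_toLin']
  refine ⟨(z.1).map Polynomial.C +
    (Polynomial.X : Polynomial κ) • (LinearMap.toMatrix' (p * y * q + q * y * r)).map Polynomial.C +
    (Polynomial.X ^ 2 : Polynomial κ) • (LinearMap.toMatrix' (p * y * r)).map Polynomial.C,
    fun a => ?_, ?_⟩
  · have h1 : ((h.cocharacter.toHom a)⁻¹ : symplecticGroup (Fin n) κ) =
        h.cocharacter.toHom a⁻¹ := (map_inv _ a).symm
    rw [h1]
    change _ = LinearMap.toMatrix' (act p q r a) * x.1 * LinearMap.toMatrix' (act p q r a⁻¹)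
    rw [hx, ← LinearMap.toMatrix'_mul, ← LinearMap.toMatrix'_mul]
    have h2 : act p q r a * y * act p q r a⁻¹ = (p * y * p + q * y * q + r * y * r) +
        (a : κ) • (p * y * q + q * y * r) + ((a : κ) ^ 2) • (p * y * r) := by
      have hq0 := h.qxp
      have hr0 := h.rxp
      have hr1 := h.rxq
      simp only [act, add_mul, mul_add, smul_mul_assoc, mul_smul_comm, inv_inv, hq0, hr0, hr1,
        smul_add, smul_zero, smul_smul, Units.mul_inv, Units.inv_mul, one_smul, pow_two, add_zero]
      abel
    have h3 : ∀ i j, z.1 i j = _ := fun i j => congrFun (congrFun hz i) j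
    rw [h2]
    ext i j
    simp [h3]
    ring
  · ext i j
    simp

end Degen

/-- If an isotropic stable subspace realizes the passage from the Jordan type of `x` to that of
`y`, then `y` is accessible in one step. -/
theorem oneAccessible_of_isoStable [IsAlgClosed κ] (h2 : (2 : κ) ≠ 0) {x y : NilCone n κ}
    {F : Submodule κ (Fin n ⊕ Fin n → κ)} (hF : IsoStable (spForm n κ) (toLin' x.1) F)
    (hy : ∀ j, kerDim (toLin' y.1) j = 2 * kerDimOn (toLin' x.1) F j +
      kerDimQuot (spForm n κ) (toLin' x.1) F j) : OneAccessible x y := by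
  obtain ⟨z, p, q, r, h, rfl⟩ := exists_degen h2 (isSN_toLin' x) hF
  have hz := h.isSN (isSN_toLin' x)
  have h' : Degen (spForm n κ) (toLin' x.1) (toLin' (NilCone.ofEnd z hz).1) p q r := by
    rwa [NilCone.toLin'_ofEnd]
  refine ⟨h'.cocharacter, NilCone.ofEnd z hz, h'.isLimit, mem_orbit_of_kerDim h2 ?_⟩
  rw [NilCone.toLin'_ofEnd]
  exact funext fun j => by rw [hy, h.kerDim_eq (isSN_toLin' x)]

end

/-! ### Jordan bases -/

section

open Module

variable {κ : Type*} [Field κ] {V : Type*} [AddCommGroup V] [Module κ V]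

theorem jordanMatrix_apply (l : List ℕ) (i k : Fin l.length) (s : Fin (l.get i))
    (t : Fin (l.get k)) :
    jordanMatrix κ l ⟨i, s⟩ ⟨k, t⟩ = if i = k ∧ (s : ℕ) + 1 = t then 1 else 0 := by
  rw [jordanMatrix, Matrix.blockDiagonal'_apply]
  by_cases h : i = k
  · subst h
    simp
  · simp [h]

/-- The Jordan normal form in terms of the basis: the basis vectors form chains. -/
theorem toMatrix_eq_jordanMatrix_iff {l : List ℕ}
    (b : Basis (Σ i : Fin l.length, Fin (l.get i)) κ V) (x : End κ V) :
    LinearMap.toMatrix b b x = jordanMatrix κ l ↔ ∀ (i : Fin l.length) (t : Fin (l.get i)),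
      x (b ⟨i, t⟩) = if 0 < (t : ℕ) then b ⟨i, ⟨t - 1, by omega⟩⟩ else 0 := by
  have key : ∀ (i k : Fin l.length) (s : Fin (l.get i)) (t : Fin (l.get k)),
      b.repr (if 0 < (t : ℕ) then b ⟨k, ⟨t - 1, by omega⟩⟩ else 0) ⟨i, s⟩ =
        jordanMatrix κ l ⟨i, s⟩ ⟨k, t⟩ := by
    intro i k s t
    rw [jordanMatrix_apply]
    by_cases ht : 0 < (t : ℕ)
    · rw [if_pos ht, Basis.repr_self, Finsupp.single_apply]
      congr 1
      by_cases h : i = k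
      · subst h
        simp only [Sigma.mk.injEq, heq_eq_eq, true_and, Fin.ext_iff, eq_iff_iff]
        omega
      · simp [h, Ne.symm h]
    · rw [if_neg ht, map_zero, if_neg (by omega)]
      rfl
  constructor
  · intro h k t
    apply b.repr.injective
    ext ⟨i, s⟩
    rw [key, ← h, LinearMap.toMatrix_apply]
  · intro h
    ext ⟨i, s⟩ ⟨k, t⟩
    rw [LinearMap.toMatrix_apply, h, key]

/-- The kernel of `x ^ j` in terms of a Jordan basis. -/
theorem kerDim_of_chain [FiniteDimensional κ V] {l : List ℕ}
    (b : Basis (Σ i : Fin l.length, Fin (l.get i)) κ V) {x : End κ V}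
    (hx : ∀ (i : Fin l.length) (t : Fin (l.get i)),
      x (b ⟨i, t⟩) = if 0 < (t : ℕ) then b ⟨i, ⟨t - 1, by omega⟩⟩ else 0) (j : ℕ) :
    kerDim x j = kerSum (l : Multiset ℕ) j := by
  have hpow : ∀ (j : ℕ) (i : Fin l.length) (t : Fin (l.get i)),
      (x ^ j) (b ⟨i, t⟩) = if j ≤ (t : ℕ) then b ⟨i, ⟨t - j, by omega⟩⟩ else 0 := by
    intro j
    induction j with
    | zero => intro i t; simp
    | succ j ih =>
      intro i t
      rw [pow_succ', Module.End.mul_apply, ih]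
      by_cases h1 : j ≤ (t : ℕ)
      · rw [if_pos h1, hx]
        by_cases h2 : j + 1 ≤ (t : ℕ)
        · rw [if_pos h2, if_pos (by simp only; omega)]
          congr 3
        · rw [if_neg h2, if_neg (by simp only; omega)]
      · rw [if_neg h1, map_zero, if_neg (by omega)]
  have hcard : finrank κ V = ∑ i : Fin l.length, l.get i := by
    rw [finrank_eq_card_basis b, Fintype.card_sigma]
    simp
  let f : (Σ i : Fin l.length, Fin (l.get i - j)) → Σ i : Fin l.length, Fin (l.get i) :=
    fun p => ⟨p.1, ⟨p.2, by omega⟩⟩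
  have hf : Function.Injective f := by
    rintro ⟨i, s⟩ ⟨k, t⟩ h
    simp only [f, Sigma.mk.injEq] at h
    obtain ⟨rfl, h⟩ := h
    simp only [heq_eq_eq, Fin.mk.injEq] at h
    rw [Fin.ext h]
  have hrange : LinearMap.range (x ^ j) = Submodule.span κ (Set.range (b ∘ f)) := by
    apply le_antisymm
    · rw [LinearMap.range_eq_map, ← b.span_eq, Submodule.map_span_le]
      rintro _ ⟨⟨i, t⟩, rfl⟩
      rw [hpow]
      split_ifs with h
      · exact Submodule.subset_span ⟨⟨i, ⟨t - j, by omega⟩⟩, rfl⟩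
      · exact zero_mem _
    · rw [Submodule.span_le]
      rintro _ ⟨⟨i, t⟩, rfl⟩
      refine ⟨b ⟨i, ⟨t + j, by omega⟩⟩, ?_⟩
      rw [hpow, if_pos (by simp)]
      simp [f]
  have hrank : finrank κ (LinearMap.range (x ^ j)) = ∑ i : Fin l.length, (l.get i - j) := by
    rw [hrange, finrank_span_eq_card (b.linearIndependent.comp f hf), Fintype.card_sigma]
    simp
  have h1 := kerDim_add_range x j
  have h2 : kerSum (l : Multiset ℕ) j = ∑ i : Fin l.length, min (l.get i) j := by
    rw [kerSum, Multiset.map_coe, Multiset.sum_coe, ← List.sum_ofFn]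
    congr 1
    conv_lhs => rw [← List.ofFn_get l]
    rw [List.map_ofFn]
    rfl
  have h3 : ∑ i : Fin l.length, l.get i =
      ∑ i : Fin l.length, min (l.get i) j + ∑ i : Fin l.length, (l.get i - j) := by
    rw [← Finset.sum_add_distrib]
    exact Finset.sum_congr rfl fun i _ => by omega
  omega

/-- The partition of `x` determines the dimensions of the kernels of its powers. -/
theorem HasPartition.kerDim_eq {n : ℕ} {x : NilCone n κ} {π : (2 * n).Partition}
    (h : HasPartition x π) : kerDim (Matrix.toLin' x.1) = kerSum π.parts := by
  obtain ⟨l, hl, b, hb⟩ := h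
  rw [← hl]
  exact funext (kerDim_of_chain b ((toMatrix_eq_jordanMatrix_iff b _).1 hb))

/-- Accessible orbits are related by moves. -/
theorem Accessible.move [IsAlgClosed κ] (h2 : (2 : κ) ≠ 0) {n : ℕ} {x y : NilCone n κ}
    {π ρ : (2 * n).Partition} (hx : HasPartition x π) (hy : HasPartition y ρ)
    (h : Accessible x y) : Relation.ReflTransGen Move π ρ := by
  have h1 := h.reach h2
  rw [hx.kerDim_eq, hy.kerDim_eq] at h1
  obtain ⟨σ, hσ, hr⟩ := h1.exists_partition π fun j hj => mult_kerSum _ hj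
  rwa [eq_of_cnt (π := ρ) (ρ := σ) fun j hj => by rw [← hσ j hj, mult_kerSum _ hj]]

end

/-! ### Accessibility of moves -/

section

open Module Matrix

variable {κ : Type*} [Field κ] {n : ℕ}

theorem Replaces.cnt_le {N : ℕ} {S T : Multiset ℕ} {π ρ : N.Partition} (h : Replaces S T π ρ) :
    ∀ j, 1 ≤ j → cnt S j ≤ cnt π.parts j := by
  obtain ⟨μ, hμ, -⟩ := h
  intro j hj
  rw [hμ, cnt_filter _ hj, cnt_add]
  simp [cnt]

theorem Replaces.kerSum_add {N : ℕ} {S T : Multiset ℕ} {π ρ : N.Partition}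
    (h : Replaces S T π ρ) (j : ℕ) :
    kerSum π.parts j + kerSum T j = kerSum ρ.parts j + kerSum S j := by
  obtain ⟨μ, hμ, hμ'⟩ := h
  rw [hμ, hμ', kerSum_filter, kerSum_filter, SympAccess.kerSum_add, SympAccess.kerSum_add]
  ring

/-- Orbits of the same Jordan type are related by the trivial cocharacter. -/
theorem oneAccessible_of_kerDim [IsAlgClosed κ] (h2 : (2 : κ) ≠ 0) {x y : NilCone n κ}
    (h : kerDim (toLin' x.1) = kerDim (toLin' y.1)) : OneAccessible x y := by
  refine oneAccessible_of_isoStable h2 (F := ⊥) ⟨fun a ha b _ => ?_, fun a ha => ?_⟩ fun j => ?_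
  · rw [(Submodule.mem_bot κ).1 ha, map_zero, LinearMap.zero_apply]
  · rw [(Submodule.mem_bot κ).1 ha, map_zero]
    exact zero_mem _
  · rw [kerDimOn, bot_inf_eq, finrank_bot, kerDimQuot_bot, h]
    simp

/-- Every move is realized by a limit along a cocharacter. -/
theorem Move.exists_oneAccessible [IsAlgClosed κ] (h2 : (2 : κ) ≠ 0) {x : NilCone n κ}
    {π ρ : (2 * n).Partition} (hx : kerDim (toLin' x.1) = kerSum π.parts) (h : Move π ρ) :
    ∃ y, OneAccessible x y ∧ kerDim (toLin' y.1) = kerSum ρ.parts := by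
  have hs := isSN_toLin' x
  have main : ∃ S T F, Replaces S T π ρ ∧ Realizes (spForm n κ) (toLin' x.1) S T F := by
    have hle : ∀ {S T}, Replaces S T π ρ →
        ∀ j, 1 ≤ j → cnt S j ≤ mult (kerDim (toLin' x.1)) j := fun hr j hj => by
      rw [hx, mult_kerSum _ hj]
      exact hr.cnt_le j hj
    rcases h with ⟨a, b, hab, hr⟩ | ⟨a, m, ham, hr⟩ | ⟨m, a, ham, hr⟩ | ⟨m, k, hmk, hr⟩
    · obtain ⟨F, hF⟩ := exists_realizes_move1 h2 hs hab (hle hr)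
      exact ⟨_, _, F, hr, hF⟩
    · obtain ⟨F, hF⟩ := exists_realizes_move2 h2 hs ham (hle hr)
      exact ⟨_, _, F, hr, hF⟩
    · obtain ⟨F, hF⟩ := exists_realizes_move3 h2 hs ham (hle hr)
      exact ⟨_, _, F, hr, hF⟩
    · obtain ⟨F, hF⟩ := exists_realizes_move4 h2 hs hmk (hle hr)
      exact ⟨_, _, F, hr, hF⟩
  obtain ⟨S, T, F, hr, hF, hk⟩ := main
  obtain ⟨z, p, q, r, h, rfl⟩ := exists_degen h2 hs hF
  have hz := h.isSN hs
  have hy : ∀ j, kerDim (toLin' (NilCone.ofEnd z hz).1) j =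
      2 * kerDimOn (toLin' x.1) (LinearMap.range p) j +
        kerDimQuot (spForm n κ) (toLin' x.1) (LinearMap.range p) j := fun j => by
    rw [NilCone.toLin'_ofEnd, h.kerDim_eq hs]
  refine ⟨NilCone.ofEnd z hz, oneAccessible_of_isoStable h2 hF hy, funext fun j => ?_⟩
  have h3 := hk j
  have h4 := hr.kerSum_add j
  rw [← hy j, hx] at h3
  omega

/-- Orbits related by moves are accessible. -/
theorem accessible_of_move [IsAlgClosed κ] (h2 : (2 : κ) ≠ 0) {x y : NilCone n κ}
    {π ρ : (2 * n).Partition} (hx : HasPartition x π) (hy : HasPartition y ρ)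
    (h : Relation.ReflTransGen Move π ρ) : Accessible x y := by
  have main : ∃ z, Accessible x z ∧ kerDim (toLin' z.1) = kerSum ρ.parts := by
    clear hy
    induction h with
    | refl => exact ⟨x, Relation.ReflTransGen.refl, hx.kerDim_eq⟩
    | tail _ hm ih =>
      obtain ⟨z, hz, hk⟩ := ih
      obtain ⟨z', hz', hk'⟩ := hm.exists_oneAccessible h2 hk
      exact ⟨z', hz.tail hz', hk'⟩
  obtain ⟨z, hz, hk⟩ := main
  exact hz.tail (oneAccessible_of_kerDim h2 (hk.trans hy.kerDim_eq.symm))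

end

/-! ### Moves and the dominance order -/

section

theorem sum_sub_add_kerSum (A : Multiset ℕ) (j : ℕ) :
    (A.map fun p => p - j).sum + kerSum A j = A.sum := by
  induction A using Multiset.induction_on with
  | empty => rfl
  | cons a A ih =>
    rw [Multiset.map_cons, Multiset.sum_cons, kerSum_cons, Multiset.sum_cons]
    omega

/-- One half of the formula for the sum of the `k` largest parts as a minimum over `j`. -/
theorem sum_take_le (L : List ℕ) (j : ℕ) :
    ∀ k, (L.take k).sum ≤ j * k + (L.map fun p => p - j).sum := by
  induction L with
  | nil => simp
  | cons a L ih =>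
    intro k
    cases k with
    | zero => simp
    | succ k =>
      have := ih k
      simp only [List.take_succ_cons, List.sum_cons, List.map_cons]
      rw [Nat.mul_succ]
      omega

/-- The other half: for a decreasing list the minimum is attained at the `k`th part. -/
theorem exists_le_sum_take (L : List ℕ) (hL : L.Pairwise (· ≥ ·)) :
    ∀ k M, (∀ p ∈ L, p ≤ M) → ∃ j ≤ M, j * k + (L.map fun p => p - j).sum ≤ (L.take k).sum := by
  induction L with
  | nil => exact fun k M _ => ⟨0, Nat.zero_le _, by simp⟩
  | cons a L ih =>
    intro k M hM
    rw [List.pairwise_cons] at hL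
    cases k with
    | zero =>
      refine ⟨M, le_rfl, ?_⟩
      have : ((a :: L).map fun p => p - M).sum = 0 := by
        rw [List.sum_eq_zero_iff]
        intro q hq
        obtain ⟨p, hp, rfl⟩ := List.mem_map.1 hq
        exact Nat.sub_eq_zero_of_le (hM p hp)
      rw [this]
      simp
    | succ k =>
      obtain ⟨j, hj, h⟩ := ih hL.2 k a hL.1
      refine ⟨j, hj.trans (hM a List.mem_cons_self), ?_⟩
      simp only [List.take_succ_cons, List.sum_cons, List.map_cons]
      rw [Nat.mul_succ]
      omega

/-- The sum of the `k` largest parts is the minimum over `j` of `j * k + ∑ (p - j)`, so larger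
values of `kerSum` give smaller partitions in the dominance order. -/
theorem dominates_of_kerSum_le {N : ℕ} {π ρ : N.Partition}
    (h : ∀ j, kerSum π.parts j ≤ kerSum ρ.parts j) : Dominates π ρ := by
  intro k
  obtain ⟨j, -, hj⟩ := exists_le_sum_take (π.parts.sort (· ≥ ·)) (Multiset.pairwise_sort _ _) k
    π.parts.sum fun p hp => Multiset.single_le_sum (fun _ _ => Nat.zero_le _) p
      (by simpa using hp)
  have h1 := sum_take_le (ρ.parts.sort (· ≥ ·)) j k
  have e : ∀ σ : N.Partition, ((σ.parts.sort (· ≥ ·)).map fun p => p - j).sum =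
      (σ.parts.map fun p => p - j).sum := fun σ => by
    rw [← Multiset.sum_coe, ← Multiset.map_coe, Multiset.sort_eq]
  rw [e] at hj h1
  have h2 := sum_sub_add_kerSum π.parts j
  have h3 := sum_sub_add_kerSum ρ.parts j
  have h4 := h j
  rw [π.parts_sum] at h2
  rw [ρ.parts_sum] at h3
  unfold topSum
  omega

/-- Every move enlarges the kernels of powers and creates a pair of equal parts. -/
theorem Move.exists_replaces {N : ℕ} {π ρ : N.Partition} (h : Move π ρ) :
    ∃ S T, Replaces S T π ρ ∧ (∀ j, kerSum S j ≤ kerSum T j) ∧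
      ∃ j, 1 ≤ j ∧ cnt S j + 2 ≤ cnt T j := by
  rcases h with ⟨a, b, hab, hr⟩ | ⟨a, m, ham, hr⟩ | ⟨m, a, ham, hr⟩ | ⟨m, k, hmk, hr⟩
  · refine ⟨_, _, hr, fun j => ?_, a + b, by omega, ?_⟩
    · simp only [Multiset.insert_eq_cons, kerSum_cons, kerSum_singleton]
      omega
    · simp only [Multiset.insert_eq_cons, cnt_cons, cnt_singleton, ind]
      split_ifs <;> omega
  · refine ⟨_, _, hr, fun j => ?_, m + 1, by omega, ?_⟩
    · simp only [Multiset.insert_eq_cons, kerSum_cons, kerSum_singleton]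
      omega
    · simp only [Multiset.insert_eq_cons, cnt_cons, cnt_singleton, ind]
      split_ifs <;> omega
  · refine ⟨_, _, hr, fun j => ?_, m - 1, by omega, ?_⟩
    · simp only [Multiset.insert_eq_cons, kerSum_cons, kerSum_singleton]
      omega
    · simp only [Multiset.insert_eq_cons, cnt_cons, cnt_singleton, ind]
      split_ifs <;> omega
  · refine ⟨_, _, hr, fun j => ?_, m - 1, by omega, ?_⟩
    · simp only [Multiset.insert_eq_cons, kerSum_cons, kerSum_singleton]
      omega
    · simp only [Multiset.insert_eq_cons, cnt_cons, cnt_singleton, ind]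
      split_ifs <;> omega

theorem Replaces.cnt_eq {N : ℕ} {S T : Multiset ℕ} {π ρ : N.Partition} (h : Replaces S T π ρ)
    {j : ℕ} (hj : 1 ≤ j) : cnt ρ.parts j = cnt π.parts j - cnt S j + cnt T j := by
  obtain ⟨μ, hμ, hμ'⟩ := h
  rw [hμ, hμ', cnt_filter _ hj, cnt_filter _ hj, cnt_add, cnt_add]
  ring

theorem Move.kerSum_le {N : ℕ} {π ρ : N.Partition} (h : Move π ρ) (j : ℕ) :
    kerSum π.parts j ≤ kerSum ρ.parts j := by
  obtain ⟨S, T, hr, hle, -⟩ := h.exists_replaces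
  have h1 := hr.kerSum_add j
  have h2 := hle j
  omega

/-- Every move creates a pair of equal parts. -/
theorem Move.exists_add_two_le {N : ℕ} {π ρ : N.Partition} (h : Move π ρ) :
    ∃ j, 1 ≤ j ∧ cnt π.parts j + 2 ≤ cnt ρ.parts j := by
  obtain ⟨S, T, hr, -, j, hj, h⟩ := h.exists_replaces
  refine ⟨j, hj, ?_⟩
  rw [hr.cnt_eq hj]
  linarith

theorem Move.ne {N : ℕ} {π ρ : N.Partition} (h : Move π ρ) : π ≠ ρ := by
  rintro rfl
  obtain ⟨j, -, hj⟩ := h.exists_add_two_le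
  omega

theorem reflTransGen_move_kerSum_le {N : ℕ} {π ρ : N.Partition}
    (h : Relation.ReflTransGen Move π ρ) (j : ℕ) : kerSum π.parts j ≤ kerSum ρ.parts j := by
  induction h with
  | refl => exact le_rfl
  | tail _ hm ih => exact ih.trans (hm.kerSum_le j)

/-- A move of type 5 creates two distinct parts, so it is not a move of the other types. -/
theorem Move5.not_move {N : ℕ} {π ρ : N.Partition} (h : Move5 π ρ) : ¬ Move π ρ := by
  intro hm
  obtain ⟨r, s, hrs, hr⟩ := h
  obtain ⟨j, hj, hle⟩ := hm.exists_add_two_le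
  rw [hr.cnt_eq hj] at hle
  simp only [Multiset.insert_eq_cons, cnt_cons, cnt_singleton, ind] at hle
  split_ifs at hle <;> omega

/-- Accessibility between adjacent partitions would be given by a single move. -/
theorem not_accessible_of_move5 {κ : Type*} [Field κ] [IsAlgClosed κ] (h2 : (2 : κ) ≠ 0) {n : ℕ}
    {x y : NilCone n κ} {π ρ : (2 * n).Partition} (hx : HasPartition x π) (hy : HasPartition y ρ)
    (hadj : Adjacent π ρ) (h5 : Move5 π ρ) : ¬ Accessible x y := by
  intro hacc
  rcases (hacc.move h2 hx hy).cases_head with rfl | ⟨σ, hπσ, hσρ⟩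
  · exact hadj.2.1 rfl
  -- the partition after the first move is symplectic, hence equal to `ρ` by adjacency
  obtain ⟨z, -, hz⟩ := hπσ.exists_oneAccessible h2 hx.kerDim_eq
  have hσ : IsSymplectic σ := fun r hr => by
    have h1 := even_mult_of_odd h2 hr _ (isSN_toLin' z) le_rfl
    rw [hz, mult_kerSum _ hr.pos] at h1
    simpa [cnt] using h1
  rcases hadj.2.2 σ hσ (dominates_of_kerSum_le hπσ.kerSum_le)
    (dominates_of_kerSum_le (reflTransGen_move_kerSum_le hσρ)) with rfl | rfl
  · exact hπσ.ne rfl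
  · exact h5.not_move hπσ

end

/-! ### Closures of orbits -/

section

open Matrix

variable {κ : Type*} [Field κ] {n : ℕ}

/-- The conjugate of a nilpotent element by a symplectic matrix. -/
def NilCone.conj (g : symplecticGroup (Fin n) κ) (x : NilCone n κ) : NilCone n κ :=
  ⟨g.1 * x.1 * (g⁻¹ : symplecticGroup (Fin n) κ).1, by
    set G := g.1
    set G' := (g⁻¹ : symplecticGroup (Fin n) κ).1
    have hGG : G' * G = 1 := congrArg Subtype.val (inv_mul_cancel g)
    have hGG' : G * G' = 1 := congrArg Subtype.val (mul_inv_cancel g)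
    have hpow : ∀ k, (G * x.1 * G') ^ k = G * x.1 ^ k * G' := fun k => by
      induction k with
      | zero => simp [hGG']
      | succ k ih =>
        rw [pow_succ, ih, pow_succ]
        simp only [mul_assoc]
        rw [← mul_assoc G' G, hGG, one_mul]
    constructor
    · have h1 := mem_symplectic_iff.1 g.2
      have h2 := mem_sp_iff.1 x.2.1
      have h3 : ∀ u, toLin' G (toLin' G' u) = u := fun u => by
        rw [← toLin'_mul_apply, hGG', toLin'_one, LinearMap.id_apply]
      refine mem_sp_iff.2 fun u v => ?_
      rw [toLin'_mul_apply, toLin'_mul_apply, toLin'_mul_apply, toLin'_mul_apply]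
      conv_lhs => rw [← h3 v]
      conv_rhs => rw [← h3 u]
      rw [h1, h1, h2]
    · obtain ⟨k, hk⟩ := x.2.2
      exact ⟨k, by rw [hpow, hk, mul_zero, zero_mul]⟩⟩

theorem NilCone.conj_mem_orbit (g : symplecticGroup (Fin n) κ) (x : NilCone n κ) :
    x.conj g ∈ orbit x := ⟨g, rfl⟩

theorem mem_orbit_trans {x y z : NilCone n κ} (h1 : y ∈ orbit x) (h2 : z ∈ orbit y) :
    z ∈ orbit x := by
  obtain ⟨g, hg⟩ := h1
  obtain ⟨g', hg'⟩ := h2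
  refine ⟨g' * g, ?_⟩
  have h3 : (g' * g)⁻¹ = g⁻¹ * g'⁻¹ := _root_.mul_inv_rev _ _
  rw [hg', hg, h3]
  simp only [Submonoid.coe_mul, mul_assoc]

theorem mem_orbit_symm {x y : NilCone n κ} (h : y ∈ orbit x) : x ∈ orbit y := by
  obtain ⟨g, hg⟩ := h
  refine ⟨g⁻¹, ?_⟩
  have h1 : (g⁻¹ : symplecticGroup (Fin n) κ).1 * g.1 = 1 :=
    congrArg Subtype.val (inv_mul_cancel g)
  rw [hg, inv_inv, ← mul_assoc, ← mul_assoc, h1, one_mul, mul_assoc, h1, mul_one]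

theorem OrbitLE.trans {x y z : NilCone n κ} (h1 : OrbitLE y x) (h2 : OrbitLE z y) : OrbitLE z x :=
  Set.Subset.trans h2 h1

/-- A curve in the orbit of `x`, defined away from `0`, has its value at `0` in the closure of this
orbit; the same holds for the conjugates of this value. -/
theorem orbitLE_of_family [Infinite κ] {x y : NilCone n κ}
    (P : Matrix (Fin n ⊕ Fin n) (Fin n ⊕ Fin n) (Polynomial κ))
    (hP : ∀ a : κˣ, ∃ w ∈ orbit x, w.1 = P.map (Polynomial.eval (a : κ)))
    (h0 : P.map (Polynomial.eval 0) = y) : OrbitLE y x := by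
  intro v hv f hf
  refine hv f fun w hw => ?_
  obtain ⟨g, hg⟩ := hw
  set G := g.1
  set G' := (g⁻¹ : symplecticGroup (Fin n) κ).1
  set Q := G.map Polynomial.C * P * G'.map Polynomial.C with hQ
  have hQev : ∀ t : κ, Q.map (Polynomial.eval t) = G * P.map (Polynomial.eval t) * G' := fun t => by
    ext i j
    simp [hQ, Matrix.mul_apply, Polynomial.eval_finsetSum]
  set q : Polynomial κ := MvPolynomial.aeval (fun ij : (Fin n ⊕ Fin n) × (Fin n ⊕ Fin n) =>
    Q ij.1 ij.2) f with hq
  have hqev : ∀ t : κ, q.eval t =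
      MvPolynomial.eval (fun ij => (Q.map (Polynomial.eval t)) ij.1 ij.2) f := fun t => by
    rw [hq, MvPolynomial.aeval_def, ← Polynomial.coe_evalRingHom, MvPolynomial.hom_eval₂]
    have : (Polynomial.evalRingHom t).comp (algebraMap κ (Polynomial κ)) = RingHom.id κ := by
      ext c
      simp
    rw [this]
    rfl
  have hq0 : q = 0 := eq_zero_of_eval_units fun a => by
    obtain ⟨w, hw, hwP⟩ := hP a
    have := hf (w.conj g) (mem_orbit_trans hw (w.conj_mem_orbit g))
    rw [hqev, hQev, ← hwP]
    exact this
  have h1 := hqev 0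
  rw [hq0, hQev, h0, Polynomial.eval_zero] at h1
  rw [hg]
  exact h1.symm

theorem OneAccessible.orbitLE [Infinite κ] {x y : NilCone n κ} (h : OneAccessible x y) :
    OrbitLE y x := by
  obtain ⟨c, z, ⟨P, hP, hP0⟩, hz⟩ := h
  have h1 : OrbitLE z x :=
    orbitLE_of_family P (fun a => ⟨x.conj (c.toHom a), x.conj_mem_orbit _, (hP a).symm⟩) hP0
  refine h1.trans fun v hv f hf => hv f fun w hw => hf w ?_
  exact mem_orbit_trans (mem_orbit_symm hz) hw

theorem Accessible.orbitLE [Infinite κ] {x y : NilCone n κ} (h : Accessible x y) :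
    OrbitLE y x := by
  induction h with
  | refl => exact subset_rfl
  | tail _ hs ih => exact ih.trans hs.orbitLE

end

/-! ### A degeneration that is not accessible -/

section

open Module

section

variable {κ : Type*} [Field κ] {V : Type*} [AddCommGroup V] [Module κ V]

/-- Vectors whose cyclic subspaces span `V`, of orders adding up to the dimension, give a Jordan
basis. -/
theorem exists_jordan_basis {x : End κ V} (l : List ℕ) (u : Fin l.length → V)
    (hu : ∀ i, (x ^ l.get i) (u i) = 0)
    (hspan : ∀ W : Submodule κ V, (∀ i, cyc x (u i) ≤ W) → W = ⊤)
    (hd : finrank κ V = ∑ i, l.get i) :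
    ∃ b : Basis (Σ i : Fin l.length, Fin (l.get i)) κ V,
      LinearMap.toMatrix b b x = jordanMatrix κ l := by
  let f : (Σ i : Fin l.length, Fin (l.get i)) → V := fun p => (x ^ (l.get p.1 - 1 - p.2)) (u p.1)
  have htop : Submodule.span κ (Set.range f) = ⊤ := by
    refine hspan _ fun i => cyc_le.2 fun k => ?_
    rcases Nat.lt_or_ge k (l.get i) with hk | hk
    · refine Submodule.subset_span ⟨⟨i, ⟨l.get i - 1 - k, by omega⟩⟩, ?_⟩
      change (x ^ (l.get i - 1 - (l.get i - 1 - k))) (u i) = _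
      congr 2
      omega
    · rw [pow_apply_eq_zero (hu i) hk]
      exact zero_mem _
  have hcard : Fintype.card (Σ i : Fin l.length, Fin (l.get i)) = finrank κ V := by
    rw [hd, Fintype.card_sigma]
    simp
  refine ⟨basisOfTopLeSpanOfCardEqFinrank f htop.ge hcard,
    (toMatrix_eq_jordanMatrix_iff _ _).2 fun i t => ?_⟩
  rw [coe_basisOfTopLeSpanOfCardEqFinrank]
  change x ((x ^ (l.get i - 1 - t)) (u i)) = if 0 < (t : ℕ) then
    (x ^ (l.get i - 1 - (t - 1))) (u i) else 0
  rw [← Module.End.mul_apply, ← pow_succ']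
  split_ifs with ht
  · congr 2
    omega
  · exact pow_apply_eq_zero (hu i) (by omega)

end

open Matrix

variable {κ : Type*} [Field κ]

/-- If all nonzero entries of `M` raise the value of `d`, those of `M ^ k` raise it by `k`. -/
theorem pow_apply_ne_zero_le {I : Type*} [Fintype I] [DecidableEq I] {M : Matrix I I κ} (d : I → ℕ)
    (hM : ∀ p q, M p q ≠ 0 → d q + 1 ≤ d p) (k : ℕ) :
    ∀ p q, (M ^ k) p q ≠ 0 → d q + k ≤ d p := by
  induction k with
  | zero =>
    intro p q h
    rw [pow_zero] at h
    have : p = q := by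
      by_contra hne
      exact h (Matrix.one_apply_ne hne)
    rw [this]
    simp
  | succ k ih =>
    intro p q h
    rw [pow_succ, Matrix.mul_apply] at h
    obtain ⟨r, -, hr⟩ := Finset.exists_ne_zero_of_sum_ne_zero h
    have h1 := ih p r (left_ne_zero_of_mul hr)
    have h2 := hM r q (right_ne_zero_of_mul hr)
    omega

/-- The family of matrices acting on the standard basis `e i`, `f i` by
`e 0 ↦ t e 1 + f 0`, `e i ↦ e (i + 1)`, `e (n - 1) ↦ f (n - 1)`, `f i ↦ -f (i - 1)`,
`f 1 ↦ -t f 0`, `f 0 ↦ 0`. For `t ≠ 0` this is a regular nilpotent element; for `t = 0` there are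
two Jordan blocks, of sizes `2n - 2` and `2`. -/
def curve (R : Type*) [CommRing R] (n : ℕ) (t : R) : Matrix (Fin n ⊕ Fin n) (Fin n ⊕ Fin n) R :=
  let A : Matrix (Fin n) (Fin n) R :=
    Matrix.of fun k i => if (k : ℕ) = i + 1 then if (i : ℕ) = 0 then t else 1 else 0
  Matrix.fromBlocks A 0
    (Matrix.of fun k i => if k = i ∧ ((i : ℕ) = 0 ∨ (i : ℕ) + 1 = n) then 1 else 0) (-Aᵀ)

theorem curve_mem_sp (n : ℕ) (t : κ) : curve κ n t ∈ LieAlgebra.Symplectic.sp (Fin n) κ := by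
  rw [LieAlgebra.Symplectic.sp, mem_skewAdjointMatricesLieSubalgebra,
    mem_skewAdjointMatricesSubmodule]
  change (curve κ n t)ᵀ * Matrix.J (Fin n) κ = Matrix.J (Fin n) κ * (-curve κ n t)
  rw [curve, Matrix.J, Matrix.fromBlocks_transpose, Matrix.fromBlocks_multiply,
    Matrix.fromBlocks_neg, Matrix.fromBlocks_multiply]
  simp only [Matrix.transpose_zero, Matrix.transpose_neg, Matrix.transpose_transpose, mul_zero,
    mul_one, zero_add, zero_mul, neg_zero, mul_neg, neg_mul, one_mul, neg_neg, add_zero]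
  congr 1
  ext i j
  simp only [Matrix.transpose_apply, Matrix.of_apply]
  by_cases h : i = j
  · rw [h]
  · rw [if_neg fun h' => h h'.1.symm, if_neg fun h' => h h'.1]

theorem curve_eval (n : ℕ) (t : κ) :
    (curve (Polynomial κ) n Polynomial.X).map (Polynomial.eval t) = curve κ n t := by
  ext (p | p) (q | q) <;> simp only [curve, Matrix.map_apply, Matrix.fromBlocks_apply₁₁,
    Matrix.fromBlocks_apply₁₂, Matrix.fromBlocks_apply₂₁, Matrix.fromBlocks_apply₂₂,
    Matrix.of_apply, Matrix.neg_apply, Matrix.transpose_apply, Matrix.zero_apply,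
    Polynomial.eval_zero, Polynomial.eval_neg, apply_ite (Polynomial.eval t), Polynomial.eval_X,
    Polynomial.eval_one]

/-- The position of a standard basis vector in the order `e 0, …, e (n - 1), f (n - 1), …, f 0`. -/
def height (n : ℕ) : Fin n ⊕ Fin n → ℕ
  | Sum.inl i => i
  | Sum.inr i => 2 * n - 1 - i

/-- The modification of `height` adapted to the two Jordan blocks of `curve κ n 0`. -/
def heightZero (n : ℕ) : Fin n ⊕ Fin n → ℕ
  | Sum.inl i => i
  | Sum.inr i => if (i : ℕ) = 0 then 1 else 2 * n - 1 - i

theorem curve_ne_zero (n : ℕ) (t : κ) (p q : Fin n ⊕ Fin n) (h : curve κ n t p q ≠ 0) :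
    height n q + 1 ≤ height n p := by
  rcases p with p | p <;> rcases q with q | q <;>
    simp only [curve, Matrix.fromBlocks_apply₁₁,
      Matrix.fromBlocks_apply₁₂, Matrix.fromBlocks_apply₂₁, Matrix.fromBlocks_apply₂₂,
      Matrix.of_apply, Matrix.neg_apply, Matrix.transpose_apply, Matrix.zero_apply, ne_eq,
      neg_eq_zero, ite_eq_right_iff, Classical.not_imp, height] at h ⊢
  · omega
  · exact (h trivial).elim
  · have := congrArg Fin.val h.1.1
    omega
  · omega

theorem curve_zero_ne_zero {n : ℕ} (hn : 2 ≤ n) (p q : Fin n ⊕ Fin n)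
    (h : curve κ n 0 p q ≠ 0) : heightZero n q + 1 ≤ heightZero n p := by
  rcases p with p | p <;> rcases q with q | q <;>
    simp only [curve, Matrix.fromBlocks_apply₁₁,
      Matrix.fromBlocks_apply₁₂, Matrix.fromBlocks_apply₂₁, Matrix.fromBlocks_apply₂₂,
      Matrix.of_apply, Matrix.neg_apply, Matrix.transpose_apply, Matrix.zero_apply, ne_eq,
      neg_eq_zero, ite_eq_right_iff, Classical.not_imp, heightZero] at h ⊢
  · omega
  · exact (h trivial).elim
  · have := congrArg Fin.val h.1.1
    split_ifs <;> omega
  · obtain ⟨h, h'⟩ := h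
    have hp : (p : ℕ) ≠ 0 := fun h0 => h' (if_pos h0)
    rw [if_neg hp, if_neg (by omega)]
    omega

/-- The element of the curve at `t`. -/
noncomputable def curveElem (n : ℕ) (t : κ) : NilCone n κ :=
  ⟨curve κ n t, curve_mem_sp n t, 2 * n, by
    ext p q
    by_contra h
    have := pow_apply_ne_zero_le _ (curve_ne_zero n t) _ p q h
    rcases p with p | p <;> simp only [height] at this <;> omega⟩

theorem toLin'_single {n : ℕ} {t : κ} {q : Fin n ⊕ Fin n} {v : Fin n ⊕ Fin n → κ}
    (hv : ∀ p, curve κ n t p q = v p) : Matrix.toLin' (curve κ n t) (Pi.single q 1) = v := by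
  rw [Matrix.toLin'_apply, Matrix.mulVec_single_one]
  exact funext hv

theorem toLin'_single_mem {n : ℕ} {t : κ} {W : Submodule κ (Fin n ⊕ Fin n → κ)}
    (hW : ∀ a ∈ W, Matrix.toLin' (curve κ n t) a ∈ W) {q : Fin n ⊕ Fin n}
    (hq : Pi.single q 1 ∈ W) {v : Fin n ⊕ Fin n → κ} (hv : ∀ p, curve κ n t p q = v p) : v ∈ W :=
  toLin'_single hv ▸ hW _ hq

theorem toLin'_single_inl_zero {n : ℕ} (hn : 2 ≤ n) (t : κ) :
    Matrix.toLin' (curve κ n t) (Pi.single (Sum.inl ⟨0, by omega⟩) 1) =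
      t • (Pi.single (Sum.inl ⟨1, by omega⟩) 1 : Fin n ⊕ Fin n → κ) +
        Pi.single (Sum.inr ⟨0, by omega⟩) 1 := by
  refine toLin'_single ?_
  rintro (p | p)
  · simp only [curve, Matrix.fromBlocks_apply₁₁, Matrix.of_apply, Pi.add_apply, Pi.smul_apply,
      Pi.single_apply, Sum.inl.injEq, reduceCtorEq, Fin.ext_iff, if_false, if_true, add_zero,
      zero_add, smul_eq_mul, mul_ite, mul_one, mul_zero]
  · simp only [curve, Matrix.fromBlocks_apply₂₁, Matrix.of_apply, Pi.add_apply, Pi.smul_apply,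
      Pi.single_apply, Sum.inr.injEq, reduceCtorEq, Fin.ext_iff, if_false, true_or, and_true,
      smul_zero, zero_add]

theorem toLin'_single_inr_zero {n : ℕ} (hn : 0 < n) (t : κ) :
    Matrix.toLin' (curve κ n t) (Pi.single (Sum.inr ⟨0, hn⟩) 1) = 0 := by
  refine toLin'_single ?_
  rintro (p | p)
  · rfl
  · simp only [curve, Matrix.fromBlocks_apply₂₂, Matrix.neg_apply, Matrix.transpose_apply,
      Matrix.of_apply, Pi.zero_apply]
    rw [if_neg (by omega), neg_zero]

section

variable {n : ℕ} {t : κ} {W : Submodule κ (Fin n ⊕ Fin n → κ)}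

/-- A stable subspace containing `e j` with `1 ≤ j` contains the rest of the chain
`e j, e (j + 1), …, e (n - 1), f (n - 1), …, f 1`. -/
theorem single_inl_mem (hW : ∀ a ∈ W, Matrix.toLin' (curve κ n t) a ∈ W) {j : ℕ} (hj : 1 ≤ j)
    (hjn : j < n) (h : (Pi.single (Sum.inl ⟨j, hjn⟩) 1 : Fin n ⊕ Fin n → κ) ∈ W) (k : ℕ) :
    ∀ hk : j + k < n, (Pi.single (Sum.inl ⟨j + k, hk⟩) 1 : Fin n ⊕ Fin n → κ) ∈ W := by
  induction k with
  | zero => exact fun _ => h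
  | succ k ih =>
    intro hk
    refine toLin'_single_mem hW (ih (by omega)) ?_
    rintro (p | p)
    · simp only [curve, Matrix.fromBlocks_apply₁₁, Matrix.of_apply, Pi.single_apply,
        Sum.inl.injEq, Fin.ext_iff]
      split_ifs <;> first | rfl | omega
    · simp only [curve, Matrix.fromBlocks_apply₂₁, Matrix.of_apply, Pi.single_apply,
        reduceCtorEq, Fin.ext_iff, if_false]
      exact if_neg (by omega)

theorem single_inr_mem (hW : ∀ a ∈ W, Matrix.toLin' (curve κ n t) a ∈ W) {j : ℕ} (hj : 1 ≤ j)
    (hjn : j < n) (h : (Pi.single (Sum.inl ⟨j, hjn⟩) 1 : Fin n ⊕ Fin n → κ) ∈ W) (k : ℕ) :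
    ∀ (i : ℕ) (hi : i < n), 1 ≤ i → i + k + 1 = n →
      (Pi.single (Sum.inr ⟨i, hi⟩) 1 : Fin n ⊕ Fin n → κ) ∈ W := by
  induction k with
  | zero =>
    intro i hi h1 hin
    have h2 := single_inl_mem hW hj hjn h (n - 1 - j) (by omega)
    refine toLin'_single_mem hW h2 ?_
    rintro (p | p)
    · simp only [curve, Matrix.fromBlocks_apply₁₁, Matrix.of_apply, Pi.single_apply,
        reduceCtorEq, if_false]
      exact if_neg (by omega)
    · simp only [curve, Matrix.fromBlocks_apply₂₁, Matrix.of_apply, Pi.single_apply,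
        Sum.inr.injEq, Fin.ext_iff]
      split_ifs <;> first | rfl | omega
  | succ k ih =>
    intro i hi h1 hin
    rw [← neg_mem_iff]
    refine toLin'_single_mem hW (ih (i + 1) (by omega) (by omega) (by omega)) ?_
    rintro (p | p)
    · simp only [curve, Matrix.fromBlocks_apply₁₂, Matrix.zero_apply, Pi.neg_apply,
        Pi.single_apply, reduceCtorEq, if_false, neg_zero]
    · simp only [curve, Matrix.fromBlocks_apply₂₂, Matrix.neg_apply, Matrix.transpose_apply,
        Matrix.of_apply, Pi.neg_apply, Pi.single_apply, Sum.inr.injEq, Fin.ext_iff]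
      split_ifs <;> first | rfl | omega

theorem eq_top_of_single_mem (hn : 2 ≤ n) (hW : ∀ a ∈ W, Matrix.toLin' (curve κ n t) a ∈ W)
    (h0 : (Pi.single (Sum.inl ⟨0, by omega⟩) 1 : Fin n ⊕ Fin n → κ) ∈ W)
    (h1 : (Pi.single (Sum.inl ⟨1, by omega⟩) 1 : Fin n ⊕ Fin n → κ) ∈ W)
    (h2 : (Pi.single (Sum.inr ⟨0, by omega⟩) 1 : Fin n ⊕ Fin n → κ) ∈ W) : W = ⊤ := by
  rw [eq_top_iff, ← (Pi.basisFun κ (Fin n ⊕ Fin n)).span_eq, Submodule.span_le]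
  rintro _ ⟨⟨i, hi⟩ | ⟨i, hi⟩, rfl⟩ <;> rw [Pi.basisFun_apply, SetLike.mem_coe] <;>
    rcases Nat.eq_zero_or_pos i with rfl | hi'
  · exact h0
  · have := single_inl_mem hW le_rfl (by omega) h1 (i - 1) (by omega)
    simpa only [Nat.add_sub_cancel' hi'] using this
  · exact h2
  · exact single_inr_mem hW le_rfl (by omega) h1 (n - 1 - i) i hi hi' (by omega)

end

/-- Away from `t = 0` the vector `e 0` generates the whole space. -/
theorem curveElem_hasPartition {n : ℕ} (hn : 3 ≤ n) {t : κ} (ht : t ≠ 0) :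
    HasPartition (curveElem n t) ⟨{2 * n}, by simp; omega, by simp⟩ := by
  refine ⟨[2 * n], rfl, exists_jordan_basis _
    (fun _ => Pi.single (Sum.inl ⟨0, by omega⟩) 1) (fun i => ?_) (fun W hW => ?_)
    (by simp [two_mul])⟩
  · obtain ⟨i, hi⟩ := i
    obtain rfl : i = 0 := by simpa using hi
    change (Matrix.toLin' (curve κ n t) ^ (2 * n)) _ = 0
    rw [← Matrix.toLin'_pow, Matrix.toLin'_apply, Matrix.mulVec_single_one]
    ext p
    by_contra h
    have := pow_apply_ne_zero_le _ (curve_ne_zero n t) _ p _ h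
    rcases p with p | p <;> simp only [height] at this <;> omega
  · have h := hW ⟨0, by simp⟩
    set x := Matrix.toLin' (curve κ n t) with hx
    set u : Fin n ⊕ Fin n → κ := Pi.single (Sum.inl ⟨0, by omega⟩) 1 with hu
    have hst := cyc_stable x u
    have h0 : u ∈ cyc x u := mem_cyc x u
    have h1 := hst _ h0
    rw [toLin'_single_inl_zero (by omega) t] at h1
    -- applying `x` once more kills the summand `f 0`
    have h2 : (Pi.single (Sum.inl ⟨2, by omega⟩) 1 : Fin n ⊕ Fin n → κ) ∈ cyc x u := by
      have h3 := hst _ h1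
      rw [map_add, map_smul, toLin'_single_inr_zero (by omega) t, add_zero,
        Submodule.smul_mem_iff _ ht] at h3
      refine Eq.mp ?_ h3
      congr 1
      refine toLin'_single ?_
      rintro (p | p)
      · simp [curve, Pi.single_apply, Fin.ext_iff]
      · simp only [curve, Matrix.fromBlocks_apply₂₁, Matrix.of_apply, Pi.single_apply,
          reduceCtorEq, Fin.ext_iff, if_false]
        exact if_neg (by rw [false_or]; omega)
    have h3 := single_inr_mem hst (by omega) _ h2 (n - 2) 1 (by omega) le_rfl (by omega)
    have h4 : (Pi.single (Sum.inr ⟨0, by omega⟩) 1 : Fin n ⊕ Fin n → κ) ∈ cyc x u := by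
      rw [← Submodule.smul_mem_iff _ (neg_ne_zero.2 ht)]
      refine toLin'_single_mem hst h3 ?_
      rintro (p | p)
      · simp [curve]
      · simp only [curve, Matrix.fromBlocks_apply₂₂, Matrix.neg_apply, Matrix.transpose_apply,
          Matrix.of_apply, Pi.smul_apply, Pi.single_apply, Sum.inr.injEq, Fin.ext_iff]
        split_ifs <;> first | omega | simp
    have h5 := (Submodule.add_mem_iff_left _ h4).1 h1
    rw [Submodule.smul_mem_iff _ ht] at h5
    exact top_le_iff.1 ((eq_top_of_single_mem (by omega) hst h0 h5 h4).ge.trans h)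

/-- At `t = 0` the vectors `e 1` and `e 0` generate Jordan blocks of sizes `2n - 2` and `2`. -/
theorem curveElem_zero_hasPartition {n : ℕ} (hn : 2 ≤ n) :
    HasPartition (curveElem n (0 : κ))
      ⟨{2 * n - 2, 2}, by simp; omega, by simp; omega⟩ := by
  refine ⟨[2 * n - 2, 2], rfl, exists_jordan_basis _
    (fun i => Pi.single (Sum.inl ⟨1 - i, by omega⟩) 1) (fun i => ?_) (fun W hW => ?_)
    (by simp; omega)⟩
  · obtain ⟨i, hi⟩ := i
    have hi' : i = 0 ∨ i = 1 := by simp at hi; omega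
    rcases hi' with rfl | rfl
    · change (Matrix.toLin' (curve κ n 0) ^ (2 * n - 2)) _ = 0
      rw [← Matrix.toLin'_pow, Matrix.toLin'_apply, Matrix.mulVec_single_one]
      ext p
      by_contra h
      have := pow_apply_ne_zero_le _ (curve_zero_ne_zero hn) _ p _ h
      rcases p with p | p <;> simp only [heightZero] at this
      · omega
      · split_ifs at this <;> omega
    · change (Matrix.toLin' (curve κ n 0) ^ 2) _ = 0
      rw [pow_two, Module.End.mul_apply]
      erw [toLin'_single_inl_zero hn (0 : κ)]
      rw [zero_smul, zero_add, toLin'_single_inr_zero]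
  · set x := Matrix.toLin' (curve κ n 0) with hx
    set e₀ : Fin n ⊕ Fin n → κ := Pi.single (Sum.inl ⟨0, by omega⟩) 1 with he₀
    set e₁ : Fin n ⊕ Fin n → κ := Pi.single (Sum.inl ⟨1, by omega⟩) 1 with he₁
    have hst := sup_stable (cyc_stable x e₁) (cyc_stable x e₀)
    have h0 : e₀ ∈ cyc x e₁ ⊔ cyc x e₀ := Submodule.mem_sup_right (mem_cyc x e₀)
    have h1 : e₁ ∈ cyc x e₁ ⊔ cyc x e₀ := Submodule.mem_sup_left (mem_cyc x e₁)
    have h2 := hst _ h0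
    rw [toLin'_single_inl_zero hn (0 : κ), zero_smul, zero_add] at h2
    exact top_le_iff.1 ((eq_top_of_single_mem hn hst h0 h1 h2).ge.trans
      (sup_le (hW ⟨0, by simp⟩) (hW ⟨1, by simp⟩)))

/-- The orbit with two Jordan blocks of sizes `2n - 2` and `2` lies in the closure of the regular
orbit, but no move ends at a partition with distinct parts. -/
theorem exists_not_accessible [IsAlgClosed κ] (h2 : (2 : κ) ≠ 0) {n : ℕ} (hn : 3 ≤ n) :
    ∃ (x y : NilCone n κ) (π ρ : (2 * n).Partition), HasPartition x π ∧
      HasPartition y ρ ∧ OrbitLE y x ∧ Dominates π ρ ∧ ¬ Accessible x y := by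
  have : Infinite κ := IsAlgClosed.instInfinite
  have hx := curveElem_hasPartition (κ := κ) hn one_ne_zero
  have hy := curveElem_zero_hasPartition (κ := κ) (n := n) (by omega)
  refine ⟨_, _, _, _, hx, hy, ?_, ?_, fun h => ?_⟩
  · refine orbitLE_of_family (curve _ n Polynomial.X) (fun a => ⟨curveElem n (a : κ), ?_, ?_⟩) ?_
    · refine mem_orbit_of_kerDim h2 ?_
      rw [hx.kerDim_eq, (curveElem_hasPartition hn a.ne_zero).kerDim_eq]
    · exact (curve_eval n (a : κ)).symm
    · exact curve_eval n 0
  · refine dominates_of_kerSum_le fun j => ?_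
    simp only [kerSum_singleton, Multiset.insert_eq_cons, kerSum_cons]
    omega
  · rcases Relation.ReflTransGen.cases_tail (h.move h2 hx hy) with h | ⟨σ, -, h⟩
    · have := congrArg (fun π : (2 * n).Partition => π.parts.card) h
      simp at this
    · obtain ⟨j, -, hj⟩ := h.exists_add_two_le
      simp only [cnt_singleton, Multiset.insert_eq_cons, cnt_cons, ind] at hj
      have : 0 ≤ cnt σ.parts j := Nat.cast_nonneg _
      split_ifs at hj <;> omega

end

end SympAccess

theorem mainTheorem2 (κ : Type*) [Field κ] [IsAlgClosed κ] (hchar : ringChar κ ≠ 2) (n : ℕ) :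
    -- accessibility is generated by the moves of type 1, 2, 3 and 4
    (∀ (x y : NilCone n κ) (π ρ : (2 * n).Partition), HasPartition x π → HasPartition y ρ →
      (Accessible x y ↔ Relation.ReflTransGen Move π ρ)) ∧
    -- move 5 between adjacent partitions is never realised
    (∀ (x y : NilCone n κ) (π ρ : (2 * n).Partition), HasPartition x π → HasPartition y ρ →
      Adjacent π ρ → Move5 π ρ → ¬ Accessible x y) ∧
    -- the accessibility order is contained in the dominance order
    (∀ (x y : NilCone n κ) (π ρ : (2 * n).Partition), HasPartition x π → HasPartition y ρ →
      Accessible x y → OrbitLE y x ∧ Dominates π ρ) ∧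
    -- and it is strictly smaller as soon as `2n ≥ 6`
    (3 ≤ n → ∃ (x y : NilCone n κ) (π ρ : (2 * n).Partition), HasPartition x π ∧
      HasPartition y ρ ∧ OrbitLE y x ∧ Dominates π ρ ∧ ¬ Accessible x y) := by
  have h2 : (2 : κ) ≠ 0 := Ring.two_ne_zero hchar
  have : Infinite κ := IsAlgClosed.instInfinite
  exact ⟨fun x y π ρ hx hy => ⟨fun h => h.move h2 hx hy, accessible_of_move h2 hx hy⟩,
    fun x y π ρ hx hy ha h5 => not_accessible_of_move5 h2 hx hy ha h5,
    fun x y π ρ hx hy h => ⟨h.orbitLE,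
      dominates_of_kerSum_le (reflTransGen_move_kerSum_le (h.move h2 hx hy))⟩,
    fun hn => exists_not_accessible h2 hn⟩
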